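/- Setting. Let $\mathcal S,\mathcal A$ be finite sets and $H\ge 1$. A non-stationary tabular MDP $M$ consists of an initial distribution $d_1$ on $\mathcal S$, transition probabilities $P_{t+1}(s'\mid s,a)$ and laws of noisy rewards $r_t$ given $(s_t,a_t,s_{t+1})=(s,a,s')$, for $t=1,\dots,H$; given the path of states and actions the rewards are independent. A policy $\pi$ gives distributions $\pi_t(\cdot\mid s)$ on $\mathcal A$, and generates trajectories $s_1\sim d_1$, $a_t\sim\pi_t(\cdot\mid s_t)$, $s_{t+1}\sim P_{t+1}(\cdot\mid s_t,a_t)$, with rewards $r_t$. Write $\pi(a\mid s)$ for $\pi_t(a\mid s)$ when $t$ is clear, let $d^\pi_t(s)$, $d^\pi_t(s,a)$ be the probabilities of $\{s_t=s\}$, $\{s_t=s,a_t=a\}$ under $\pi$, and put $v^\pi=\mathbb E_\pi[\sum_{t=1}^H r_t]$, $V^\pi_h(s)=\mathbb E_\pi[\sum_{t=h}^H r_t\mid s_h=s]$, $V^\pi_{H+1}\equiv 0$. Let $\mu$ (logging) and $\pi$ (target) be policies such that: (1) $0\le r_t\le R_{\max}$ almost surely for all $t$; (2) $d_m:=\min_{t\le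 H,s}d^\mu_t(s)>0$; (3) $\mu_t(a\mid s)>0$ for all $t,s,a$, so that the weights $\tau_s:=\max_{t\le H,s}d^\pi_t(s)/d^\mu_t(s)$ and $\tau_a:=\max_{t,s,a}\pi_t(a\mid s)/\mu_t(a\mid s)$ are finite and $\min_{t,s,a}d^\mu_t(s,a)>0$. Estimator. From $n$ i.i.d. episodes generated by $\mu$, let $n_{s_t,a_t}$ be the number of episodes with state $s_t$ and action $a_t$ at step $t$, let $\widehat P_{t+1}(s'\mid s_t,a_t)$ be the fraction of those whose next state is $s'$ and $\widehat r_t(s_t,a_t)$ the mean of their rewards at step $t$ (both $0$ if $n_{s_t,a_t}=0$). Let $\widehat d^\pi_1$ be the empirical distribution of $s_1$, $\widehat d^\pi_{t+1}(s')=\sum_{s,a}\widehat P_{t+1}(s'\mid s,a)\pi(a\mid s)\widehat d^\pi_t(s)$, and $$\widehat v^\pi_{\mathrm{TMIS}}=\sum_{t=1}^H\sum_s\widehat d^\pi_t(s)\sum_a\widehat r_t(s,a)\pi(a\mid s).$$ Theorem. Put $$\sigma^2:=\mathrm{Var}[V_1^\pi(s_1)]+\sum_{h=1}^H\sum_{s,a}\frac{d^\pi_h(s)^2}{d^\mu_h(s)}\,\frac{\pi(a\mid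 s)^2}{\mu(a\mid s)}\,\mathrm{Var}\big[V^\pi_{h+1}(s_{h+1})+r_h\,\big|\,s_h=s,a_h=a\big].$$ There is a universal constant $C$ such that in every such setting, for every $n$ with $$n>\max\left[\frac{16\log n}{\min_{t,s,a}d^\mu_t(s,a)},\ \frac{4H\tau_a\tau_s}{\min_{t\le H,s}\max\{d^\pi_t(s),d^\mu_t(s)\}}\right],$$ one has $$\mathbb E\big[(\widehat v^\pi_{\mathrm{TMIS}}-v^\pi)^2\big]\le\frac{\sigma^2}{n}\left(1+\sqrt{\frac{16\log n}{n\min_{t,s,a}d^\mu_t(s,a)}}\right)+C\,\frac{\tau_a^2\tau_sH^3R_{\max}^2}{n^2d_m}.$$ Moreover, $\lim_{n\to\infty}n\,\mathbb E\big[(\widehat v^\pi_{\mathrm{TMIS}}-v^\pi)^2\big]=\sigma^2$ in every such setting (asymptotic efficiency: $\sigma^2$ is the expression of the Cramér–Rao lower bound for this problem; that it is a lower bound is not part of the claim). -/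

import Mathlib

open MeasureTheory ProbabilityTheory Filter Topology

noncomputable section

/-- A non-stationary tabular MDP with horizon `H`. The index `t : Fin H` stands for time `t + 1`, and
states live at the times `1, …, H + 1`, indexed by `Fin (H + 1)`. `reward t s a s'` is the law of
the noisy reward collected at step `t` when action `a` is taken in state `s` and the next state
is `s'`. -/
structure TabularMDP (S A : Type*) [Fintype S] [Fintype A] (H : ℕ) where
  init : S → ℝ
  init_mem : init ∈ stdSimplex ℝ S
  trans : Fin H → S → A → S → ℝ
  trans_mem : ∀ t s a, trans t s a ∈ stdSimplex ℝ S
  reward : Fin H → S → A → S → Measure ℝ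
  reward_prob : ∀ t s a s', IsProbabilityMeasure (reward t s a s')

/-- A non-stationary policy: `prob t s a` is the probability of action `a` in state `s` at step `t`. -/
structure Policy (S A : Type*) [Fintype A] (H : ℕ) where
  prob : Fin H → S → A → ℝ
  prob_mem : ∀ t s, prob t s ∈ stdSimplex ℝ A

/-- Trajectories `(s₁, …, s_{H+1}), (a₁, …, a_H), (r₁, …, r_H)`. -/
abbrev Traj (S A : Type*) (H : ℕ) : Type _ :=
  (Fin (H + 1) → S) × (Fin H → A) × (Fin H → ℝ)

namespace Traj

variable {S A : Type*} {H : ℕ}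

def state (ω : Traj S A H) (t : Fin (H + 1)) : S := ω.1 t

def action (ω : Traj S A H) (t : Fin H) : A := ω.2.1 t

def rew (ω : Traj S A H) (t : Fin H) : ℝ := ω.2.2 t

end Traj

namespace TabularMDP

variable {S A : Type*} [Fintype S] [Fintype A] [MeasurableSpace S] [MeasurableSpace A] {H : ℕ}

/-- The law of a trajectory under the policy `π`: the path `(s, a)` has probability
`d₁(s₁) ∏ₜ πₜ(aₜ | sₜ) Pₜ(sₜ₊₁ | sₜ, aₜ)`, and given the path the rewards are independent
with laws `reward t sₜ aₜ sₜ₊₁`. -/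
def law (M : TabularMDP S A H) (π : Policy S A H) : Measure (Traj S A H) :=
  ∑ s : Fin (H + 1) → S, ∑ a : Fin H → A,
    ENNReal.ofReal (M.init (s 0) *
        ∏ t : Fin H, π.prob t (s t.castSucc) (a t) * M.trans t (s t.castSucc) (a t) (s t.succ)) •
      (Measure.pi fun t : Fin H => M.reward t (s t.castSucc) (a t) (s t.succ)).map
        (fun r => ((s, a, r) : Traj S A H))

/-- The marginal state distribution `d^π_t(s)`. -/
def stateOcc (M : TabularMDP S A H) (π : Policy S A H) (t : Fin (H + 1)) (s : S) : ℝ :=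
  (M.law π).real {ω | ω.state t = s}

/-- The marginal state-action distribution `d^π_t(s, a)`. -/
def stateActionOcc (M : TabularMDP S A H) (π : Policy S A H) (t : Fin H) (s : S) (a : A) : ℝ :=
  (M.law π).real {ω | ω.state t.castSucc = s ∧ ω.action t = a}

/-- The value `v^π = E_π[∑ₜ rₜ]`. -/
def value (M : TabularMDP S A H) (π : Policy S A H) : ℝ :=
  ∫ ω, ∑ t : Fin H, ω.rew t ∂(M.law π)

/-- The value function `V^π_h(s) = E_π[∑_{t ≥ h} rₜ | s_h = s]`; it vanishes at `h = H + 1`. (When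
`s` has probability zero at time `h` under `π` the conditional measure, hence the value, is `0`;
such values never contribute below.) -/
def valueFun (M : TabularMDP S A H) (π : Policy S A H) (h : Fin (H + 1)) (s : S) : ℝ :=
  ∫ ω, ∑ t : Fin H with h ≤ t.castSucc, ω.rew t ∂((M.law π)[|{ω | ω.state h = s}])

/-- `Var[V^π_{t+1}(s_{t+1}) + r_t | s_t = s, a_t = a]` for a trajectory logged by `μ`. -/
def stepVar (M : TabularMDP S A H) (π μ : Policy S A H) (t : Fin H) (s : S) (a : A) : ℝ :=
  Var[fun ω => M.valueFun π t.succ (ω.state t.succ) + ω.rew t;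
    (M.law μ)[|{ω | ω.state t.castSucc = s ∧ ω.action t = a}]]

/-- The leading coefficient
`∑_{h=0}^H ∑_{s,a} d^π_h(s)²/d^μ_h(s) · π(a|s)²/μ(a|s) · Var[V^π_{h+1}(s_{h+1}) + r_h | s, a]`.
Under the boundary conditions (ratios `1` and reward `0` at time `0`) the term `h = 0`
is `Var[V^π_1(s_1)]`. -/
def leadingVar (M : TabularMDP S A H) (π μ : Policy S A H) : ℝ :=
  Var[fun ω => M.valueFun π 0 (ω.state 0); M.law μ] +
    ∑ t : Fin H, ∑ s : S, ∑ a : A,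
      M.stateOcc π t.castSucc s ^ 2 / M.stateOcc μ t.castSucc s *
        (π.prob t s a ^ 2 / μ.prob t s a) * M.stepVar π μ t s a

/-- `min_{t,s,a} d^μ_t(s, a)`. -/
def minStateActionOcc (M : TabularMDP S A H) (μ : Policy S A H) : ℝ :=
  ⨅ x : Fin H × S × A, M.stateActionOcc μ x.1 x.2.1 x.2.2

/-- `d_m = min_{t,s} d^μ_t(s)`, over the times `t = 1, …, H`. -/
def minStateOcc (M : TabularMDP S A H) (μ : Policy S A H) : ℝ :=
  ⨅ x : Fin H × S, M.stateOcc μ x.1.castSucc x.2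

/-- `min_{t,s} max {d^π_t(s), d^μ_t(s)}`, over the times `t = 1, …, H`. -/
def minMaxOcc (M : TabularMDP S A H) (π μ : Policy S A H) : ℝ :=
  ⨅ x : Fin H × S, max (M.stateOcc π x.1.castSucc x.2) (M.stateOcc μ x.1.castSucc x.2)

/-- `τ_s = max_{t,s} d^π_t(s) / d^μ_t(s)`, over the times `t = 1, …, H`. -/
def stateWeight (M : TabularMDP S A H) (π μ : Policy S A H) : ℝ :=
  ⨆ x : Fin H × S, M.stateOcc π x.1.castSucc x.2 / M.stateOcc μ x.1.castSucc x.2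

end TabularMDP

/-- `τ_a = max_{t,s,a} π_t(a|s) / μ_t(a|s)`. -/
def actionWeight {S A : Type*} [Fintype A] {H : ℕ} (π μ : Policy S A H) : ℝ :=
  ⨆ x : Fin H × S × A, π.prob x.1 x.2.1 x.2.2 / μ.prob x.1 x.2.1 x.2.2

namespace TMIS

variable {S A : Type*} [DecidableEq S] [DecidableEq A] {H n : ℕ}

/-- `n_{s_t, a_t}`: the number of episodes that visit `(s, a)` at step `t`. -/
def count (D : Fin n → Traj S A H) (t : Fin H) (s : S) (a : A) : ℕ :=
  (Finset.univ.filter fun i => (D i).state t.castSucc = s ∧ (D i).action t = a).card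

/-- The empirical transition probability (`0` when `(s, a)` is not visited at step `t`). -/
def transHat (D : Fin n → Traj S A H) (t : Fin H) (s : S) (a : A) (s' : S) : ℝ :=
  ((Finset.univ.filter fun i =>
      (D i).state t.castSucc = s ∧ (D i).action t = a ∧ (D i).state t.succ = s').card : ℝ) /
    (count D t s a : ℝ)

/-- The empirical mean reward (`0` when `(s, a)` is not visited at step `t`). -/
def rewHat (D : Fin n → Traj S A H) (t : Fin H) (s : S) (a : A) : ℝ :=
  (∑ i with (D i).state t.castSucc = s ∧ (D i).action t = a, (D i).rew t) / (count D t s a : ℝ)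

variable [Fintype S] [Fintype A]

/-- The estimated marginal state distribution of `π`: empirical at time `1`, then propagated by
`P̂^π_{t+1}(s' | s) = ∑ₐ P̂_{t+1}(s' | s, a) π(a | s)`. -/
def occHat (π : Policy S A H) (D : Fin n → Traj S A H) (t : Fin (H + 1)) : S → ℝ :=
  Fin.induction (motive := fun _ => S → ℝ)
    (fun s => ((Finset.univ.filter fun i => (D i).state 0 = s).card : ℝ) / (n : ℝ))
    (fun t d s' => ∑ s : S, (∑ a : A, transHat D t s a s' * π.prob t s a) * d s) t

/-- The Tabular-MIS estimator `∑ₜ ∑ₛ d̂^π_t(s) r̂^π_t(s)`, with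
`r̂^π_t(s) = ∑ₐ r̂_t(s, a) π(a | s)`. -/
def estimator (π : Policy S A H) (D : Fin n → Traj S A H) : ℝ :=
  ∑ t : Fin H, ∑ s : S, occHat π D t.castSucc s * ∑ a : A, rewHat D t s a * π.prob t s a

/-- The mean-square error of the Tabular-MIS estimator built from `n` independent episodes
logged by `μ`. -/
def mse [MeasurableSpace S] [MeasurableSpace A] (M : TabularMDP S A H) (π μ : Policy S A H)
    (n : ℕ) : ℝ :=
  ∫ D, (estimator π D - M.value π) ^ 2 ∂(Measure.pi fun _ : Fin n => M.law μ)

end TMIS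

end

/-!
The estimator is the value of `π` in the empirical model. Write `V_k` for the value functions of `π`
and `d̂_t` for the estimated occupancies, and complete the rewards collected before time `k` by the
true values of the states from then on (`estError`):
`Z_k = ∑_{t < k} ∑_{s, a} d̂_t(s) π(a|s) r̂_t(s, a) + ∑_s d̂_k(s) V_k(s) - v`.
Then `Z_0` is the error of a sample mean, with variance `Var[V_0(s_0)] / n`, and the last `Z_k` is the
error of the estimator. By the Bellman equation, as soon as all pairs are visited, `Z_{t+1} - Z_t` is a
combination of the deviations `V_{t+1}(s_{t+1}) + r_t - E[V_{t+1}(s_{t+1}) + r_t | s_t, a_t]` of the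
episodes, with coefficients `d̂_t(s_t) π(a_t|s_t) / n_{s_t, a_t}` that depend only on the data up to the
choice of `a_t`. Given those data, the deviations are centred and independent between episodes
(`integral_sq_add_sum_noise`), so second moments add up: step `t` contributes
`∑_{s, a} π(a|s)² Var[V_{t+1} + r_t | s, a] E[d̂_t(s)² / n_{s, a}]`.

To keep the inverse counts under control everything is multiplied by the indicator `good` that each
pair has been visited at least a third as often as expected before the time in question. It too depends
only on the data up to the choice of `a_t`, and it fails with probability `O(H / n²)` (`failProb_le`,
`large_sample`), a failure which costs at most `(H R)²`.

For the upper bound, a Chernoff bound replaces `1 / n_{s, a}` by `(1 + 2 δ) / (n d^μ(s, a))` up to an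
event of probability `n⁻²` (`visitMoment_le`), and it remains to show
`E[d̂_t(s)²] ≤ d_t(s)² + 12 τ_a τ_s d_t(s) / n` on the event `good`. For that, the stronger inequality
`E[(∑ d̂_t φ)²] ≤ (∑ d_t φ)² + (12 τ_a τ_s / n) ∑ d_t φ²` for all `φ` is stable under one step: the
backward operator turns `∑ d_t φ²` into `∑ d_t (E[φ | s])²`, and the conditional variance that is lost
is what pays for the deviations of the new step (`integral_sq_sum_occHat_le`).

For the limit, `x² / y ≥ 2 l x - l² y` bounds `E[d̂_t(s)² / n_{s, a}]` from below by the means of `d̂_t(s)`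
and `n_{s, a}` (`le_visitMoment`), and `d̂_t` restricted to `good` is unbiased up to the failure
probability (`le_integral_sum_occHat`), so `n` times the mean square error is at least the leading
coefficient up to `O(n)` times that probability (`le_mse`), hence up to `O(1 / n)`.

Rewards are truncated to `[0, R]` throughout, which changes nothing almost surely and makes all random
variables bounded. The independence of past and future is used in the form of `integral_mul_step`, for
functions that are constant on trajectories with the same history, rather than through
conditional expectations.
-/

set_option linter.unusedSectionVars false

/-! ### Bounded measurable functions of a history -/

/-- `f` is a bounded measurable function whose value is the same on any two points related by `r`.
With `r` the relation "same history up to step `t`" this encodes that `f` is a bounded random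
variable known at step `t`; with `r = Eq` the last condition is void. -/
structure HistoryFun {Ω : Type*} [MeasurableSpace Ω] (r : Ω → Ω → Prop) (f : Ω → ℝ) : Prop where
  meas : Measurable f
  bdd : ∃ B, ∀ ω, |f ω| ≤ B
  dep : ∀ ω ω', r ω ω' → f ω = f ω'

namespace HistoryFun

variable {Ω : Type*} [MeasurableSpace Ω] {r : Ω → Ω → Prop} {f g : Ω → ℝ}

lemma const (c : ℝ) : HistoryFun r (fun _ => c) :=
  ⟨measurable_const, ⟨|c|, fun _ => le_rfl⟩, fun _ _ _ => rfl⟩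

lemma mono {r' : Ω → Ω → Prop} (hf : HistoryFun r f) (h : ∀ ω ω', r' ω ω' → r ω ω') :
    HistoryFun r' f :=
  ⟨hf.meas, hf.bdd, fun ω ω' h' => hf.dep ω ω' (h ω ω' h')⟩

lemma toEq (hf : HistoryFun r f) : HistoryFun Eq f :=
  ⟨hf.meas, hf.bdd, fun _ _ h' => congrArg f h'⟩

lemma mul (hf : HistoryFun r f) (hg : HistoryFun r g) : HistoryFun r (fun ω => f ω * g ω) := by
  obtain ⟨B, hB⟩ := hf.bdd
  obtain ⟨C, hC⟩ := hg.bdd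
  refine ⟨hf.meas.mul hg.meas, ⟨B * C, fun ω => ?_⟩, fun ω ω' h => ?_⟩
  · rw [abs_mul]
    exact mul_le_mul (hB ω) (hC ω) (abs_nonneg _) ((abs_nonneg _).trans (hB ω))
  · rw [hf.dep ω ω' h, hg.dep ω ω' h]

lemma add (hf : HistoryFun r f) (hg : HistoryFun r g) : HistoryFun r (fun ω => f ω + g ω) := by
  obtain ⟨B, hB⟩ := hf.bdd
  obtain ⟨C, hC⟩ := hg.bdd
  refine ⟨hf.meas.add hg.meas, ⟨B + C, fun ω => ?_⟩, fun ω ω' h => ?_⟩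
  · exact (abs_add_le _ _).trans (add_le_add (hB ω) (hC ω))
  · rw [hf.dep ω ω' h, hg.dep ω ω' h]

lemma sub (hf : HistoryFun r f) (hg : HistoryFun r g) : HistoryFun r (fun ω => f ω - g ω) := by
  have := hf.add ((const (-1)).mul hg)
  simpa [sub_eq_add_neg] using this

lemma sq (hf : HistoryFun r f) : HistoryFun r (fun ω => f ω ^ 2) := by
  simpa [pow_two] using hf.mul hf

lemma sum {ι : Type*} {s : Finset ι} {F : ι → Ω → ℝ} (hF : ∀ i ∈ s, HistoryFun r (F i)) :
    HistoryFun r (fun ω => ∑ i ∈ s, F i ω) := by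
  classical
  induction s using Finset.induction_on with
  | empty => simpa using const 0
  | insert i s hi ih =>
    simp only [Finset.sum_insert hi]
    exact (hF i (by simp)).add (ih fun j hj => hF j (by simp [hj]))

lemma comp {Ω' : Type*} [MeasurableSpace Ω'] {r' : Ω' → Ω' → Prop} {φ : Ω' → Ω}
    (hf : HistoryFun r f) (hφ : Measurable φ) (h : ∀ x y, r' x y → r (φ x) (φ y)) :
    HistoryFun r' (fun x => f (φ x)) :=
  ⟨hf.meas.comp hφ, hf.bdd.imp fun _ hB x => hB (φ x), fun _ _ hxy => hf.dep _ _ (h _ _ hxy)⟩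

lemma of_finite {X : Type*} [Finite X] [MeasurableSpace X] [MeasurableSingletonClass X]
    {φ : Ω → X} (hφ : Measurable φ) (h : ∀ x y, r x y → φ x = φ y) (g : X → ℝ) :
    HistoryFun r (fun x => g (φ x)) := by
  refine ⟨(measurable_of_finite g).comp hφ, ?_, fun x y hxy => by rw [h x y hxy]⟩
  obtain ⟨B, hB⟩ := (Set.finite_range fun x => |g x|).bddAbove
  exact ⟨B, fun ω => hB ⟨φ ω, rfl⟩⟩

lemma integrable (hf : HistoryFun r f) (ν : Measure Ω) [IsFiniteMeasure ν] : Integrable f ν := by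
  obtain ⟨B, hB⟩ := hf.bdd
  exact Integrable.of_bound hf.meas.aestronglyMeasurable B (ae_of_all _ hB)

lemma memLp (hf : HistoryFun r f) (ν : Measure Ω) [IsFiniteMeasure ν] : MemLp f 2 ν := by
  obtain ⟨B, hB⟩ := hf.bdd
  exact MemLp.of_bound hf.meas.aestronglyMeasurable B (ae_of_all _ hB)

lemma integral_right {X : Type*} [MeasurableSpace X] {F : X × Ω → ℝ} (hF : HistoryFun Eq F)
    (ν : Measure Ω) [IsProbabilityMeasure ν] : HistoryFun Eq (fun x => ∫ ω, F (x, ω) ∂ν) := by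
  obtain ⟨B, hB⟩ := hF.bdd
  refine ⟨(StronglyMeasurable.integral_prod_right (f := fun x ω => F (x, ω))
    hF.meas.stronglyMeasurable).measurable, ⟨B, fun x => ?_⟩,
    fun x y h => by rw [h]⟩
  have := norm_integral_le_of_norm_le_const (μ := ν) (f := fun ω => F (x, ω)) (C := B)
    (ae_of_all _ fun ω => hB (x, ω))
  simpa using this

end HistoryFun

/-! ### The law of a trajectory -/

lemma sum_fin_cons {X : Type*} [Fintype X] {m : ℕ} (f : (Fin (m + 1) → X) → ℝ) :
    ∑ x, f x = ∑ x₀ : X, ∑ x : Fin m → X, f (Fin.cons x₀ x) := by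
  rw [← (Fin.consEquiv fun _ : Fin (m + 1) => X).sum_comp, Fintype.sum_prod_type]
  rfl

lemma measurable_fin_cons {X Y : Type*} [MeasurableSpace X] [MeasurableSpace Y] {m : ℕ}
    {f : Y → X} {g : Y → Fin m → X} (hf : Measurable f) (hg : Measurable g) :
    Measurable (fun y => (Fin.cons (f y) (g y) : Fin (m + 1) → X)) := by
  refine measurable_pi_lambda _ fun i => ?_
  refine Fin.cases ?_ (fun j => ?_) i
  · simpa using hf
  · simp only [Fin.cons_succ]
    exact (measurable_pi_apply j).comp hg

lemma integral_pi_cons {m : ℕ} (ν : Fin (m + 1) → Measure ℝ) [∀ i, IsProbabilityMeasure (ν i)]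
    {F : (Fin (m + 1) → ℝ) → ℝ} (hF : HistoryFun Eq F) :
    ∫ r, F r ∂(Measure.pi ν) =
      ∫ r₀, ∫ r, F (Fin.cons r₀ r) ∂(Measure.pi fun i : Fin m => ν i.succ) ∂(ν 0) := by
  have h := (measurePreserving_piFinSuccAbove ν 0).symm
  have h2 := h.integral_comp (MeasurableEquiv.measurableEmbedding _) F
  rw [← h2, integral_prod]
  · simp [MeasurableEquiv.piFinSuccAbove, Fin.insertNthEquiv]
  · exact (hF.comp (r' := Eq) (MeasurableEquiv.measurable _) (by rintro x y rfl; rfl)).integrable _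

namespace Traj

variable {S A : Type*} [MeasurableSpace S] [MeasurableSpace A] {H : ℕ}

@[fun_prop]
lemma measurable_state (t : Fin (H + 1)) : Measurable (fun ω : Traj S A H => ω.state t) :=
  (measurable_pi_apply t).comp measurable_fst

@[fun_prop]
lemma measurable_action (t : Fin H) : Measurable (fun ω : Traj S A H => ω.action t) :=
  (measurable_pi_apply t).comp (measurable_fst.comp measurable_snd)

@[fun_prop]
lemma measurable_rew (t : Fin H) : Measurable (fun ω : Traj S A H => ω.rew t) :=
  (measurable_pi_apply t).comp (measurable_snd.comp measurable_snd)

/-- Prepend a first state, action and reward to a trajectory. -/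
def cons (s : S) (a : A) (r : ℝ) (ω : Traj S A H) : Traj S A (H + 1) :=
  (Fin.cons s ω.1, Fin.cons a ω.2.1, Fin.cons r ω.2.2)

section cons
variable (s : S) (a : A) (r : ℝ) (ω : Traj S A H)
@[simp] lemma cons_state_zero : (cons s a r ω).state 0 = s := rfl
@[simp] lemma cons_state_succ (t : Fin (H + 1)) : (cons s a r ω).state t.succ = ω.state t := rfl
@[simp] lemma cons_action_zero : (cons s a r ω).action 0 = a := rfl
@[simp] lemma cons_rew_zero : (cons s a r ω).rew 0 = r := rfl
end cons

lemma measurable_cons (s : S) (a : A) :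
    Measurable (fun p : ℝ × Traj S A H => cons s a p.1 p.2) := by
  refine Measurable.prodMk ?_ (Measurable.prodMk ?_ ?_)
  · exact measurable_fin_cons measurable_const (measurable_fst.comp measurable_snd)
  · exact measurable_fin_cons measurable_const
      (measurable_fst.comp (measurable_snd.comp measurable_snd))
  · exact measurable_fin_cons measurable_fst
      (measurable_snd.comp (measurable_snd.comp measurable_snd))

/-- Two trajectories have the same states up to time `t` and the same actions and rewards before
time `t`. -/
def SameState (t : Fin (H + 1)) (ω ω' : Traj S A H) : Prop :=
  (∀ j ≤ t, ω.state j = ω'.state j) ∧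
    ∀ j : Fin H, j.castSucc < t → ω.action j = ω'.action j ∧ ω.rew j = ω'.rew j

/-- Two trajectories have the same history up to time `t`, including the action chosen at time
`t` but not the reward collected or the state reached thereafter. -/
def SameAction (t : Fin H) (ω ω' : Traj S A H) : Prop :=
  SameState t.castSucc ω ω' ∧ ω.action t = ω'.action t

end Traj

namespace TabularMDP

variable {S A : Type*} [Fintype S] [Fintype A] {H : ℕ}

instance (M : TabularMDP S A H) (t : Fin H) (s : S) (a : A) (s' : S) :
    IsProbabilityMeasure (M.reward t s a s') := M.reward_prob t s a s'

/-- The mean of `Y s_{t+1} r_t` given `s_t = s` and `a_t = a`. -/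
noncomputable def stepMean (M : TabularMDP S A H) (t : Fin H) (Y : S → ℝ → ℝ) (s : S) (a : A) : ℝ :=
  ∑ s', M.trans t s a s' * ∫ r, Y s' r ∂(M.reward t s a s')

/-- The decision process that remains after the first step, started at the state `s`. -/
def tail [DecidableEq S] (M : TabularMDP S A (H + 1)) (s : S) : TabularMDP S A H where
  init := Pi.single s 1
  init_mem := single_mem_stdSimplex ℝ s
  trans t := M.trans t.succ
  trans_mem t := M.trans_mem t.succ
  reward t := M.reward t.succ
  reward_prob t := M.reward_prob t.succ

end TabularMDP

/-- The policy that remains after the first step. -/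
def Policy.tail {S A : Type*} [Fintype A] {H : ℕ} (π : Policy S A (H + 1)) : Policy S A H where
  prob t := π.prob t.succ
  prob_mem t := π.prob_mem t.succ

namespace TabularMDP

variable {S A : Type*} [Fintype S] [Fintype A] [DecidableEq S]
  [MeasurableSpace S] [MeasurableSpace A] {H : ℕ}

/-- The probability of a path of states and actions. -/
noncomputable def pathWeight (M : TabularMDP S A H) (π : Policy S A H) (s : Fin (H + 1) → S)
    (a : Fin H → A) : ℝ :=
  M.init (s 0) *
    ∏ t : Fin H, π.prob t (s t.castSucc) (a t) * M.trans t (s t.castSucc) (a t) (s t.succ)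

lemma pathWeight_nonneg (M : TabularMDP S A H) (π : Policy S A H) (s : Fin (H + 1) → S)
    (a : Fin H → A) : 0 ≤ M.pathWeight π s a :=
  mul_nonneg (M.init_mem.1 _) (Finset.prod_nonneg fun t _ =>
    mul_nonneg ((π.prob_mem t _).1 _) ((M.trans_mem t _ _).1 _))

lemma measurable_path (s : Fin (H + 1) → S) (a : Fin H → A) :
    Measurable (fun r : Fin H → ℝ => ((s, a, r) : Traj S A H)) := by fun_prop

lemma integral_law (M : TabularMDP S A H) (π : Policy S A H) {F : Traj S A H → ℝ}
    (hF : HistoryFun Eq F) :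
    ∫ ω, F ω ∂(M.law π) = ∑ s, ∑ a, M.pathWeight π s a *
      ∫ r, F (s, a, r) ∂(Measure.pi fun t : Fin H =>
        M.reward t (s t.castSucc) (a t) (s t.succ)) := by
  have hi : ∀ s a, Integrable F (ENNReal.ofReal (M.pathWeight π s a) •
      (Measure.pi fun t : Fin H => M.reward t (s t.castSucc) (a t) (s t.succ)).map
        (fun r => ((s, a, r) : Traj S A H))) := fun s a =>
    (hF.integrable _).smul_measure ENNReal.ofReal_ne_top
  change ∫ ω, F ω ∂(∑ s, ∑ a, ENNReal.ofReal (M.pathWeight π s a) •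
      (Measure.pi fun t : Fin H => M.reward t (s t.castSucc) (a t) (s t.succ)).map
        (fun r => ((s, a, r) : Traj S A H))) = _
  rw [integral_finsetSum_measure fun s _ => integrable_finsetSum_measure.2 fun a _ => hi s a]
  refine Finset.sum_congr rfl fun s _ => ?_
  rw [integral_finsetSum_measure fun a _ => hi s a]
  refine Finset.sum_congr rfl fun a _ => ?_
  rw [integral_smul_measure, integral_map (measurable_path s a).aemeasurable
    hF.meas.aestronglyMeasurable]
  rw [smul_eq_mul]
  congr 1
  exact ENNReal.toReal_ofReal (M.pathWeight_nonneg π s a)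

lemma pathWeight_cons (M : TabularMDP S A (H + 1)) (π : Policy S A (H + 1)) (s₀ : S)
    (s : Fin (H + 1) → S) (a₀ : A) (a : Fin H → A) :
    M.pathWeight π (Fin.cons s₀ s) (Fin.cons a₀ a) =
      M.init s₀ * (π.prob 0 s₀ a₀ * ∑ s₁, M.trans 0 s₀ a₀ s₁ *
        (M.tail s₁).pathWeight π.tail s a) := by
  have : ∀ s₁, (M.tail s₁).pathWeight π.tail s a = if s 0 = s₁ then
      ∏ t : Fin H, π.prob t.succ (s t.castSucc) (a t) *
        M.trans t.succ (s t.castSucc) (a t) (s t.succ) else 0 := by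
    intro s₁
    simp only [pathWeight, tail, Policy.tail, Pi.single_apply]
    split_ifs <;> simp
  simp only [this, mul_ite, mul_zero, Finset.sum_ite_eq, Finset.mem_univ, if_true]
  simp only [pathWeight, Fin.prod_univ_succ, Fin.cons_zero, Fin.castSucc_zero, Fin.cons_succ,
    ← Fin.succ_castSucc]
  ring

/-- The law of a trajectory decomposed along its first step. -/
lemma integral_law_succ (M : TabularMDP S A (H + 1)) (π : Policy S A (H + 1))
    [∀ s, IsProbabilityMeasure ((M.tail s).law π.tail)]
    {F : Traj S A (H + 1) → ℝ} (hF : HistoryFun Eq F) :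
    ∫ ω, F ω ∂(M.law π) = ∑ s₀, M.init s₀ * ∑ a₀, π.prob 0 s₀ a₀ * ∑ s₁, M.trans 0 s₀ a₀ s₁ *
      ∫ r, ∫ ω, F (Traj.cons s₀ a₀ r ω) ∂((M.tail s₁).law π.tail) ∂(M.reward 0 s₀ a₀ s₁) := by
  have hF' : ∀ s a, HistoryFun Eq (fun r => F ((s, a, r) : Traj S A (H + 1))) := fun s a =>
    hF.comp (measurable_path s a) (by rintro x y rfl; rfl)
  have hc : ∀ s₀ a₀, HistoryFun Eq
      (fun p : ℝ × Traj S A H => F (Traj.cons s₀ a₀ p.1 p.2)) := fun s₀ a₀ =>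
    hF.comp (Traj.measurable_cons s₀ a₀) (by rintro x y rfl; rfl)
  have hc1 : ∀ s₀ a₀ r, HistoryFun Eq
      (fun ω : Traj S A H => F (Traj.cons s₀ a₀ r ω)) := fun s₀ a₀ r =>
    (hc s₀ a₀).comp measurable_prodMk_left (by rintro x y rfl; rfl)
  have hc2 : ∀ s₀ a₀ s a, HistoryFun Eq (fun p : ℝ × (Fin H → ℝ) =>
      F (Traj.cons s₀ a₀ p.1 ((s, a, p.2) : Traj S A H))) := fun s₀ a₀ s a =>
    (hc s₀ a₀).comp (φ := fun p : ℝ × (Fin H → ℝ) => (p.1, ((s, a, p.2) : Traj S A H)))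
      (measurable_fst.prodMk ((measurable_path s a).comp measurable_snd)) (by rintro x y rfl; rfl)
  rw [integral_law M π hF, sum_fin_cons]
  refine Finset.sum_congr rfl fun s₀ _ => ?_
  have h1 : ∀ s : Fin (H + 1) → S, (∑ a : Fin (H + 1) → A, M.pathWeight π (Fin.cons s₀ s) a *
      ∫ r, F (Fin.cons s₀ s, a, r) ∂(Measure.pi fun t : Fin (H + 1) =>
        M.reward t ((Fin.cons s₀ s : Fin (H + 2) → S) t.castSucc) (a t)
          ((Fin.cons s₀ s : Fin (H + 2) → S) t.succ))) =
      ∑ a₀, ∑ a : Fin H → A, ∑ s₁, M.init s₀ * (π.prob 0 s₀ a₀ * (M.trans 0 s₀ a₀ s₁ *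
        ((M.tail s₁).pathWeight π.tail s a *
          ∫ r₀, ∫ r, F (Traj.cons s₀ a₀ r₀ (s, a, r)) ∂(Measure.pi fun t : Fin H =>
            (M.tail s₁).reward t (s t.castSucc) (a t) (s t.succ)) ∂(M.reward 0 s₀ a₀ s₁)))) := by
    intro s
    rw [sum_fin_cons]
    refine Finset.sum_congr rfl fun a₀ _ => Finset.sum_congr rfl fun a _ => ?_
    rw [pathWeight_cons, integral_pi_cons _ (hF' _ _)]
    simp only [Finset.mul_sum, Finset.sum_mul]
    refine Finset.sum_congr rfl fun s₁ _ => ?_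
    by_cases h : s 0 = s₁
    · subst h
      simp only [Fin.castSucc_zero, Fin.cons_zero, Fin.cons_succ, ← Fin.succ_castSucc, mul_assoc]
      rfl
    · have : (M.tail s₁).pathWeight π.tail s a = 0 := by
        simp [pathWeight, tail, h]
      simp [this]
  simp only [h1]
  rw [Finset.sum_comm, Finset.mul_sum]
  refine Finset.sum_congr rfl fun a₀ _ => ?_
  simp only [Finset.mul_sum]
  have h2 : ∀ s₁, ∫ r₀, ∫ ω, F (Traj.cons s₀ a₀ r₀ ω) ∂((M.tail s₁).law π.tail)
        ∂(M.reward 0 s₀ a₀ s₁) =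
      ∑ s : Fin (H + 1) → S, ∑ a : Fin H → A, (M.tail s₁).pathWeight π.tail s a *
          ∫ r₀, ∫ r, F (Traj.cons s₀ a₀ r₀ (s, a, r)) ∂(Measure.pi fun t : Fin H =>
            (M.tail s₁).reward t (s t.castSucc) (a t) (s t.succ)) ∂(M.reward 0 s₀ a₀ s₁) := by
    intro s₁
    simp only [fun r₀ => integral_law (M.tail s₁) π.tail (hc1 s₀ a₀ r₀)]
    have hI : ∀ s a, Integrable (fun r₀ => ∫ r, F (Traj.cons s₀ a₀ r₀ (s, a, r))
        ∂(Measure.pi fun t : Fin H => (M.tail s₁).reward t (s t.castSucc) (a t) (s t.succ)))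
        (M.reward 0 s₀ a₀ s₁) := fun s a =>
      ((hc2 s₀ a₀ s a).integral_right _).integrable _
    rw [integral_finsetSum _ fun s _ => integrable_finsetSum _ fun a _ => (hI s a).const_mul _]
    refine Finset.sum_congr rfl fun s _ => ?_
    rw [integral_finsetSum _ fun a _ => (hI s a).const_mul _]
    simp only [integral_const_mul]
  simp only [h2, Finset.mul_sum]
  rw [Finset.sum_comm' (s' := fun _ => Finset.univ) (t' := Finset.univ) (by simp)]
  conv_lhs =>
    enter [2, a]
    rw [Finset.sum_comm]
  rw [Finset.sum_comm]
  refine Finset.sum_congr rfl fun s₁ _ => ?_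
  rw [Finset.sum_comm]

end TabularMDP

namespace TabularMDP

variable {S A : Type*} [Fintype S] [Fintype A] [DecidableEq S]
  [MeasurableSpace S] [MeasurableSpace A] {H : ℕ}

lemma sum_init (M : TabularMDP S A H) : ∑ s, M.init s = 1 := M.init_mem.2

lemma sum_trans (M : TabularMDP S A H) (t : Fin H) (s : S) (a : A) : ∑ s', M.trans t s a s' = 1 :=
  (M.trans_mem t s a).2

lemma _root_.Policy.sum_prob (π : Policy S A H) (t : Fin H) (s : S) : ∑ a, π.prob t s a = 1 :=
  (π.prob_mem t s).2

lemma init_nonneg (M : TabularMDP S A H) (s : S) : 0 ≤ M.init s := M.init_mem.1 s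

lemma trans_nonneg (M : TabularMDP S A H) (t : Fin H) (s : S) (a : A) (s' : S) :
    0 ≤ M.trans t s a s' := (M.trans_mem t s a).1 s'

lemma _root_.Policy.prob_nonneg (π : Policy S A H) (t : Fin H) (s : S) (a : A) :
    0 ≤ π.prob t s a := (π.prob_mem t s).1 a

instance isProbabilityMeasure_law : ∀ {H : ℕ} (M : TabularMDP S A H) (π : Policy S A H),
    IsProbabilityMeasure (M.law π) := by
  have key : ∀ {H : ℕ} (M : TabularMDP S A H) (π : Policy S A H),
      ∫ _, (1 : ℝ) ∂(M.law π) = 1 → IsProbabilityMeasure (M.law π) := by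
    intro H M π h
    rw [integral_const, smul_eq_mul, mul_one, Measure.real, ENNReal.toReal_eq_one_iff] at h
    exact ⟨h⟩
  intro H
  induction H with
  | zero =>
    intro M π
    refine key M π ?_
    rw [integral_law M π (HistoryFun.const 1), sum_fin_cons]
    simpa [pathWeight] using M.sum_init
  | succ H ih =>
    intro M π
    refine key M π ?_
    rw [integral_law_succ M π (HistoryFun.const 1)]
    simp [sum_trans, Policy.sum_prob, sum_init]

lemma integral_state_zero [MeasurableSingletonClass S] (M : TabularMDP S A H) (π : Policy S A H)
    (φ : S → ℝ) : ∫ ω, φ (ω.state 0) ∂(M.law π) = ∑ s, M.init s * φ s := by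
  have hφ : HistoryFun Eq (fun ω : Traj S A H => φ (ω.state 0)) :=
    HistoryFun.of_finite (Traj.measurable_state 0) (by rintro x y rfl; rfl) φ
  cases H with
  | zero =>
    rw [integral_law M π hφ, sum_fin_cons]
    simp [pathWeight, Traj.state]
  | succ H =>
    rw [integral_law_succ M π hφ]
    simp [← Finset.sum_mul, sum_trans, Policy.sum_prob]

variable [MeasurableSingletonClass S] [MeasurableSingletonClass A]

lemma _root_.HistoryFun.step {r : Traj S A H → Traj S A H → Prop} {t : Fin H} {Y : S → ℝ → ℝ}
    {B : ℝ} (hY : ∀ s, Measurable (Y s)) (hB : ∀ s r, |Y s r| ≤ B)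
    (hs : ∀ ω ω', r ω ω' → ω.state t.succ = ω'.state t.succ)
    (hr : ∀ ω ω', r ω ω' → ω.rew t = ω'.rew t) :
    HistoryFun r (fun ω : Traj S A H => Y (ω.state t.succ) (ω.rew t)) := by
  refine ⟨?_, ⟨B, fun ω => hB _ _⟩, fun ω ω' h => by rw [hs ω ω' h, hr ω ω' h]⟩
  have h : Measurable (Function.uncurry Y) := measurable_from_prod_countable_right hY
  exact h.comp ((Traj.measurable_state t.succ).prodMk (Traj.measurable_rew t))

lemma _root_.HistoryFun.stateAction {r : Traj S A H → Traj S A H → Prop} {t : Fin H}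
    (g : S → A → ℝ) (h : ∀ ω ω', r ω ω' → ω.state t.castSucc = ω'.state t.castSucc ∧
      ω.action t = ω'.action t) :
    HistoryFun r (fun ω : Traj S A H => g (ω.state t.castSucc) (ω.action t)) :=
  HistoryFun.of_finite (X := S × A) ((Traj.measurable_state t.castSucc).prodMk
    (Traj.measurable_action t)) (fun x y hxy => Prod.ext (h x y hxy).1 (h x y hxy).2)
    (fun p => g p.1 p.2)

lemma _root_.Traj.SameAction.cons {t : Fin H} {ω ω' : Traj S A H} (h : Traj.SameAction t ω ω')
    (s : S) (a : A) (r : ℝ) : Traj.SameAction t.succ (Traj.cons s a r ω) (Traj.cons s a r ω') := by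
  obtain ⟨⟨h1, h2⟩, h3⟩ := h
  refine ⟨⟨fun j => ?_, fun j => ?_⟩, h3⟩
  · refine Fin.cases (fun _ => rfl) (fun j hj => ?_) j
    exact h1 j (by rwa [← Fin.succ_castSucc, Fin.succ_le_succ_iff] at hj)
  · refine Fin.cases (fun _ => ⟨rfl, rfl⟩) (fun j hj => ?_) j
    exact h2 j (by rwa [← Fin.succ_castSucc, ← Fin.succ_castSucc, Fin.succ_lt_succ_iff] at hj)

lemma _root_.Traj.SameState.cons {t : Fin (H + 1)} {ω ω' : Traj S A H}
    (h : Traj.SameState t ω ω') (s : S) (a : A) (r : ℝ) :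
    Traj.SameState t.succ (Traj.cons s a r ω) (Traj.cons s a r ω') := by
  obtain ⟨h1, h2⟩ := h
  refine ⟨fun j => ?_, fun j => ?_⟩
  · refine Fin.cases (fun _ => rfl) (fun j hj => ?_) j
    exact h1 j (by rwa [Fin.succ_le_succ_iff] at hj)
  · refine Fin.cases (fun _ => ⟨rfl, rfl⟩) (fun j hj => ?_) j
    exact h2 j (by rwa [← Fin.succ_castSucc, Fin.succ_lt_succ_iff] at hj)

/-- The Markov property: given the history up to the action chosen at step `t`, the mean of a
function of the next state and the reward depends on the current state and action only. -/
theorem integral_mul_step : ∀ {H : ℕ} (M : TabularMDP S A H) (π : Policy S A H) (t : Fin H)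
    {f : Traj S A H → ℝ} (_ : HistoryFun (Traj.SameAction t) f) {Y : S → ℝ → ℝ} {B : ℝ}
    (_ : ∀ s, Measurable (Y s)) (_ : ∀ s r, |Y s r| ≤ B),
    ∫ ω, f ω * Y (ω.state t.succ) (ω.rew t) ∂(M.law π) =
      ∫ ω, f ω * M.stepMean t Y (ω.state t.castSucc) (ω.action t) ∂(M.law π) := by
  intro H
  induction H with
  | zero => intro M π t; exact t.elim0
  | succ H ih =>
    intro M π t f hf Y B hY hB
    have hL := hf.toEq.mul (HistoryFun.step (t := t) (r := Eq) hY hB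
      (by rintro x y rfl; rfl) (by rintro x y rfl; rfl))
    have hR := hf.toEq.mul (HistoryFun.stateAction (t := t) (r := Eq) (M.stepMean t Y)
      (by rintro x y rfl; exact ⟨rfl, rfl⟩))
    rw [integral_law_succ M π hL, integral_law_succ M π hR]
    refine Finset.sum_congr rfl fun s₀ _ => ?_
    congr 1
    refine Finset.sum_congr rfl fun a₀ _ => ?_
    congr 1
    induction t using Fin.cases with
    | zero =>
      set ω₀ : Traj S A H := (fun _ => s₀, fun _ => a₀, fun _ => 0)
      have hc : ∀ r ω, f (Traj.cons s₀ a₀ r ω) = f (Traj.cons s₀ a₀ 0 ω₀) := by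
        intro r ω
        refine hf.dep _ _ ⟨⟨fun j hj => ?_, fun j hj => ?_⟩, rfl⟩
        · have : j = 0 := Fin.le_zero_iff.1 hj
          subst this; rfl
        · exact absurd hj (Fin.not_lt_zero _)
      have h0 : ∀ s₁ r, ∫ ω, Y (Traj.state ω 0) r ∂((M.tail s₁).law π.tail) = Y s₁ r := by
        intro s₁ r
        rw [integral_state_zero (M.tail s₁) π.tail (fun s => Y s r)]
        simp [tail, Pi.single_apply]
      simp only [hc, Traj.cons_state_succ, Traj.cons_rew_zero, Traj.cons_action_zero,
        Fin.castSucc_zero, Traj.cons_state_zero, integral_const_mul, h0]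
      simp only [integral_const, probReal_univ, one_smul]
      rw [← Finset.sum_mul, sum_trans, one_mul, stepMean, Finset.mul_sum]
      exact Finset.sum_congr rfl fun _ _ => by ring
    | succ t =>
      refine Finset.sum_congr rfl fun s₁ _ => ?_
      congr 1
      refine integral_congr_ae (ae_of_all _ fun r => ?_)
      have hm : Measurable (fun ω : Traj S A H => Traj.cons s₀ a₀ r ω) :=
        (Traj.measurable_cons s₀ a₀).comp measurable_prodMk_left
      exact ih (M.tail s₁) π.tail t (hf.comp hm fun x y h => h.cons s₀ a₀ r) hY hB

/-- Given the history up to the state at step `t`, the action is drawn from the policy. -/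
theorem integral_mul_action : ∀ {H : ℕ} (M : TabularMDP S A H) (π : Policy S A H) (t : Fin H)
    {f : Traj S A H → ℝ} (_ : HistoryFun (Traj.SameState t.castSucc) f) (g : S → A → ℝ),
    ∫ ω, f ω * g (ω.state t.castSucc) (ω.action t) ∂(M.law π) =
      ∫ ω, f ω * ∑ a, π.prob t (ω.state t.castSucc) a * g (ω.state t.castSucc) a ∂(M.law π) := by
  intro H
  induction H with
  | zero => intro M π t; exact t.elim0
  | succ H ih =>
    intro M π t f hf g
    have hL := hf.toEq.mul (HistoryFun.stateAction (t := t) (r := Eq) g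
      (by rintro x y rfl; exact ⟨rfl, rfl⟩))
    have hR := hf.toEq.mul (HistoryFun.stateAction (t := t) (r := Eq)
      (fun s _ => ∑ a, π.prob t s a * g s a) (by rintro x y rfl; exact ⟨rfl, rfl⟩))
    rw [integral_law_succ M π hL, integral_law_succ M π hR]
    refine Finset.sum_congr rfl fun s₀ _ => ?_
    congr 1
    induction t using Fin.cases with
    | zero =>
      have hc : ∀ a₀ a₁ r ω ω', f (Traj.cons s₀ a₀ r ω) = f (Traj.cons s₀ a₁ 0 ω') := by
        intro a₀ a₁ r ω ω'
        refine hf.dep _ _ ⟨fun j hj => ?_, fun j hj => ?_⟩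
        · have : j = 0 := Fin.le_zero_iff.1 hj
          subst this; rfl
        · exact absurd hj (Fin.not_lt_zero _)
      obtain ⟨a₁⟩ : Nonempty A := by
        by_contra h
        have := π.sum_prob 0 s₀
        rw [not_nonempty_iff] at h
        simp at this
      simp only [hc _ a₁ _ _ (fun _ => s₀, fun _ => a₁, fun _ => 0), Traj.cons_action_zero,
        Fin.castSucc_zero, Traj.cons_state_zero, integral_const_mul]
      simp only [integral_const, probReal_univ, one_smul]
      simp only [← Finset.sum_mul, sum_trans, Policy.sum_prob, one_mul]
      rw [Finset.mul_sum]
      exact Finset.sum_congr rfl fun _ _ => by ring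
    | succ t =>
      refine Finset.sum_congr rfl fun a₀ _ => ?_
      congr 1
      refine Finset.sum_congr rfl fun s₁ _ => ?_
      congr 1
      refine integral_congr_ae (ae_of_all _ fun r => ?_)
      have hm : Measurable (fun ω : Traj S A H => Traj.cons s₀ a₀ r ω) :=
        (Traj.measurable_cons s₀ a₀).comp measurable_prodMk_left
      refine ih (M.tail s₁) π.tail t (hf.comp hm fun x y h => ?_) g
      have := h.cons s₀ a₀ r
      rwa [Fin.succ_castSucc] at this

end TabularMDP

/-! ### One-step means and variances -/

namespace TabularMDP

section stepMean

variable {S A : Type*} [Fintype S] [Fintype A] {H : ℕ} (M : TabularMDP S A H) (t : Fin H)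

/-- The variance of `Y s_{t+1} r_t` given `s_t = s` and `a_t = a`. -/
noncomputable def stepVariance (Y : S → ℝ → ℝ) (s : S) (a : A) : ℝ :=
  M.stepMean t (fun s' r => (Y s' r - M.stepMean t Y s a) ^ 2) s a

lemma integrable_reward {Y : ℝ → ℝ} {B : ℝ} (hY : Measurable Y) (hB : ∀ r, |Y r| ≤ B)
    (s : S) (a : A) (s' : S) : Integrable Y (M.reward t s a s') :=
  Integrable.of_bound hY.aestronglyMeasurable B (ae_of_all _ hB)

lemma stepMean_const (c : ℝ) (s : S) (a : A) : M.stepMean t (fun _ _ => c) s a = c := by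
  simp [stepMean, ← Finset.sum_mul, (M.trans_mem t s a).2]

lemma stepMean_next (φ : S → ℝ) (s : S) (a : A) :
    M.stepMean t (fun s' _ => φ s') s a = ∑ s', M.trans t s a s' * φ s' := by
  simp [stepMean]

lemma stepMean_mono {Y Z : S → ℝ → ℝ} {B C : ℝ} (hY : ∀ s, Measurable (Y s))
    (hB : ∀ s r, |Y s r| ≤ B) (hZ : ∀ s, Measurable (Z s)) (hC : ∀ s r, |Z s r| ≤ C)
    (h : ∀ s r, Y s r ≤ Z s r) (s : S) (a : A) : M.stepMean t Y s a ≤ M.stepMean t Z s a := by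
  refine Finset.sum_le_sum fun s' _ => mul_le_mul_of_nonneg_left ?_ ((M.trans_mem t s a).1 s')
  exact integral_mono (M.integrable_reward t (hY s') (hB s') s a s')
    (M.integrable_reward t (hZ s') (hC s') s a s') (h s')

lemma stepMean_nonneg {Y : S → ℝ → ℝ} (h : ∀ s r, 0 ≤ Y s r) (s : S) (a : A) :
    0 ≤ M.stepMean t Y s a :=
  Finset.sum_nonneg fun s' _ => mul_nonneg ((M.trans_mem t s a).1 s')
    (integral_nonneg (h s'))

lemma stepMean_mem_Icc {Y : S → ℝ → ℝ} {B : ℝ} (hY : ∀ s, Measurable (Y s))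
    (h : ∀ s r, Y s r ∈ Set.Icc 0 B) (s : S) (a : A) : M.stepMean t Y s a ∈ Set.Icc 0 B := by
  refine ⟨M.stepMean_nonneg t (fun s r => (h s r).1) s a, ?_⟩
  have := M.stepMean_mono t hY (fun s r => (abs_of_nonneg (h s r).1).le.trans (h s r).2)
    (fun _ => measurable_const (a := B)) (C := |B|) (fun _ _ => le_rfl) (fun s r => (h s r).2) s a
  rwa [stepMean_const] at this

lemma stepVariance_nonneg (Y : S → ℝ → ℝ) (s : S) (a : A) : 0 ≤ M.stepVariance t Y s a :=
  M.stepMean_nonneg t (fun _ _ => sq_nonneg _) s a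

lemma stepVariance_le {Y : S → ℝ → ℝ} {B : ℝ} (hY : ∀ s, Measurable (Y s))
    (h : ∀ s r, Y s r ∈ Set.Icc 0 B) (s : S) (a : A) : M.stepVariance t Y s a ≤ B ^ 2 := by
  have hm := M.stepMean_mem_Icc t hY h s a
  refine (M.stepMean_mem_Icc t (Y := fun s' r => (Y s' r - M.stepMean t Y s a) ^ 2) (B := B ^ 2)
    (fun s' => ((hY s').sub_const _).pow_const 2) (fun s' r => ⟨sq_nonneg _, ?_⟩) s a).2
  have h1 := h s' r
  rw [sq_le_sq, abs_of_nonneg (hm.1.trans hm.2), abs_le]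
  constructor <;> linarith [h1.1, h1.2, hm.1, hm.2]

lemma stepVariance_eq {Y : S → ℝ → ℝ} {B : ℝ} (hY : ∀ s, Measurable (Y s))
    (hB : ∀ s r, |Y s r| ≤ B) (s : S) (a : A) :
    M.stepVariance t Y s a = M.stepMean t (fun s' r => Y s' r ^ 2) s a - M.stepMean t Y s a ^ 2 := by
  set m := M.stepMean t Y s a with hm
  have h1 : ∀ s', ∫ r, (Y s' r - m) ^ 2 ∂(M.reward t s a s') =
      ∫ r, Y s' r ^ 2 ∂(M.reward t s a s') - 2 * m * ∫ r, Y s' r ∂(M.reward t s a s') + m ^ 2 := by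
    intro s'
    have i1 := M.integrable_reward t (hY s') (hB s') s a s'
    have i2 := M.integrable_reward t ((hY s').pow_const 2) (B := B ^ 2)
      (fun r => by rw [abs_pow]; exact pow_le_pow_left₀ (abs_nonneg _) (hB s' r) 2) s a s'
    have : ∀ r, (Y s' r - m) ^ 2 = Y s' r ^ 2 - 2 * m * Y s' r + m ^ 2 := fun r => by ring
    simp only [this]
    have i3 : Integrable (fun r => Y s' r ^ 2 - 2 * m * Y s' r) (M.reward t s a s') :=
      i2.sub (i1.const_mul _)
    rw [integral_add i3 (integrable_const _),
      integral_sub i2 (i1.const_mul _), integral_const_mul]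
    simp
  have h2 : ∑ s', M.trans t s a s' * ∫ r, Y s' r ∂(M.reward t s a s') = m := rfl
  simp only [stepVariance, ← hm]
  simp only [stepMean, h1, mul_add, mul_sub, Finset.sum_add_distrib, Finset.sum_sub_distrib,
    ← Finset.sum_mul, (M.trans_mem t s a).2]
  have h3 : ∑ s', M.trans t s a s' * (2 * m * ∫ r, Y s' r ∂(M.reward t s a s')) = 2 * m * m := by
    conv_rhs => rw [← h2, Finset.mul_sum]
    exact Finset.sum_congr rfl fun _ _ => by rw [← h2]; ring
  rw [h3]; ring

end stepMean

/-! ### Occupancy measures -/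

section Occ

variable {S A : Type*} [Fintype S] [Fintype A] [DecidableEq S] [DecidableEq A]
  [MeasurableSpace S] [MeasurableSpace A] [MeasurableSingletonClass S]
  [MeasurableSingletonClass A] {H : ℕ} (M : TabularMDP S A H) (π : Policy S A H)

lemma measurableSet_state (t : Fin (H + 1)) (s : S) :
    MeasurableSet {ω : Traj S A H | ω.state t = s} :=
  Traj.measurable_state t (measurableSet_singleton s)

lemma measurableSet_stateAction (t : Fin H) (s : S) (a : A) :
    MeasurableSet {ω : Traj S A H | ω.state t.castSucc = s ∧ ω.action t = a} :=
  (measurableSet_state t.castSucc s).inter (Traj.measurable_action t (measurableSet_singleton a))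

lemma integral_state (t : Fin (H + 1)) (φ : S → ℝ) :
    ∫ ω, φ (ω.state t) ∂(M.law π) = ∑ s, M.stateOcc π t s * φ s := by
  have h : ∀ ω : Traj S A H, φ (ω.state t) =
      ∑ s, ({ω : Traj S A H | ω.state t = s}.indicator (fun _ => φ s)) ω := by
    intro ω
    simp [Set.indicator_apply]
  simp only [h]
  rw [integral_finsetSum _ fun s _ => (integrable_const _).indicator (measurableSet_state t s)]
  refine Finset.sum_congr rfl fun s _ => ?_
  rw [integral_indicator_const _ (measurableSet_state t s)]
  rfl

lemma integral_stateAction (t : Fin H) (g : S → A → ℝ) :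
    ∫ ω, g (ω.state t.castSucc) (ω.action t) ∂(M.law π) =
      ∑ s, M.stateOcc π t.castSucc s * ∑ a, π.prob t s a * g s a := by
  have := integral_mul_action M π t (HistoryFun.const 1) g
  simp only [one_mul] at this
  rw [this, integral_state M π t.castSucc (fun s => ∑ a, π.prob t s a * g s a)]

lemma integral_step (t : Fin H) {Y : S → ℝ → ℝ} {B : ℝ}
    (hY : ∀ s, Measurable (Y s)) (hB : ∀ s r, |Y s r| ≤ B) :
    ∫ ω, Y (ω.state t.succ) (ω.rew t) ∂(M.law π) =
      ∑ s, M.stateOcc π t.castSucc s * ∑ a, π.prob t s a * M.stepMean t Y s a := by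
  have := integral_mul_step M π t (HistoryFun.const 1) hY hB
  simp only [one_mul] at this
  rw [this, integral_stateAction M π t (M.stepMean t Y)]

lemma stateOcc_nonneg (t : Fin (H + 1)) (s : S) : 0 ≤ M.stateOcc π t s := measureReal_nonneg

lemma sum_stateOcc (t : Fin (H + 1)) : ∑ s, M.stateOcc π t s = 1 := by
  have := integral_state M π t (fun _ => 1)
  simpa using this.symm

lemma stateOcc_le_one (t : Fin (H + 1)) (s : S) : M.stateOcc π t s ≤ 1 := measureReal_le_one

lemma stateOcc_zero (s : S) : M.stateOcc π 0 s = M.init s := by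
  have h := integral_state M π 0 (Pi.single s 1)
  rw [integral_state_zero M π (Pi.single s 1)] at h
  simpa [Pi.single_apply] using h.symm

lemma stateActionOcc_eq (t : Fin H) (s : S) (a : A) :
    M.stateActionOcc π t s a = M.stateOcc π t.castSucc s * π.prob t s a := by
  have h := integral_stateAction M π t (fun x y => if x = s ∧ y = a then 1 else 0)
  have h2 : ∫ ω : Traj S A H, (if ω.state t.castSucc = s ∧ ω.action t = a then (1 : ℝ) else 0)
      ∂(M.law π) = M.stateActionOcc π t s a := by
    have := integral_indicator_const (μ := M.law π) (1 : ℝ) (measurableSet_stateAction t s a)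
    rw [smul_eq_mul, mul_one] at this
    rw [stateActionOcc, ← this]
    simp [Set.indicator_apply]
  rw [← h2, h]
  simp [ite_and]

/-- Forward recursion for the occupancy measures, tested against a function `φ`. -/
lemma sum_stateOcc_succ (t : Fin H) (φ : S → ℝ) :
    ∑ s, M.stateOcc π t.succ s * φ s =
      ∑ s, M.stateOcc π t.castSucc s * ∑ a, π.prob t s a * M.stepMean t (fun s' _ => φ s') s a := by
  rw [← integral_state M π t.succ φ]
  exact integral_step M π t (Y := fun s' _ => φ s') (B := ∑ s, |φ s|) (fun _ => measurable_const)
    (fun s _ => Finset.single_le_sum (f := fun s => |φ s|) (fun _ _ => abs_nonneg _)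
      (Finset.mem_univ s))

lemma stateOcc_succ_pos {t : Fin H} {s s' : S} {a : A} (h1 : 0 < M.stateOcc π t.castSucc s)
    (h2 : 0 < π.prob t s a) (h3 : 0 < M.trans t s a s') : 0 < M.stateOcc π t.succ s' := by
  have h := sum_stateOcc_succ M π t (Pi.single s' 1)
  simp only [stepMean_next, Pi.single_apply, mul_ite, mul_one, mul_zero, Finset.sum_ite_eq',
    Finset.mem_univ, if_true] at h
  rw [h]
  have ha : ∀ s, ∀ a ∈ Finset.univ, 0 ≤ π.prob t s a * M.trans t s a s' := fun s a _ =>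
    mul_nonneg (π.prob_nonneg t s a) (M.trans_nonneg t s a s')
  calc 0 < M.stateOcc π t.castSucc s * (π.prob t s a * M.trans t s a s') := by positivity
    _ ≤ M.stateOcc π t.castSucc s * ∑ a, π.prob t s a * M.trans t s a s' :=
        mul_le_mul_of_nonneg_left (Finset.single_le_sum (ha s) (Finset.mem_univ a)) h1.le
    _ ≤ _ := Finset.single_le_sum
        (f := fun s => M.stateOcc π t.castSucc s * ∑ a, π.prob t s a * M.trans t s a s')
        (fun s _ => mul_nonneg (M.stateOcc_nonneg π _ s) (Finset.sum_nonneg (ha s)))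
        (Finset.mem_univ s)

/-- An almost sure property of the one-step law given `(s, a)` holds almost surely along
trajectories that visit `(s, a)`. -/
lemma ae_step (t : Fin H) (s : S) (a : A) {Q : S → Set ℝ} (hQ : ∀ s', MeasurableSet (Q s'))
    (h : ∀ s', 0 < M.trans t s a s' → ∀ᵐ r ∂(M.reward t s a s'), r ∈ Q s') :
    ∀ᵐ ω ∂(M.law π), ω.state t.castSucc = s → ω.action t = a →
      ω.rew t ∈ Q (ω.state t.succ) := by
  classical
  set Y : S → ℝ → ℝ := fun s' r => (Q s')ᶜ.indicator (fun _ => 1) r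
  have hY : ∀ s', Measurable (Y s') := fun s' => measurable_const.indicator (hQ s').compl
  have hY0 : ∀ s' r, 0 ≤ Y s' r := fun s' r => Set.indicator_nonneg (fun _ _ => zero_le_one) r
  have hY1 : ∀ s' r, |Y s' r| ≤ 1 := fun s' r => by
    rw [abs_of_nonneg (hY0 s' r)]
    exact Set.indicator_le_self' (fun _ _ => zero_le_one) r
  have hf : HistoryFun (Traj.SameAction t) (fun ω : Traj S A H =>
      (if ω.state t.castSucc = s ∧ ω.action t = a then (1 : ℝ) else 0)) :=
    HistoryFun.stateAction (fun x y => if x = s ∧ y = a then (1 : ℝ) else 0)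
      (fun x y h => ⟨h.1.1 _ le_rfl, h.2⟩)
  have h0 : M.stepMean t Y s a = 0 := by
    refine Finset.sum_eq_zero fun s' _ => ?_
    rcases (M.trans_nonneg t s a s').eq_or_lt with h' | h'
    · rw [← h', zero_mul]
    · rw [integral_eq_zero_of_ae, mul_zero]
      filter_upwards [h s' h'] with r hr
      simp [Y, hr]
  have hI := integral_mul_step M π t hf hY hY1
  have hR : ∫ ω : Traj S A H, (if ω.state t.castSucc = s ∧ ω.action t = a then (1 : ℝ) else 0) *
      M.stepMean t Y (ω.state t.castSucc) (ω.action t) ∂(M.law π) = 0 := by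
    refine integral_eq_zero_of_ae (ae_of_all _ fun ω => ?_)
    by_cases hω : ω.state t.castSucc = s ∧ ω.action t = a
    · simp [hω.1, hω.2, h0]
    · simp [hω]
  rw [hR, integral_eq_zero_iff_of_nonneg_ae] at hI
  · filter_upwards [hI] with ω hω h1 h2
    by_contra hc
    simp [h1, h2, Y, hc] at hω
  · exact ae_of_all _ fun ω => mul_nonneg (by split_ifs <;> norm_num) (hY0 _ _)
  · exact (hf.toEq.mul (HistoryFun.step (t := t) (r := Eq) hY hY1
      (by rintro x y rfl; rfl) (by rintro x y rfl; rfl))).integrable _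

end Occ

end TabularMDP

/-! ### Value functions -/

/-- Truncation of a reward to the interval `[0, R]`. Rewards lie in that interval almost surely, and
truncating them makes every random variable below bounded everywhere. -/
noncomputable def clip (R r : ℝ) : ℝ := max 0 (min r R)

lemma measurable_clip (R : ℝ) : Measurable (clip R) := by
  unfold clip
  fun_prop

lemma clip_mem_Icc {R : ℝ} (hR : 0 ≤ R) (r : ℝ) : clip R r ∈ Set.Icc 0 R :=
  ⟨le_max_left _ _, max_le hR (min_le_right _ _)⟩

lemma clip_of_mem {R r : ℝ} (h : r ∈ Set.Icc 0 R) : clip R r = r := by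
  rw [clip, min_eq_left h.2, max_eq_right h.1]

namespace TabularMDP

variable {S A : Type*} [Fintype S] [Fintype A] {H : ℕ} (M : TabularMDP S A H) (π : Policy S A H)

/-- The value functions of `π` for rewards truncated to `[0, R]`, by backward recursion. Unlike
`valueFun` they satisfy the Bellman equation at every state, reachable or not. -/
noncomputable def bellmanValue (R : ℝ) (t : Fin (H + 1)) : S → ℝ :=
  Fin.reverseInduction (motive := fun _ => S → ℝ) (fun _ => 0)
    (fun t V s => ∑ a, π.prob t s a * M.stepMean t (fun s' r => V s' + clip R r) s a) t

/-- The next value plus the truncated reward, as a function of the next state and the reward. -/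
noncomputable def target (R : ℝ) (t : Fin H) (s' : S) (r : ℝ) : ℝ :=
  M.bellmanValue π R t.succ s' + clip R r

lemma bellmanValue_last (R : ℝ) (s : S) : M.bellmanValue π R (Fin.last H) s = 0 := by
  simp [bellmanValue]

lemma bellmanValue_castSucc (R : ℝ) (t : Fin H) (s : S) :
    M.bellmanValue π R t.castSucc s =
      ∑ a, π.prob t s a * M.stepMean t (M.target π R t) s a := by
  unfold target bellmanValue
  rw [Fin.reverseInduction_castSucc]

lemma measurable_target (R : ℝ) (t : Fin H) (s : S) : Measurable (M.target π R t s) :=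
  (measurable_clip R).const_add _

lemma target_mem_of_bellmanValue {R : ℝ} (hR : 0 ≤ R) {t : Fin H}
    (h : ∀ s, M.bellmanValue π R t.succ s ∈ Set.Icc 0 (((H : ℝ) - (t.succ : Fin (H + 1))) * R))
    (s : S) (r : ℝ) : M.target π R t s r ∈ Set.Icc 0 (((H : ℝ) - (t.castSucc : Fin (H + 1))) * R) := by
  have h1 := h s
  have h2 := clip_mem_Icc hR r
  simp only [Fin.val_succ, Nat.cast_add, Nat.cast_one, Fin.val_castSucc, target, Set.mem_Icc] at *
  constructor <;> nlinarith

lemma bellmanValue_mem {R : ℝ} (hR : 0 ≤ R) (t : Fin (H + 1)) (s : S) :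
    M.bellmanValue π R t s ∈ Set.Icc 0 (((H : ℝ) - t) * R) := by
  induction t using Fin.reverseInduction generalizing s with
  | last => simp [bellmanValue_last]
  | cast t ih =>
    rw [bellmanValue_castSucc]
    have hm := fun a => M.stepMean_mem_Icc t (M.measurable_target π R t)
      (M.target_mem_of_bellmanValue π hR ih) s a
    refine ⟨Finset.sum_nonneg fun a _ => mul_nonneg ((π.prob_mem t s).1 a) (hm a).1, ?_⟩
    calc _ ≤ ∑ a, π.prob t s a * (((H : ℝ) - (t.castSucc : Fin (H + 1))) * R) :=
          Finset.sum_le_sum fun a _ => mul_le_mul_of_nonneg_left (hm a).2 ((π.prob_mem t s).1 a)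
      _ = _ := by rw [← Finset.sum_mul, (π.prob_mem t s).2, one_mul]

lemma bellmanValue_mem_Icc {R : ℝ} (hR : 0 ≤ R) (t : Fin (H + 1)) (s : S) :
    M.bellmanValue π R t s ∈ Set.Icc 0 (H * R) := by
  have h := M.bellmanValue_mem π hR t s
  refine ⟨h.1, h.2.trans (mul_le_mul_of_nonneg_right ?_ hR)⟩
  simp

lemma target_mem {R : ℝ} (hR : 0 ≤ R) (t : Fin H) (s : S) (r : ℝ) :
    M.target π R t s r ∈ Set.Icc 0 (H * R) := by
  have h := M.target_mem_of_bellmanValue π hR (t := t) (M.bellmanValue_mem π hR t.succ) s r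
  refine ⟨h.1, h.2.trans (mul_le_mul_of_nonneg_right ?_ hR)⟩
  simp

lemma abs_target_le {R : ℝ} (hR : 0 ≤ R) (t : Fin H) (s : S) (r : ℝ) :
    |M.target π R t s r| ≤ H * R := by
  rw [abs_of_nonneg (M.target_mem π hR t s r).1]
  exact (M.target_mem π hR t s r).2

variable [DecidableEq S] [DecidableEq A]
  [MeasurableSpace S] [MeasurableSpace A] [MeasurableSingletonClass S]
  [MeasurableSingletonClass A]

lemma filter_le_castSucc (t : Fin H) :
    (Finset.univ.filter fun j : Fin H => t.castSucc ≤ j.castSucc) =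
      insert t (Finset.univ.filter fun j : Fin H => t.succ ≤ j.castSucc) := by
  ext j
  simp only [Finset.mem_filter, Finset.mem_univ, true_and, Finset.mem_insert,
    Fin.castSucc_le_castSucc_iff, Fin.succ_le_castSucc_iff]
  rw [le_iff_eq_or_lt, eq_comm]

lemma _root_.Traj.SameState.of_succ {t : Fin H} {ω ω' : Traj S A H}
    (h : Traj.SameState t.succ ω ω') : Traj.SameAction t ω ω' := by
  refine ⟨⟨fun j hj => h.1 j (hj.trans (Fin.castSucc_le_succ t)), fun j hj => h.2 j ?_⟩,
    (h.2 t (Fin.castSucc_lt_succ)).1⟩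
  exact hj.trans (Fin.castSucc_lt_succ)

lemma _root_.HistoryFun.clip_rew {R : ℝ} (hR : 0 ≤ R) (t : Fin H) :
    HistoryFun Eq (fun ω : Traj S A H => clip R (ω.rew t)) := by
  refine ⟨(measurable_clip R).comp (Traj.measurable_rew t), ⟨R, fun ω => ?_⟩,
    by rintro x y rfl; rfl⟩
  rw [abs_of_nonneg (clip_mem_Icc hR _).1]
  exact (clip_mem_Icc hR _).2

/-- Given the history up to the state at time `t`, the mean of the rewards still to come is the
value of that state. -/
lemma integral_mul_return {R : ℝ} (hR : 0 ≤ R) (t : Fin (H + 1)) {f : Traj S A H → ℝ}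
    (hf : HistoryFun (Traj.SameState t) f) :
    ∫ ω, f ω * ∑ j : Fin H with t ≤ j.castSucc, clip R (ω.rew j) ∂(M.law π) =
      ∫ ω, f ω * M.bellmanValue π R t (ω.state t) ∂(M.law π) := by
  induction t using Fin.reverseInduction generalizing f with
  | last =>
    simp [bellmanValue_last]
  | cast t ih =>
    have hf1 : HistoryFun (Traj.SameAction t) f := hf.mono fun _ _ h => h.1
    have hf2 : HistoryFun (Traj.SameState t.succ) f := hf1.mono fun _ _ h => h.of_succ
    have i1 := (hf.toEq.mul (HistoryFun.clip_rew hR t)).integrable (M.law π)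
    have i2 := (hf.toEq.mul (HistoryFun.sum (s := Finset.univ.filter
      fun j : Fin H => t.succ ≤ j.castSucc) fun j _ =>
        HistoryFun.clip_rew (S := S) (A := A) hR j)).integrable (M.law π)
    have i3 := (hf.toEq.mul (HistoryFun.of_finite (r := Eq) (Traj.measurable_state t.succ)
      (by rintro x y rfl; rfl) (M.bellmanValue π R t.succ))).integrable (M.law π)
    have hn : t ∉ (Finset.univ.filter fun j : Fin H => t.succ ≤ j.castSucc) := by simp
    simp only [filter_le_castSucc, Finset.sum_insert hn, mul_add]
    rw [integral_add i1 i2, ih hf2, add_comm, ← integral_add i3 i1]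
    have h := integral_mul_step M π t hf1 (M.measurable_target π R t)
      (M.abs_target_le π hR t)
    simp only [target, mul_add] at h
    rw [h]
    change ∫ ω, f ω * M.stepMean t (M.target π R t) (ω.state t.castSucc) (ω.action t)
      ∂(M.law π) = _
    rw [integral_mul_action M π t hf (M.stepMean t (M.target π R t))]
    simp only [bellmanValue_castSucc]

/-- All rewards that can occur lie in `[0, R]` almost surely. -/
def RewardsIn (R : ℝ) : Prop :=
  ∀ t s a s', 0 < M.trans t s a s' → ∀ᵐ r ∂(M.reward t s a s'), 0 ≤ r ∧ r ≤ R

lemma rewardBound_nonneg {R : ℝ} (hM : M.RewardsIn R) (t : Fin H) (a : A) : 0 ≤ R := by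
  obtain ⟨s⟩ : Nonempty S := by
    by_contra h
    have := M.sum_init
    rw [not_nonempty_iff] at h
    simp at this
  obtain ⟨s', -, hs'⟩ : ∃ s' ∈ Finset.univ, 0 < M.trans t s a s' := by
    by_contra! h
    have := Finset.sum_nonpos h
    rw [sum_trans] at this
    linarith
  obtain ⟨r, hr⟩ := (hM t s a s' hs').exists
  exact hr.1.trans hr.2

lemma ae_rew_mem {R : ℝ} (hM : M.RewardsIn R) : ∀ᵐ ω ∂(M.law π), ∀ t, ω.rew t ∈ Set.Icc 0 R := by
  rw [ae_all_iff]
  intro t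
  have h : ∀ p : S × A, ∀ᵐ ω ∂(M.law π), ω.state t.castSucc = p.1 → ω.action t = p.2 →
      ω.rew t ∈ Set.Icc 0 R := fun p =>
    M.ae_step π t p.1 p.2 (Q := fun _ => Set.Icc 0 R) (fun _ => measurableSet_Icc)
      (hM t p.1 p.2)
  filter_upwards [ae_all_iff.2 h] with ω hω
  exact hω (_, _) rfl rfl

lemma value_eq {R : ℝ} (hM : M.RewardsIn R) (hR : 0 ≤ R) :
    M.value π = ∑ s, M.init s * M.bellmanValue π R 0 s := by
  have h := M.integral_mul_return π hR 0 (HistoryFun.const 1)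
  simp only [one_mul, Fin.zero_le, Finset.filter_true] at h
  rw [integral_state_zero M π (M.bellmanValue π R 0)] at h
  rw [← h, value]
  refine integral_congr_ae ?_
  filter_upwards [M.ae_rew_mem π hM] with ω hω
  exact Finset.sum_congr rfl fun t _ => (clip_of_mem (hω t)).symm

lemma valueFun_eq {R : ℝ} (hM : M.RewardsIn R) (hR : 0 ≤ R) (t : Fin (H + 1)) (s : S) (hs : 0 < M.stateOcc π t s) :
    M.valueFun π t s = M.bellmanValue π R t s := by
  have hf : HistoryFun (Traj.SameState t) (fun ω : Traj S A H => if ω.state t = s then (1 : ℝ) else 0) :=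
    HistoryFun.of_finite (Traj.measurable_state t) (fun x y h => h.1 t le_rfl)
      (fun x => if x = s then 1 else 0)
  have h := M.integral_mul_return π hR t hf
  have hR' : ∫ ω : Traj S A H, (if ω.state t = s then (1 : ℝ) else 0) *
      M.bellmanValue π R t (ω.state t) ∂(M.law π) =
      M.stateOcc π t s * M.bellmanValue π R t s := by
    rw [integral_state M π t (fun x => (if x = s then (1 : ℝ) else 0) * M.bellmanValue π R t x)]
    simp
  rw [hR'] at h
  rw [valueFun, ProbabilityTheory.cond, integral_smul_measure, ← integral_indicator (measurableSet_state t s)]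
  have : ∫ ω, {ω : Traj S A H | ω.state t = s}.indicator
      (fun ω => ∑ j : Fin H with t ≤ j.castSucc, ω.rew j) ω ∂(M.law π) =
      M.stateOcc π t s * M.bellmanValue π R t s := by
    rw [← h]
    refine integral_congr_ae ?_
    filter_upwards [M.ae_rew_mem π hM] with ω hω
    simp only [Set.indicator_apply, Set.mem_ofPred_eq, ite_mul, one_mul, zero_mul]
    split_ifs
    · exact Finset.sum_congr rfl fun t _ => (clip_of_mem (hω t)).symm
    · rfl
  rw [this, ENNReal.toReal_inv, smul_eq_mul]
  exact inv_mul_cancel_left₀ hs.ne' _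

lemma integral_cond_stateAction (t : Fin H) (s : S) (a : A) {Y : S → ℝ → ℝ} {B : ℝ}
    (hY : ∀ s, Measurable (Y s)) (hB : ∀ s r, |Y s r| ≤ B)
    (hp : 0 < M.stateActionOcc π t s a) :
    ∫ ω, Y (ω.state t.succ) (ω.rew t)
        ∂((M.law π)[|{ω | ω.state t.castSucc = s ∧ ω.action t = a}]) = M.stepMean t Y s a := by
  have hf : HistoryFun (Traj.SameAction t) (fun ω : Traj S A H =>
      (if ω.state t.castSucc = s ∧ ω.action t = a then (1 : ℝ) else 0)) :=
    HistoryFun.stateAction (fun x y => if x = s ∧ y = a then (1 : ℝ) else 0)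
      (fun x y h => ⟨h.1.1 _ le_rfl, h.2⟩)
  have h := integral_mul_step M π t hf hY hB
  rw [integral_stateAction M π t
    (fun x y => (if x = s ∧ y = a then (1 : ℝ) else 0) * M.stepMean t Y x y)] at h
  rw [ProbabilityTheory.cond, integral_smul_measure, ← integral_indicator (measurableSet_stateAction t s a)]
  have h2 : ∫ ω, {ω : Traj S A H | ω.state t.castSucc = s ∧ ω.action t = a}.indicator
      (fun ω => Y (ω.state t.succ) (ω.rew t)) ω ∂(M.law π) =
      M.stateActionOcc π t s a * M.stepMean t Y s a := by
    have : ∀ ω : Traj S A H, {ω : Traj S A H | ω.state t.castSucc = s ∧ ω.action t = a}.indicator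
      (fun ω => Y (ω.state t.succ) (ω.rew t)) ω =
        (if ω.state t.castSucc = s ∧ ω.action t = a then (1 : ℝ) else 0) *
          Y (ω.state t.succ) (ω.rew t) := fun ω => by simp [Set.indicator_apply]
    simp only [this]
    rw [h, stateActionOcc_eq]
    simp [ite_and, mul_assoc]
  rw [h2, ENNReal.toReal_inv, smul_eq_mul]
  exact inv_mul_cancel_left₀ hp.ne' _

lemma stepVar_eq {R : ℝ} (hM : M.RewardsIn R)
    (hR : 0 ≤ R) (μ : Policy S A H) (t : Fin H) (s : S) (a : A)
    (hp : 0 < M.stateActionOcc μ t s a)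
    (hV : ∀ s', 0 < M.trans t s a s' → 0 < M.stateOcc π t.succ s') :
    M.stepVar π μ t s a = M.stepVariance t (M.target π R t) s a := by
  set E : Set (Traj S A H) := {ω | ω.state t.castSucc = s ∧ ω.action t = a}
  have hae : ∀ᵐ ω ∂(M.law μ), ω.state t.castSucc = s → ω.action t = a →
      ω.rew t ∈ {r | M.valueFun π t.succ (ω.state t.succ) + r =
        M.target π R t (ω.state t.succ) r} := by
    refine M.ae_step μ t s a (Q := fun s' => {r | M.valueFun π t.succ s' + r =
      M.target π R t s' r}) (fun s' => ?_) fun s' hs' => ?_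
    · exact measurableSet_eq_fun (by fun_prop) (M.measurable_target π R t s')
    · filter_upwards [hM t s a s' hs'] with r hr
      rw [target, M.valueFun_eq π hM hR _ _ (hV s' hs'), clip_of_mem hr]
  have hae' : (fun ω => M.valueFun π t.succ (ω.state t.succ) + ω.rew t) =ᵐ[(M.law μ)[|E]]
      fun ω => M.target π R t (ω.state t.succ) (ω.rew t) := by
    refine Measure.ae_smul_measure ?_ _
    refine (ae_restrict_iff' (measurableSet_stateAction t s a)).2 ?_
    filter_upwards [hae] with ω hω hE
    exact hω hE.1 hE.2
  have hm := (HistoryFun.step (S := S) (A := A) (t := t) (r := Eq) (M.measurable_target π R t)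
    (M.abs_target_le π hR t) (by rintro x y rfl; rfl) (by rintro x y rfl; rfl)).meas
  rw [stepVar, variance_congr hae', variance_eq_integral hm.aemeasurable,
    M.integral_cond_stateAction μ t s a (M.measurable_target π R t) (M.abs_target_le π hR t) hp]
  refine M.integral_cond_stateAction μ t s a (Y := fun s' r => (M.target π R t s' r -
    M.stepMean t (M.target π R t) s a) ^ 2) (B := (H * R) ^ 2)
    (fun s' => ((M.measurable_target π R t s').sub_const _).pow_const 2) (fun s' r => ?_) hp
  have h1 := M.target_mem π hR t s' r
  have h2 := M.stepMean_mem_Icc t (M.measurable_target π R t) (M.target_mem π hR t) s a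
  rw [abs_of_nonneg (sq_nonneg _), sq_le_sq, abs_of_nonneg (h1.1.trans h1.2), abs_le]
  constructor <;> linarith [h1.1, h1.2, h2.1, h2.2]

/-- The leading coefficient in terms of the value functions given by the Bellman recursion. -/
lemma leadingVar_eq {R : ℝ} (hM : M.RewardsIn R)
    (hR : 0 ≤ R) (μ : Policy S A H) (hs : ∀ (t : Fin H) (s : S), 0 < M.stateOcc μ t.castSucc s)
    (ha : ∀ (t : Fin H) (s : S) (a : A), 0 < μ.prob t s a) :
    M.leadingVar π μ = Var[fun ω => M.bellmanValue π R 0 (ω.state 0); M.law μ] +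
      ∑ t : Fin H, ∑ s : S, ∑ a : A,
        M.stateOcc π t.castSucc s ^ 2 / M.stateOcc μ t.castSucc s *
          (π.prob t s a ^ 2 / μ.prob t s a) * M.stepVariance t (M.target π R t) s a := by
  unfold leadingVar
  congr 1
  · refine variance_congr ?_
    have h := integral_state_zero M μ (fun s => if M.init s = 0 then 1 else 0)
    simp only [mul_ite, mul_one, mul_zero] at h
    rw [Finset.sum_eq_zero (fun s _ => by split_ifs with h' <;> simp [h'])] at h
    rw [integral_eq_zero_iff_of_nonneg (fun ω => by simp only [Pi.zero_apply]; split_ifs <;> norm_num)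
      ((HistoryFun.of_finite (r := Eq) (Traj.measurable_state 0) (by rintro x y rfl; rfl)
        (fun s => if M.init s = 0 then (1 : ℝ) else 0)).integrable _)] at h
    filter_upwards [h] with ω hω
    refine M.valueFun_eq π hM hR 0 _ ?_
    rw [stateOcc_zero]
    refine lt_of_le_of_ne (M.init_nonneg _) fun h0 => ?_
    simp [← h0] at hω
  · refine Finset.sum_congr rfl fun t _ => Finset.sum_congr rfl fun s _ =>
      Finset.sum_congr rfl fun a _ => ?_
    rcases (M.stateOcc_nonneg π t.castSucc s).eq_or_lt with h1 | h1
    · simp [← h1]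
    rcases (π.prob_nonneg t s a).eq_or_lt with h2 | h2
    · simp [← h2]
    rw [M.stepVar_eq π hM hR μ t s a]
    · rw [stateActionOcc_eq]
      exact mul_pos (hs t s) (ha t s a)
    · exact fun s' hs' => M.stateOcc_succ_pos π h1 h2 hs'

end TabularMDP

/-! ### Independent samples -/

section Resample

variable {Ω : Type*} [MeasurableSpace Ω] {n : ℕ}

/-- Resampling one coordinate of an independent sample leaves its law unchanged. -/
lemma measurePreserving_update (ν : Measure Ω) [IsProbabilityMeasure ν] (i : Fin n) :
    MeasurePreserving (fun p : (Fin n → Ω) × Ω => Function.update p.1 i p.2)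
      ((Measure.pi fun _ : Fin n => ν).prod ν) (Measure.pi fun _ : Fin n => ν) := by
  have hm : Measurable (fun p : (Fin n → Ω) × Ω => Function.update p.1 i p.2) := by
    refine measurable_pi_lambda _ fun j => ?_
    by_cases h : j = i
    · subst h
      simpa using measurable_snd
    · simp only [Function.update_of_ne h]
      exact (measurable_pi_apply j).comp measurable_fst
  refine ⟨hm, (Measure.pi_eq fun B hB => ?_).symm⟩
  rw [Measure.map_apply hm (MeasurableSet.univ_pi hB)]
  have : (fun p : (Fin n → Ω) × Ω => Function.update p.1 i p.2) ⁻¹' (Set.univ.pi B) =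
      (Set.univ.pi (Function.update B i Set.univ)) ×ˢ B i := by
    ext ⟨D, x⟩
    simp only [Set.mem_preimage, Set.mem_pi, Set.mem_univ, true_imp_iff, Set.mem_prod]
    constructor
    · intro h
      refine ⟨fun j => ?_, by simpa using h i⟩
      by_cases hj : j = i
      · subst hj; simp
      · simpa [hj] using h j
    · rintro ⟨h1, h2⟩ j
      by_cases hj : j = i
      · subst hj; simpa using h2
      · simpa [hj] using h1 j
  rw [this, Measure.prod_prod, Measure.pi_pi, ← Finset.prod_erase_mul _ _ (Finset.mem_univ i),
    ← Finset.prod_erase_mul _ (fun j => ν (B j)) (Finset.mem_univ i)]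
  simp only [Function.update_self, measure_univ, mul_one]
  congr 1
  refine Finset.prod_congr rfl fun j hj => ?_
  rw [Function.update_of_ne (Finset.ne_of_mem_erase hj)]

lemma integral_pi_update (ν : Measure Ω) [IsProbabilityMeasure ν] (i : Fin n)
    {F : (Fin n → Ω) → ℝ} (hF : HistoryFun Eq F) :
    ∫ D, F D ∂(Measure.pi fun _ : Fin n => ν) =
      ∫ D, ∫ x, F (Function.update D i x) ∂ν ∂(Measure.pi fun _ : Fin n => ν) := by
  have h := measurePreserving_update ν i
  rw [← integral_prod (fun p : (Fin n → Ω) × Ω => F (Function.update p.1 i p.2))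
    ((hF.comp (r' := Eq) h.measurable (by rintro x y rfl; rfl)).integrable _)]
  conv_lhs => rw [← h.map_eq]
  rw [integral_map h.measurable.aemeasurable hF.meas.aestronglyMeasurable]

lemma exp_neg_le_quadratic {x : ℝ} (hx : 0 ≤ x) : Real.exp (-x) ≤ 1 - x + x ^ 2 / 2 := by
  have h := Real.quadratic_le_exp_of_nonneg hx
  have h1 : 0 < 1 - x + x ^ 2 / 2 := by nlinarith [sq_nonneg (x - 1)]
  rw [Real.exp_neg, inv_le_comm₀ (Real.exp_pos x) h1]
  refine le_trans ?_ h
  rw [inv_le_iff_one_le_mul₀ h1]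
  nlinarith [sq_nonneg (x ^ 2)]

/-- Multiplicative Chernoff bound for the lower tail of a binomial count. -/
lemma chernoff_lower (ν : Measure Ω) [IsProbabilityMeasure ν] {B : Set Ω} (hB : MeasurableSet B)
    {δ : ℝ} (hδ : 0 ≤ δ) :
    (Measure.pi fun _ : Fin n => ν).real
        {D | ∑ i, B.indicator (fun _ => (1 : ℝ)) (D i) ≤ (1 - δ) * (n * ν.real B)} ≤
      Real.exp (-(δ ^ 2 / 2 * (n * ν.real B))) := by
  set X : (Fin n → Ω) → ℝ := fun D => ∑ i, B.indicator (fun _ => (1 : ℝ)) (D i) with hX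
  have hind : Measurable (B.indicator (fun _ => (1 : ℝ))) := measurable_const.indicator hB
  have hXm : Measurable X := by
    refine Finset.measurable_sum _ fun i _ => hind.comp (measurable_pi_apply i)
  have hX0 : ∀ D, 0 ≤ X D := fun D =>
    Finset.sum_nonneg fun i _ => Set.indicator_nonneg (fun _ _ => zero_le_one) _
  have hint : Integrable (fun D => Real.exp (-δ * X D)) (Measure.pi fun _ : Fin n => ν) := by
    refine Integrable.of_bound
      (Real.measurable_exp.comp (hXm.const_mul (-δ))).aestronglyMeasurable 1
      (ae_of_all _ fun D => ?_)
    rw [Real.norm_eq_abs, Real.abs_exp, Real.exp_le_one_iff]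
    nlinarith [hX0 D]
  refine (measure_le_le_exp_mul_mgf (t := -δ) ((1 - δ) * (n * ν.real B)) (by linarith) hint).trans ?_
  have h1 : ∫ x, Real.exp (-δ * B.indicator (fun _ => (1 : ℝ)) x) ∂ν =
      1 + (Real.exp (-δ) - 1) * ν.real B := by
    have : ∀ x, Real.exp (-δ * B.indicator (fun _ => (1 : ℝ)) x) =
        1 + (Real.exp (-δ) - 1) * B.indicator (fun _ => (1 : ℝ)) x := by
      intro x
      by_cases hx : x ∈ B <;> simp [hx]
    simp only [this]
    rw [integral_add (integrable_const _)
      (((integrable_const (1 : ℝ)).indicator hB).const_mul _), integral_const_mul,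
      integral_indicator_const _ hB]
    simp
  have hmgf : mgf X (Measure.pi fun _ : Fin n => ν) (-δ) =
      (1 + (Real.exp (-δ) - 1) * ν.real B) ^ n := by
    have h2 : ∀ D, Real.exp (-δ * X D) =
        ∏ i, Real.exp (-δ * B.indicator (fun _ => (1 : ℝ)) (D i)) := by
      intro D
      rw [← Real.exp_sum, hX, Finset.mul_sum]
    simp only [mgf, h2]
    rw [integral_fintype_prod_eq_pow
      (fun x => Real.exp (-δ * B.indicator (fun _ => (1 : ℝ)) x)), h1, Fintype.card_fin]
  rw [hmgf]
  have hp : 0 ≤ ν.real B := measureReal_nonneg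
  have hp1 : ν.real B ≤ 1 := measureReal_le_one
  have h3 : 1 + (Real.exp (-δ) - 1) * ν.real B ≤ Real.exp (-(δ - δ ^ 2 / 2) * ν.real B) := by
    have h4 := Real.add_one_le_exp (-(δ - δ ^ 2 / 2) * ν.real B)
    nlinarith [exp_neg_le_quadratic hδ]
  have h0 : 0 ≤ 1 + (Real.exp (-δ) - 1) * ν.real B := by
    nlinarith [Real.exp_pos (-δ)]
  calc _ ≤ Real.exp (- -δ * ((1 - δ) * (n * ν.real B))) *
        Real.exp (-(δ - δ ^ 2 / 2) * ν.real B) ^ n := by gcongr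
    _ = _ := by
        rw [← Real.exp_nat_mul, ← Real.exp_add]
        congr 1
        ring

end Resample

/-! ### Martingale differences in the sample -/

namespace TabularMDP

variable {S A : Type*} {H n : ℕ}

/-- All episodes of two samples have the same history up to the action at step `t`. -/
def SameData (t : Fin H) (D D' : Fin n → Traj S A H) : Prop :=
  ∀ i, Traj.SameAction t (D i) (D' i)

/-- Two samples agree except that episode `i` may differ after the action at step `t`. -/
def SameDataAt (i : Fin n) (t : Fin H) (D D' : Fin n → Traj S A H) : Prop :=
  (∀ j, j ≠ i → D j = D' j) ∧ Traj.SameAction t (D i) (D' i)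

lemma _root_.Traj.SameAction.refl (t : Fin H) (ω : Traj S A H) : Traj.SameAction t ω ω :=
  ⟨⟨fun _ _ => rfl, fun _ _ => ⟨rfl, rfl⟩⟩, rfl⟩

lemma SameDataAt.sameData {i : Fin n} {t : Fin H} {D D' : Fin n → Traj S A H}
    (h : SameDataAt i t D D') : SameData t D D' := by
  intro j
  by_cases hj : j = i
  · subst hj; exact h.2
  · rw [h.1 j hj]; exact Traj.SameAction.refl t _

variable [Fintype S] [Fintype A] [DecidableEq S] [DecidableEq A]
  [MeasurableSpace S] [MeasurableSpace A] [MeasurableSingletonClass S]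
  [MeasurableSingletonClass A] (M : TabularMDP S A H) (μ : Policy S A H)

/-- The law of `n` independent episodes. -/
noncomputable abbrev sampleLaw (n : ℕ) : Measure (Fin n → Traj S A H) :=
  Measure.pi fun _ : Fin n => M.law μ

/-- The deviation of `Y s_{t+1} r_t` from its conditional mean, for one episode. -/
noncomputable def noise (t : Fin H) (Y : S → ℝ → ℝ) (ω : Traj S A H) : ℝ :=
  Y (ω.state t.succ) (ω.rew t) - M.stepMean t Y (ω.state t.castSucc) (ω.action t)

section

variable {t : Fin H} {Y : S → ℝ → ℝ} {B : ℝ} (hY : ∀ s, Measurable (Y s))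
  (hB : ∀ s r, |Y s r| ≤ B)

lemma historyFun_apply {r : (Fin n → Traj S A H) → (Fin n → Traj S A H) → Prop} {j : Fin n}
    {f : Traj S A H → ℝ} {r' : Traj S A H → Traj S A H → Prop} (hf : HistoryFun r' f)
    (h : ∀ D D', r D D' → r' (D j) (D' j)) : HistoryFun r (fun D => f (D j)) :=
  hf.comp (measurable_pi_apply j) h

lemma historyFun_stateAction_apply (t : Fin H) (i : Fin n) (g : S → A → ℝ) :
    HistoryFun (SameData t) (fun D : Fin n → Traj S A H =>
      g ((D i).state t.castSucc) ((D i).action t)) :=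
  historyFun_apply (j := i) (r' := Traj.SameAction t) (HistoryFun.stateAction g
      fun _ _ h => ⟨h.1.1 _ le_rfl, h.2⟩) fun _ _ h => h i

include hY hB in
lemma historyFun_step_apply (i : Fin n) : HistoryFun Eq (fun D : Fin n → Traj S A H =>
    Y ((D i).state t.succ) ((D i).rew t)) :=
  historyFun_apply (j := i) (r' := Eq) (HistoryFun.step (t := t) hY hB
    (by rintro x y rfl; rfl) (by rintro x y rfl; rfl)) (by rintro x y rfl; rfl)

include hY hB in
lemma historyFun_noise : HistoryFun Eq (M.noise t Y) :=
  (HistoryFun.step hY hB (by rintro x y rfl; rfl) (by rintro x y rfl; rfl)).sub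
    (HistoryFun.stateAction _ (by rintro x y rfl; exact ⟨rfl, rfl⟩))

include hY hB in
lemma integral_sample_mul_step (i : Fin n) {W : (Fin n → Traj S A H) → ℝ}
    (hW : HistoryFun (SameDataAt i t) W) :
    ∫ D, W D * Y ((D i).state t.succ) ((D i).rew t) ∂(M.sampleLaw μ n) =
      ∫ D, W D * M.stepMean t Y ((D i).state t.castSucc) ((D i).action t)
        ∂(M.sampleLaw μ n) := by
  have hL := hW.toEq.mul (historyFun_step_apply hY hB i (t := t))
  have hR := hW.toEq.mul (historyFun_stateAction_apply t i (M.stepMean t Y)).toEq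
  rw [integral_pi_update (M.law μ) i hL, integral_pi_update (M.law μ) i hR]
  refine integral_congr_ae (ae_of_all _ fun D => ?_)
  simp only [Function.update_self]
  refine integral_mul_step M μ t (hW.comp (φ := fun x => Function.update D i x)
    (measurable_update D) fun x y h => ⟨fun j hj => ?_, ?_⟩) hY hB
  · simp [hj]
  · simpa using h

include hY hB in
lemma integral_mul_noise (i : Fin n) {W : (Fin n → Traj S A H) → ℝ}
    (hW : HistoryFun (SameDataAt i t) W) :
    ∫ D, W D * M.noise t Y (D i) ∂(M.sampleLaw μ n) = 0 := by
  have hL := hW.toEq.mul (historyFun_step_apply hY hB i (t := t))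
  have hR := hW.toEq.mul (historyFun_stateAction_apply t i (M.stepMean t Y)).toEq
  simp only [noise, mul_sub]
  rw [integral_sub (hL.integrable _) (hR.integrable _), M.integral_sample_mul_step μ hY hB i hW,
    sub_self]

include hY hB in
lemma integral_mul_noise_sq (i : Fin n) {W : (Fin n → Traj S A H) → ℝ}
    (hW : HistoryFun (SameDataAt i t) W) :
    ∫ D, W D * M.noise t Y (D i) ^ 2 ∂(M.sampleLaw μ n) =
      ∫ D, W D * M.stepVariance t Y ((D i).state t.castSucc) ((D i).action t)
        ∂(M.sampleLaw μ n) := by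
  have hY2 : ∀ s, Measurable (fun r => Y s r ^ 2) := fun s => (hY s).pow_const 2
  have hB2 : ∀ s r, |Y s r ^ 2| ≤ B ^ 2 := fun s r => by
    rw [abs_pow]; exact pow_le_pow_left₀ (abs_nonneg _) (hB s r) 2
  have hg : ∀ g : S → A → ℝ, HistoryFun (SameDataAt i t) (fun D : Fin n → Traj S A H =>
      g ((D i).state t.castSucc) ((D i).action t)) := fun g =>
    (historyFun_stateAction_apply t i g).mono fun _ _ h => h.sameData
  have hWm := hW.mul (hg (M.stepMean t Y))
  have h1 := M.integral_sample_mul_step μ hY2 hB2 i hW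
  have h2 := M.integral_mul_noise μ hY hB i hWm
  have e1 : ∀ D : Fin n → Traj S A H, W D * M.noise t Y (D i) ^ 2 =
      W D * (Y ((D i).state t.succ) ((D i).rew t) ^ 2)
      - 2 * (W D * M.stepMean t Y ((D i).state t.castSucc) ((D i).action t) * M.noise t Y (D i))
      - W D * M.stepMean t Y ((D i).state t.castSucc) ((D i).action t) ^ 2 := by
    intro D; simp only [noise]; ring
  have i1 := (hW.toEq.mul (historyFun_step_apply hY2 hB2 i (t := t))).integrable
      (M.sampleLaw μ n)
  have i2 := ((hWm.toEq.mul (historyFun_apply (r := Eq) (j := i) (M.historyFun_noise (t := t) hY hB)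
    (by rintro x y rfl; rfl))).integrable (M.sampleLaw μ n)).const_mul 2
  have i3 := (hW.mul (hg fun s a => M.stepMean t Y s a ^ 2)).toEq.integrable (M.sampleLaw μ n)
  have i4 := (hW.mul (hg (M.stepMean t fun s' r => Y s' r ^ 2))).toEq.integrable (M.sampleLaw μ n)
  simp only [e1]
  have i5 : Integrable (fun D : Fin n → Traj S A H =>
      W D * (Y ((D i).state t.succ) ((D i).rew t) ^ 2)
      - 2 * (W D * M.stepMean t Y ((D i).state t.castSucc) ((D i).action t) *
        M.noise t Y (D i))) (M.sampleLaw μ n) := i1.sub i2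
  rw [integral_sub i5 i3, integral_sub i1 i2, integral_const_mul, h2, mul_zero, sub_zero,
    h1, ← integral_sub i4 i3]
  refine integral_congr_ae (ae_of_all _ fun D => ?_)
  simp only [M.stepVariance_eq t hY hB]
  ring

include hY hB in
/-- Adding a predictable combination of one-step deviations does not change the mean. -/
theorem integral_add_sum_noise {W : (Fin n → Traj S A H) → ℝ}
    {b : Fin n → (Fin n → Traj S A H) → ℝ} (hW : HistoryFun (SameData t) W)
    (hb : ∀ i, HistoryFun (SameData t) (b i)) :
    ∫ D, (W D + ∑ i, b i D * M.noise t Y (D i)) ∂(M.sampleLaw μ n) =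
      ∫ D, W D ∂(M.sampleLaw μ n) := by
  have hn : ∀ i : Fin n, HistoryFun Eq (fun D : Fin n → Traj S A H => M.noise t Y (D i)) :=
    fun i => historyFun_apply (M.historyFun_noise hY hB) (by rintro x y rfl; rfl)
  rw [integral_add (hW.toEq.integrable _)
    (integrable_finsetSum _ fun i _ => ((hb i).toEq.mul (hn i)).integrable _),
    integral_finsetSum _ fun i _ => ((hb i).toEq.mul (hn i)).integrable _,
    Finset.sum_eq_zero, add_zero]
  exact fun i _ => M.integral_mul_noise μ hY hB i ((hb i).mono fun _ _ h => h.sameData)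

include hY hB in
/-- One-step deviations of different episodes are orthogonal to each other and to the past, so
the second moment of a predictable combination is that of the past plus the accumulated
conditional variances. -/
theorem integral_sq_add_sum_noise {W : (Fin n → Traj S A H) → ℝ}
    {b : Fin n → (Fin n → Traj S A H) → ℝ} (hW : HistoryFun (SameData t) W)
    (hb : ∀ i, HistoryFun (SameData t) (b i)) :
    ∫ D, (W D + ∑ i, b i D * M.noise t Y (D i)) ^ 2 ∂(M.sampleLaw μ n) =
      ∫ D, W D ^ 2 ∂(M.sampleLaw μ n) + ∫ D, ∑ i, b i D ^ 2 *
        M.stepVariance t Y ((D i).state t.castSucc) ((D i).action t) ∂(M.sampleLaw μ n) := by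
  have hn : ∀ i : Fin n, HistoryFun Eq (fun D : Fin n → Traj S A H => M.noise t Y (D i)) :=
    fun i => historyFun_apply (M.historyFun_noise hY hB) (by rintro x y rfl; rfl)
  have e1 : ∀ D : Fin n → Traj S A H, (W D + ∑ i, b i D * M.noise t Y (D i)) ^ 2 =
      (W D ^ 2 + ∑ i, 2 * W D * b i D * M.noise t Y (D i)) +
      ∑ i, ∑ j, b i D * (b j D * M.noise t Y (D j)) * M.noise t Y (D i) := by
    intro D
    rw [add_sq, pow_two (∑ i, b i D * M.noise t Y (D i)), Finset.sum_mul_sum, Finset.mul_sum]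
    refine congrArg₂ (· + ·) (congrArg₂ (· + ·) rfl ?_) ?_
    · exact Finset.sum_congr rfl fun _ _ => by ring
    · exact Finset.sum_congr rfl fun _ _ => Finset.sum_congr rfl fun _ _ => by ring
  have hc : ∀ i j, HistoryFun Eq (fun D : Fin n → Traj S A H =>
      b i D * (b j D * M.noise t Y (D j)) * M.noise t Y (D i)) := fun i j =>
    ((hb i).toEq.mul ((hb j).toEq.mul (hn j))).mul (hn i)
  simp only [e1]
  rw [integral_add, M.integral_add_sum_noise μ hY hB (b := fun i D => 2 * W D * b i D) hW.sq
    fun i => ((HistoryFun.const 2).mul hW).mul (hb i)]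
  · congr 1
    rw [integral_finsetSum _ fun i _ => integrable_finsetSum _ fun j _ => (hc i j).integrable _,
      integral_finsetSum _ fun i _ => ((hb i).sq.mul (historyFun_stateAction_apply t i (M.stepVariance t Y))).toEq.integrable _]
    refine Finset.sum_congr rfl fun i _ => ?_
    rw [integral_finsetSum _ fun j _ => (hc i j).integrable _, Finset.sum_eq_single i]
    · rw [← M.integral_mul_noise_sq μ hY hB i ((hb i).sq.mono fun _ _ h => h.sameData)]
      exact integral_congr_ae (ae_of_all _ fun D => by ring)
    · intro j _ hj
      refine M.integral_mul_noise μ hY hB i ?_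
      refine ((hb i).mono fun _ _ h => h.sameData).mul
        (((hb j).mono fun _ _ h => h.sameData).mul ?_)
      exact historyFun_apply (M.historyFun_noise hY hB) fun D D' h => h.1 j hj
    · simp
  · exact ((hW.sq.toEq).add (HistoryFun.sum fun i _ =>
      (((HistoryFun.const 2).mul hW).mul (hb i)).toEq.mul (hn i))).integrable _
  · exact (HistoryFun.sum fun i _ => HistoryFun.sum fun j _ => hc i j).integrable _

end

end TabularMDP

/-! ### Empirical averages and the estimated occupancies -/

namespace TMIS

variable {S A : Type*} [DecidableEq S] [DecidableEq A] {H n : ℕ}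

/-- The average of `Y s_{t+1} r_t` over the episodes that visit `(s, a)` at step `t` (`0` if there
are none). -/
noncomputable def avg (D : Fin n → Traj S A H) (t : Fin H) (Y : S → ℝ → ℝ) (s : S) (a : A) : ℝ :=
  (∑ i with (D i).state t.castSucc = s ∧ (D i).action t = a,
    Y ((D i).state t.succ) ((D i).rew t)) / (count D t s a : ℝ)

lemma avg_mem_Icc (D : Fin n → Traj S A H) (t : Fin H) {Y : S → ℝ → ℝ} {B : ℝ}
    (h : ∀ s r, Y s r ∈ Set.Icc 0 B) (hB : 0 ≤ B) (s : S) (a : A) :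
    avg D t Y s a ∈ Set.Icc 0 B := by
  refine ⟨div_nonneg (Finset.sum_nonneg fun i _ => (h _ _).1) (Nat.cast_nonneg _), ?_⟩
  refine div_le_of_le_mul₀ (Nat.cast_nonneg _) hB ?_
  refine (Finset.sum_le_sum fun i _ => (h _ _).2).trans (le_of_eq ?_)
  rw [Finset.sum_const, nsmul_eq_mul, mul_comm]
  rfl

lemma avg_add (D : Fin n → Traj S A H) (t : Fin H) (Y Z : S → ℝ → ℝ) (s : S) (a : A) :
    avg D t (fun s' r => Y s' r + Z s' r) s a = avg D t Y s a + avg D t Z s a := by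
  simp [avg, Finset.sum_add_distrib, add_div]

variable [Fintype S] [Fintype A]

lemma sum_transHat_mul (D : Fin n → Traj S A H) (t : Fin H) (φ : S → ℝ) (s : S) (a : A) :
    ∑ s', transHat D t s a s' * φ s' = avg D t (fun s' _ => φ s') s a := by
  simp only [transHat, avg, div_mul_eq_mul_div, ← Finset.sum_div]
  congr 1
  have h1 : ∀ i, φ ((D i).state t.succ) =
      ∑ s', if (D i).state t.succ = s' then φ s' else 0 := fun i => by simp
  simp only [h1]
  rw [Finset.sum_comm]
  refine Finset.sum_congr rfl fun s' _ => ?_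
  rw [← Finset.sum_filter, Finset.filter_filter, Finset.sum_const, nsmul_eq_mul]
  simp only [and_assoc]

/-- Forward recursion for the estimated occupancies, tested against a function `φ`. -/
lemma sum_occHat_succ (π : Policy S A H) (D : Fin n → Traj S A H) (t : Fin H) (φ : S → ℝ) :
    ∑ s, occHat π D t.succ s * φ s =
      ∑ s, occHat π D t.castSucc s * ∑ a, π.prob t s a * avg D t (fun s' _ => φ s') s a := by
  have h : ∀ s', occHat π D t.succ s' =
      ∑ s, (∑ a, transHat D t s a s' * π.prob t s a) * occHat π D t.castSucc s := by
    intro s'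
    simp [occHat, Fin.induction_succ]
  simp only [h, ← sum_transHat_mul, Finset.sum_mul, Finset.mul_sum]
  rw [Finset.sum_comm]
  refine Finset.sum_congr rfl fun s _ => ?_
  rw [Finset.sum_comm]
  exact Finset.sum_congr rfl fun a _ => Finset.sum_congr rfl fun s' _ => by ring

lemma occHat_zero (π : Policy S A H) (D : Fin n → Traj S A H) (s : S) :
    occHat π D 0 s =
      ((Finset.univ.filter fun i => (D i).state 0 = s).card : ℝ) / (n : ℝ) := by
  simp [occHat]

lemma sum_occHat_zero (π : Policy S A H) (D : Fin n → Traj S A H) (φ : S → ℝ) :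
    ∑ s, occHat π D 0 s * φ s = (∑ i, φ ((D i).state 0)) / n := by
  simp only [occHat_zero, div_mul_eq_mul_div, ← Finset.sum_div]
  congr 1
  have h1 : ∀ i, φ ((D i).state 0) =
      ∑ s', if (D i).state 0 = s' then φ s' else 0 := fun i => by simp
  simp only [h1]
  rw [Finset.sum_comm]
  refine Finset.sum_congr rfl fun s' _ => ?_
  rw [← Finset.sum_filter, Finset.sum_const, nsmul_eq_mul]

lemma occHat_nonneg (π : Policy S A H) (D : Fin n → Traj S A H) (t : Fin (H + 1)) (s : S) :
    0 ≤ occHat π D t s := by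
  induction t using Fin.induction generalizing s with
  | zero => rw [occHat_zero]; positivity
  | succ t ih =>
    have h := sum_occHat_succ π D t (Pi.single s 1)
    simp only [Pi.single_apply, mul_ite, mul_one, mul_zero, Finset.sum_ite_eq', Finset.mem_univ,
      if_true] at h
    rw [h]
    refine Finset.sum_nonneg fun x _ => mul_nonneg (ih x) (Finset.sum_nonneg fun a _ =>
      mul_nonneg ((π.prob_mem t x).1 a)
        (avg_mem_Icc D t (B := 1) (fun s' _ => ?_) zero_le_one x a).1)
    split_ifs <;> simp

lemma sum_occHat_le_one (π : Policy S A H) (D : Fin n → Traj S A H) (t : Fin (H + 1)) :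
    ∑ s, occHat π D t s ≤ 1 := by
  induction t using Fin.induction with
  | zero =>
    have h := sum_occHat_zero π D (fun _ => 1)
    simp only [mul_one] at h
    rw [h]
    simpa using div_self_le_one (n : ℝ)
  | succ t ih =>
    have h := sum_occHat_succ π D t (fun _ => 1)
    simp only [mul_one] at h
    rw [h]
    refine le_trans (Finset.sum_le_sum fun s _ => ?_) ih
    refine mul_le_of_le_one_right (occHat_nonneg π D _ s) ?_
    calc _ ≤ ∑ a, π.prob t s a :=
          Finset.sum_le_sum fun a _ => mul_le_of_le_one_right ((π.prob_mem t s).1 a)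
            (avg_mem_Icc D t (fun _ _ => ⟨zero_le_one, le_rfl⟩) zero_le_one s a).2
      _ = 1 := (π.prob_mem t s).2

lemma occHat_le_one (π : Policy S A H) (D : Fin n → Traj S A H) (t : Fin (H + 1)) (s : S) :
    occHat π D t s ≤ 1 :=
  (Finset.single_le_sum (fun s _ => occHat_nonneg π D t s) (Finset.mem_univ s)).trans
    (sum_occHat_le_one π D t)

lemma sum_occHat_mul_mem_Icc (π : Policy S A H) (D : Fin n → Traj S A H) (t : Fin (H + 1))
    {φ : S → ℝ} {B : ℝ} (h : ∀ s, φ s ∈ Set.Icc 0 B) (hB : 0 ≤ B) :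
    ∑ s, occHat π D t s * φ s ∈ Set.Icc 0 B := by
  refine ⟨Finset.sum_nonneg fun s _ => mul_nonneg (occHat_nonneg π D t s) (h s).1, ?_⟩
  calc _ ≤ ∑ s, occHat π D t s * B :=
        Finset.sum_le_sum fun s _ => mul_le_mul_of_nonneg_left (h s).2 (occHat_nonneg π D t s)
    _ ≤ 1 * B := by
        rw [← Finset.sum_mul]
        exact mul_le_mul_of_nonneg_right (sum_occHat_le_one π D t) hB
    _ = B := one_mul B

lemma count_congr {D D' : Fin n → Traj S A H} {t : Fin H}
    (h : ∀ i, (D i).state t.castSucc = (D' i).state t.castSucc ∧ (D i).action t = (D' i).action t)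
    (s : S) (a : A) : count D t s a = count D' t s a := by
  simp only [count, fun i => (h i).1, fun i => (h i).2]

lemma occHat_congr (π : Policy S A H) {D D' : Fin n → Traj S A H} (t : Fin (H + 1))
    (h : ∀ i, (∀ j ≤ t, (D i).state j = (D' i).state j) ∧
      ∀ j : Fin H, j.castSucc < t → (D i).action j = (D' i).action j) (s : S) :
    occHat π D t s = occHat π D' t s := by
  induction t using Fin.induction generalizing s with
  | zero => simp only [occHat_zero, fun i => (h i).1 0 le_rfl]
  | succ t ih =>
    have h1 : ∀ i, (D i).state t.castSucc = (D' i).state t.castSucc := fun i =>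
      (h i).1 _ (Fin.castSucc_le_succ t)
    have h2 : ∀ i, (D i).state t.succ = (D' i).state t.succ := fun i => (h i).1 _ le_rfl
    have h3 : ∀ i, (D i).action t = (D' i).action t := fun i =>
      (h i).2 t Fin.castSucc_lt_succ
    have ih' := ih fun i => ⟨fun j hj => (h i).1 j (hj.trans (Fin.castSucc_le_succ t)),
      fun j hj => (h i).2 j (hj.trans Fin.castSucc_lt_succ)⟩
    have e := sum_occHat_succ π D t (Pi.single s 1)
    have e' := sum_occHat_succ π D' t (Pi.single s 1)
    simp only [avg, count_congr (fun i => ⟨h1 i, h3 i⟩), h1, h2, h3, ih'] at e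
    simp only [avg] at e'
    rw [← e'] at e
    simpa [Pi.single_apply] using e

lemma sum_episodes (D : Fin n → Traj S A H) (t : Fin H) (F : S → A → ℝ) :
    ∑ i, F ((D i).state t.castSucc) ((D i).action t) = ∑ s, ∑ a, (count D t s a : ℝ) * F s a := by
  have h1 : ∀ i, F ((D i).state t.castSucc) ((D i).action t) =
      ∑ s, ∑ a, if (D i).state t.castSucc = s ∧ (D i).action t = a then F s a else 0 :=
    fun i => by simp [ite_and]
  simp only [h1]
  rw [Finset.sum_comm]
  refine Finset.sum_congr rfl fun s _ => ?_
  rw [Finset.sum_comm]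
  refine Finset.sum_congr rfl fun a _ => ?_
  rw [← Finset.sum_filter, Finset.sum_const, nsmul_eq_mul]
  rfl

end TMIS

/-! ### The event of sufficient visits -/

namespace TabularMDP

variable {S A : Type*} [Fintype S] [Fintype A] [DecidableEq S] [DecidableEq A]
  [MeasurableSpace S] [MeasurableSpace A] [MeasurableSingletonClass S]
  [MeasurableSingletonClass A] {H n : ℕ}

open TMIS

/-- A function of the states and actions of a sample takes finitely many values, so it is bounded
and measurable. -/
lemma historyFun_of_path {r : (Fin n → Traj S A H) → (Fin n → Traj S A H) → Prop}
    {f : (Fin n → Traj S A H) → ℝ}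
    (hpath : ∀ D D', (∀ i, (D i).1 = (D' i).1 ∧ (D i).2.1 = (D' i).2.1) → f D = f D')
    (h : ∀ D D', r D D' → f D = f D') : HistoryFun r f := by
  set p : (Fin n → Traj S A H) → (Fin n → (Fin (H + 1) → S) × (Fin H → A)) :=
    fun D i => ((D i).1, (D i).2.1) with hp
  have hpm : Measurable p := by fun_prop
  have hft : Function.FactorsThrough f p := by
    refine fun D D' hD => hpath D D' fun i => ?_
    have := congrFun hD i
    exact Prod.ext_iff.1 this
  have hf : f = fun D => Function.extend p f (fun _ => 0) (p D) :=
    funext fun D => (hft.extend_apply _ D).symm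
  have := HistoryFun.of_finite (r := Eq) hpm (by rintro x y rfl; rfl) (Function.extend p f fun _ => 0)
  rw [← hf] at this
  exact ⟨this.meas, this.bdd, h⟩

variable (M : TabularMDP S A H) (π μ : Policy S A H)

/-- Before time `k`, every state-action pair has been visited at least a third as often as expected. -/
def EnoughVisits (k : Fin (H + 1)) (D : Fin n → Traj S A H) : Prop :=
  ∀ t : Fin H, t.castSucc < k → ∀ s a, n * M.stateActionOcc μ t s a ≤ 3 * (count D t s a : ℝ)

open scoped Classical in
/-- The indicator of `EnoughVisits`. -/
noncomputable def good (k : Fin (H + 1)) (D : Fin n → Traj S A H) : ℝ :=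
  if M.EnoughVisits μ k D then 1 else 0

lemma good_eq_zero_or_one (k : Fin (H + 1)) (D : Fin n → Traj S A H) :
    M.good μ k D = 0 ∨ M.good μ k D = 1 := by
  unfold good; split_ifs <;> simp

lemma good_sq (k : Fin (H + 1)) (D : Fin n → Traj S A H) : M.good μ k D ^ 2 = M.good μ k D := by
  rcases M.good_eq_zero_or_one μ k D with h | h <;> simp [h]

lemma good_nonneg (k : Fin (H + 1)) (D : Fin n → Traj S A H) : 0 ≤ M.good μ k D := by
  rcases M.good_eq_zero_or_one μ k D with h | h <;> simp [h]

lemma good_le_one (k : Fin (H + 1)) (D : Fin n → Traj S A H) : M.good μ k D ≤ 1 := by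
  rcases M.good_eq_zero_or_one μ k D with h | h <;> simp [h]

lemma good_zero (D : Fin n → Traj S A H) : M.good μ 0 D = 1 := by
  simp [good, EnoughVisits]

lemma good_anti {k l : Fin (H + 1)} (h : k ≤ l) (D : Fin n → Traj S A H) :
    M.good μ l D ≤ M.good μ k D := by
  unfold good
  split_ifs with h1 h2
  · exact le_rfl
  · exact absurd (fun t ht => h1 t (ht.trans_le h)) h2
  · exact zero_le_one
  · exact le_rfl

lemma le_count_of_good {t : Fin H} {D : Fin n → Traj S A H} (h : M.good μ t.succ D ≠ 0)
    (s : S) (a : A) : n * M.stateActionOcc μ t s a ≤ 3 * (count D t s a : ℝ) := by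
  unfold good at h
  split_ifs at h with h1
  · exact h1 t Fin.castSucc_lt_succ s a
  · exact absurd rfl h

lemma SameData.state_action {t : Fin H} {D D' : Fin n → Traj S A H} (h : SameData t D D')
    {j : Fin H} (hj : j ≤ t) (i : Fin n) : (D i).state j.castSucc = (D' i).state j.castSucc ∧
      (D i).action j = (D' i).action j := by
  refine ⟨(h i).1.1 _ (Fin.castSucc_le_castSucc_iff.2 hj), ?_⟩
  rcases hj.eq_or_lt with rfl | hj
  · exact (h i).2
  · exact ((h i).1.2 j (Fin.castSucc_lt_castSucc_iff.2 hj)).1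

lemma good_congr {k : Fin (H + 1)} {D D' : Fin n → Traj S A H}
    (h : ∀ j : Fin H, j.castSucc < k → ∀ i, (D i).state j.castSucc = (D' i).state j.castSucc ∧
      (D i).action j = (D' i).action j) : M.good μ k D = M.good μ k D' := by
  have : M.EnoughVisits μ k D ↔ M.EnoughVisits μ k D' :=
    forall_congr' fun j => forall_congr' fun hj => by simp only [count_congr (h j hj)]
  unfold good
  by_cases hk : M.EnoughVisits μ k D
  · rw [if_pos hk, if_pos (this.1 hk)]
  · rw [if_neg hk, if_neg (mt this.2 hk)]

lemma historyFun_good (t : Fin H) :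
    HistoryFun (SameData t) (fun D : Fin n → Traj S A H => M.good μ t.succ D) := by
  refine historyFun_of_path (fun D D' h => M.good_congr μ fun j _ i => ?_)
    (fun D D' h => M.good_congr μ fun j hj i => ?_)
  · exact ⟨congrFun (h i).1 _, congrFun (h i).2 _⟩
  · exact h.state_action (Fin.castSucc_lt_succ_iff.1 hj) i

lemma historyFun_good_eq (k : Fin (H + 1)) :
    HistoryFun Eq (fun D : Fin n → Traj S A H => M.good μ k D) := by
  refine historyFun_of_path (fun D D' h => M.good_congr μ fun j _ i => ?_)
    (fun D D' h => by rw [h])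
  exact ⟨congrFun (h i).1 _, congrFun (h i).2 _⟩

lemma historyFun_count (t : Fin H) (s : S) (a : A) :
    HistoryFun (SameData t) (fun D : Fin n → Traj S A H => (count D t s a : ℝ)) := by
  refine historyFun_of_path (fun D D' h => ?_) (fun D D' h => ?_)
  · rw [count_congr fun i => ⟨congrFun (h i).1 _, congrFun (h i).2 _⟩]
  · rw [count_congr fun i => h.state_action le_rfl i]

lemma historyFun_inv_count (t : Fin H) (s : S) (a : A) :
    HistoryFun (SameData t) (fun D : Fin n → Traj S A H => (count D t s a : ℝ)⁻¹) := by
  refine historyFun_of_path (fun D D' h => ?_) (fun D D' h => ?_)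
  · rw [count_congr fun i => ⟨congrFun (h i).1 _, congrFun (h i).2 _⟩]
  · rw [count_congr fun i => h.state_action le_rfl i]

lemma SameData.occHat_eq {t : Fin H} {D D' : Fin n → Traj S A H} (h : SameData t D D') (s : S) :
    occHat π D t.castSucc s = occHat π D' t.castSucc s :=
  occHat_congr π _ (fun i => ⟨(h i).1.1, fun j hj => ((h i).1.2 j hj).1⟩) s

lemma occHat_eq_of_path {D D' : Fin n → Traj S A H}
    (h : ∀ i, (D i).1 = (D' i).1 ∧ (D i).2.1 = (D' i).2.1) (t : Fin (H + 1)) (s : S) :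
    occHat π D t s = occHat π D' t s :=
  occHat_congr π t (fun i => ⟨fun _ _ => congrFun (h i).1 _, fun _ _ => congrFun (h i).2 _⟩) s

lemma historyFun_occHat (t : Fin H) (s : S) :
    HistoryFun (SameData t) (fun D : Fin n → Traj S A H => occHat π D t.castSucc s) :=
  historyFun_of_path (fun _ _ h => occHat_eq_of_path π h _ s) (fun _ _ h => h.occHat_eq π s)

lemma historyFun_occHat_eq (t : Fin (H + 1)) (s : S) :
    HistoryFun Eq (fun D : Fin n → Traj S A H => occHat π D t s) :=
  historyFun_of_path (fun _ _ h => occHat_eq_of_path π h _ s) (fun _ _ h => by rw [h])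

/-- The factor by which the step-`t` deviation of episode `i` enters the estimator. -/
noncomputable def stepWeight (t : Fin H) (i : Fin n) (D : Fin n → Traj S A H) : ℝ :=
  M.good μ t.succ D * (occHat π D t.castSucc ((D i).state t.castSucc) *
    π.prob t ((D i).state t.castSucc) ((D i).action t) /
      count D t ((D i).state t.castSucc) ((D i).action t))

lemma historyFun_stepWeight (t : Fin H) (i : Fin n) :
    HistoryFun (SameData t) (M.stepWeight π μ t i) := by
  refine historyFun_of_path (fun D D' h => ?_) (fun D D' h => ?_)
  · have h1 : (D i).state t.castSucc = (D' i).state t.castSucc := congrFun (h i).1 _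
    have h2 : (D i).action t = (D' i).action t := congrFun (h i).2 _
    simp only [stepWeight]
    rw [h1, h2, occHat_eq_of_path π h,
      count_congr fun i => ⟨congrFun (h i).1 _, congrFun (h i).2 _⟩,
      M.good_congr μ fun j _ i => ⟨congrFun (h i).1 _, congrFun (h i).2 _⟩]
  · obtain ⟨h1, h2⟩ := h.state_action le_rfl i
    simp only [stepWeight]
    rw [h1, h2, h.occHat_eq π, count_congr fun i => h.state_action le_rfl i,
      (M.historyFun_good μ t).dep D D' h]

lemma avg_eq_add_noise (D : Fin n → Traj S A H) (t : Fin H) (Y : S → ℝ → ℝ) (s : S) (a : A)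
    (hc : count D t s a ≠ 0) :
    avg D t Y s a = M.stepMean t Y s a +
      (∑ i with (D i).state t.castSucc = s ∧ (D i).action t = a, M.noise t Y (D i)) /
        count D t s a := by
  have h : ∀ i ∈ Finset.univ.filter fun i => (D i).state t.castSucc = s ∧ (D i).action t = a,
      M.noise t Y (D i) = Y ((D i).state t.succ) ((D i).rew t) - M.stepMean t Y s a := by
    intro i hi
    rw [Finset.mem_filter] at hi
    rw [noise, hi.2.1, hi.2.2]
  rw [Finset.sum_congr rfl h, Finset.sum_sub_distrib, Finset.sum_const, nsmul_eq_mul]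
  have hc' : (count D t s a : ℝ) ≠ 0 := Nat.cast_ne_zero.2 hc
  rw [avg]
  change _ = _ + (_ - (count D t s a : ℝ) * _) / _
  field_simp
  ring

variable {M μ}

lemma count_ne_zero_of_good {t : Fin H} {s : S} {a : A} (hd : 0 < M.stateActionOcc μ t s a)
    (hn : 0 < n) {D : Fin n → Traj S A H} (h : M.good μ t.succ D ≠ 0) : count D t s a ≠ 0 := by
  intro h0
  have h1 := M.le_count_of_good μ h s a
  rw [h0] at h1
  have : 0 < (n : ℝ) * M.stateActionOcc μ t s a := mul_pos (Nat.cast_pos.2 hn) hd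
  simp at h1
  linarith

/-- One step of the estimator is its conditional mean plus a predictable combination of one-step
deviations. -/
lemma good_mul_step {t : Fin H} (hd : ∀ s a, 0 < M.stateActionOcc μ t s a) (hn : 0 < n)
    (D : Fin n → Traj S A H) (Y : S → ℝ → ℝ) :
    M.good μ t.succ D * ∑ s, occHat π D t.castSucc s * ∑ a, π.prob t s a * avg D t Y s a =
      M.good μ t.succ D *
        ∑ s, occHat π D t.castSucc s * ∑ a, π.prob t s a * M.stepMean t Y s a +
      ∑ i, M.stepWeight π μ t i D * M.noise t Y (D i) := by
  by_cases hg : M.good μ t.succ D = 0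
  · simp [hg, stepWeight]
  have h1 : ∑ i, M.stepWeight π μ t i D * M.noise t Y (D i) =
      ∑ s, ∑ a, M.good μ t.succ D * (occHat π D t.castSucc s * π.prob t s a / count D t s a) *
        ∑ i with (D i).state t.castSucc = s ∧ (D i).action t = a, M.noise t Y (D i) := by
    simp only [Finset.sum_filter, Finset.mul_sum]
    conv_rhs =>
      enter [2, s]
      rw [Finset.sum_comm]
    rw [Finset.sum_comm]
    refine Finset.sum_congr rfl fun i _ => ?_
    simp [ite_and, stepWeight]
  rw [h1]
  simp only [Finset.mul_sum, ← Finset.sum_add_distrib]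
  refine Finset.sum_congr rfl fun s _ => Finset.sum_congr rfl fun a _ => ?_
  rw [M.avg_eq_add_noise D t Y s a (count_ne_zero_of_good (hd s a) hn hg), ← Finset.mul_sum]
  ring

lemma sum_stepWeight_sq (t : Fin H) (D : Fin n → Traj S A H) (v : S → A → ℝ) :
    ∑ i, M.stepWeight π μ t i D ^ 2 * v ((D i).state t.castSucc) ((D i).action t) =
      ∑ s, ∑ a, π.prob t s a ^ 2 * v s a *
        (M.good μ t.succ D * occHat π D t.castSucc s ^ 2 * (count D t s a : ℝ)⁻¹) := by
  have h := sum_episodes D t fun s a => (M.good μ t.succ D *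
    (occHat π D t.castSucc s * π.prob t s a / count D t s a)) ^ 2 * v s a
  simp only [stepWeight]
  rw [h]
  refine Finset.sum_congr rfl fun s _ => Finset.sum_congr rfl fun a _ => ?_
  rw [mul_pow, good_sq]
  by_cases hc : (count D t s a : ℝ) = 0
  · simp [hc]
  · field_simp

section

variable {t : Fin H} {Y : S → ℝ → ℝ} {B : ℝ} (hY : ∀ s, Measurable (Y s))
  (hB : ∀ s r, |Y s r| ≤ B) (hd : ∀ s a, 0 < M.stateActionOcc μ t s a) (hn : 0 < n)

lemma historyFun_good_mul_mean (t : Fin H) (m : S → A → ℝ) :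
    HistoryFun (SameData t) (fun D : Fin n → Traj S A H => M.good μ t.succ D *
      ∑ s, occHat π D t.castSucc s * ∑ a, π.prob t s a * m s a) :=
  (M.historyFun_good μ t).mul (HistoryFun.sum fun s _ =>
    (historyFun_occHat π t s).mul (HistoryFun.const _))

include hY hB hd hn in
lemma integral_good_mul_step :
    ∫ D, M.good μ t.succ D * ∑ s, occHat π D t.castSucc s * ∑ a, π.prob t s a * avg D t Y s a
        ∂(M.sampleLaw μ n) =
      ∫ D, M.good μ t.succ D *
        ∑ s, occHat π D t.castSucc s * ∑ a, π.prob t s a * M.stepMean t Y s a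
        ∂(M.sampleLaw μ n) := by
  simp only [good_mul_step π hd hn]
  exact M.integral_add_sum_noise μ hY hB (historyFun_good_mul_mean π t _)
    (M.historyFun_stepWeight π μ t)

include hY hB hd hn in
/-- The increase of the second moment in one step of the estimator. -/
lemma integral_sq_good_mul_step {W : (Fin n → Traj S A H) → ℝ}
    (hW : HistoryFun (SameData t) W) :
    ∫ D, (M.good μ t.succ D * (W D +
        ∑ s, occHat π D t.castSucc s * ∑ a, π.prob t s a * avg D t Y s a)) ^ 2
        ∂(M.sampleLaw μ n) =
      ∫ D, (M.good μ t.succ D * (W D +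
        ∑ s, occHat π D t.castSucc s * ∑ a, π.prob t s a * M.stepMean t Y s a)) ^ 2
        ∂(M.sampleLaw μ n) +
      ∑ s, ∑ a, π.prob t s a ^ 2 * M.stepVariance t Y s a *
        ∫ D, M.good μ t.succ D * occHat π D t.castSucc s ^ 2 * (count D t s a : ℝ)⁻¹
          ∂(M.sampleLaw μ n) := by
  simp only [mul_add, good_mul_step π hd hn, ← add_assoc]
  rw [M.integral_sq_add_sum_noise μ hY hB
    (((M.historyFun_good μ t).mul hW).add (historyFun_good_mul_mean π t _))
    (M.historyFun_stepWeight π μ t)]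
  congr 1
  simp only [sum_stepWeight_sq]
  have hi : ∀ s a, Integrable (fun D : Fin n → Traj S A H => π.prob t s a ^ 2 *
      M.stepVariance t Y s a * (M.good μ t.succ D * occHat π D t.castSucc s ^ 2 *
        (count D t s a : ℝ)⁻¹)) (M.sampleLaw μ n) := fun s a =>
    ((HistoryFun.const _).mul (((M.historyFun_good μ t).mul (historyFun_occHat π t s).sq).mul
      (historyFun_inv_count t s a))).toEq.integrable _
  rw [integral_finsetSum _ fun s _ => integrable_finsetSum _ fun a _ => hi s a]
  refine Finset.sum_congr rfl fun s _ => ?_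
  rw [integral_finsetSum _ fun a _ => hi s a]
  simp only [integral_const_mul]

end

end TabularMDP

/-! ### Moments of a sample mean -/

section SampleMean

variable {Ω : Type*} [MeasurableSpace Ω] {n : ℕ} (ν : Measure Ω) [IsProbabilityMeasure ν]
  {X : Ω → ℝ} (hX : HistoryFun Eq X)

include hX

lemma integral_sample_eval (i : Fin n) :
    ∫ D, X (D i) ∂(Measure.pi fun _ : Fin n => ν) = ∫ ω, X ω ∂ν := by
  have h := measurePreserving_eval (fun _ : Fin n => ν) i
  have h2 := integral_map (μ := Measure.pi fun _ : Fin n => ν) (f := X)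
    h.measurable.aemeasurable hX.meas.aestronglyMeasurable
  rw [h.map_eq] at h2
  exact h2.symm

lemma integral_sample_mean (hn : 0 < n) :
    ∫ D, (∑ i, X (D i)) / n ∂(Measure.pi fun _ : Fin n => ν) = ∫ ω, X ω ∂ν := by
  have hXi : ∀ i : Fin n, HistoryFun Eq (fun D : Fin n → Ω => X (D i)) := fun i =>
    hX.comp (measurable_pi_apply i) (by rintro x y rfl; rfl)
  rw [integral_div, integral_finsetSum _ fun i _ => (hXi i).integrable _]
  simp only [integral_sample_eval ν hX]
  have : (n : ℝ) ≠ 0 := by positivity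
  simp only [Finset.sum_const, Finset.card_univ, Fintype.card_fin, nsmul_eq_mul]
  field_simp

/-- The mean square of a sample mean, shifted by a constant. -/
lemma integral_sample_mean_sub_sq (hn : 0 < n) (c : ℝ) :
    ∫ D, ((∑ i, X (D i)) / n - c) ^ 2 ∂(Measure.pi fun _ : Fin n => ν) =
      (∫ ω, X ω ∂ν - c) ^ 2 + Var[X; ν] / n := by
  have hn' : (n : ℝ) ≠ 0 := by positivity
  have hXi : ∀ i : Fin n, HistoryFun Eq (fun D : Fin n → Ω => X (D i)) := fun i =>
    hX.comp (measurable_pi_apply i) (by rintro x y rfl; rfl)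
  have hS : HistoryFun Eq (fun D : Fin n → Ω => (∑ i, X (D i)) / n) := by
    simpa only [div_eq_mul_inv] using
      (HistoryFun.sum fun i _ => hXi i).mul (HistoryFun.const ((n : ℝ)⁻¹))
  have hSc := hS.sub (HistoryFun.const c)
  have hvar : Var[fun D : Fin n → Ω => (∑ i, X (D i)) / n; Measure.pi fun _ : Fin n => ν] =
      Var[X; ν] / n := by
    have h := variance_sum_pi (ι := Fin n) (μ := fun _ => ν) (X := fun _ => X)
      fun _ => hX.memLp ν
    have e : (fun D : Fin n → Ω => (∑ i, X (D i)) / n) =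
        fun D => (n : ℝ)⁻¹ * (∑ i : Fin n, fun D : Fin n → Ω => X (D i)) D := by
      funext D
      simp [div_eq_inv_mul]
    rw [e, variance_const_mul, h]
    simp only [Finset.sum_const, Finset.card_univ, Fintype.card_fin, nsmul_eq_mul]
    field_simp
  have h1 := variance_eq_sub (hSc.memLp (Measure.pi fun _ : Fin n => ν))
  rw [variance_sub_const hS.meas.aestronglyMeasurable, hvar,
    integral_sub (hS.integrable _) (integrable_const _), integral_sample_mean ν hX hn] at h1
  simp only [integral_const, probReal_univ, one_smul] at h1
  have h2 : ∫ D, ((fun D : Fin n → Ω => (∑ i, X (D i)) / n - c) ^ 2) D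
      ∂(Measure.pi fun _ : Fin n => ν) = ∫ D, ((∑ i, X (D i)) / n - c) ^ 2
      ∂(Measure.pi fun _ : Fin n => ν) := rfl
  rw [← h2]
  linarith

end SampleMean

lemma sq_sum_mul_le {ι : Type*} [Fintype ι] {w x : ι → ℝ} (hw : ∀ i, 0 ≤ w i)
    (h1 : ∑ i, w i = 1) : (∑ i, w i * x i) ^ 2 ≤ ∑ i, w i * x i ^ 2 := by
  have h := (even_two.convexOn_pow (𝕜 := ℝ)).map_sum_le (t := Finset.univ) (w := w) (p := x)
    (fun i _ => hw i) h1 (fun _ _ => Set.mem_univ _)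
  simpa using h

lemma fin_sum_sub {H : ℕ} (f : Fin (H + 1) → ℝ) :
    ∑ t : Fin H, (f t.succ - f t.castSucc) = f (Fin.last H) - f 0 := by
  rw [Finset.sum_sub_distrib]
  have h1 := Fin.sum_univ_succ f
  have h2 := Fin.sum_univ_castSucc f
  linarith

namespace TabularMDP

open TMIS

variable {S A : Type*} [Fintype S] [Fintype A] [DecidableEq S] [DecidableEq A]
  [MeasurableSpace S] [MeasurableSpace A] [MeasurableSingletonClass S]
  [MeasurableSingletonClass A] {H n : ℕ} (M : TabularMDP S A H) (π μ : Policy S A H)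

/-! ### Counts of visits -/

lemma count_eq_sum_indicator (D : Fin n → Traj S A H) (t : Fin H) (s : S) (a : A) :
    (count D t s a : ℝ) = ∑ i, {ω : Traj S A H | ω.state t.castSucc = s ∧ ω.action t = a}.indicator
      (fun _ => (1 : ℝ)) (D i) := by
  simp [count, Set.indicator_apply]

lemma integral_count (t : Fin H) (s : S) (a : A) :
    ∫ D : Fin n → Traj S A H, (count D t s a : ℝ) ∂(M.sampleLaw μ n) =
      n * M.stateActionOcc μ t s a := by
  have hX : HistoryFun Eq ({ω : Traj S A H | ω.state t.castSucc = s ∧ ω.action t = a}.indicator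
      (fun _ => (1 : ℝ))) := by
    refine ⟨measurable_const.indicator (measurableSet_stateAction t s a), ⟨1, fun ω => ?_⟩,
      by rintro x y rfl; rfl⟩
    by_cases h : ω ∈ {ω : Traj S A H | ω.state t.castSucc = s ∧ ω.action t = a} <;> simp [h]
  simp only [count_eq_sum_indicator]
  rw [integral_finsetSum _ fun i _ => (HistoryFun.comp (r' := Eq) hX (measurable_pi_apply i)
    (by rintro x y rfl; rfl)).integrable _]
  simp only [integral_sample_eval (M.law μ) hX]
  rw [integral_indicator_const _ (measurableSet_stateAction t s a)]
  simp [stateActionOcc]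

lemma count_chernoff (t : Fin H) (s : S) (a : A) {δ : ℝ} (hδ : 0 ≤ δ) :
    (M.sampleLaw μ n).real {D | (count D t s a : ℝ) ≤ (1 - δ) * (n * M.stateActionOcc μ t s a)} ≤
      Real.exp (-(δ ^ 2 / 2 * (n * M.stateActionOcc μ t s a))) := by
  simp only [count_eq_sum_indicator]
  exact chernoff_lower (M.law μ) (measurableSet_stateAction t s a) hδ

lemma measurableSet_count_le (t : Fin H) (s : S) (a : A) (c : ℝ) :
    MeasurableSet {D : Fin n → Traj S A H | (count D t s a : ℝ) ≤ c} :=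
  measurableSet_le (historyFun_count t s a).meas measurable_const

/-- The probability that some state-action pair is not visited often enough. -/
noncomputable def failProb (n : ℕ) : ℝ :=
  1 - ∫ D, M.good μ (Fin.last H) D ∂(M.sampleLaw μ n)

lemma integral_one_sub_good :
    ∫ D, (1 - M.good μ (Fin.last H) D) ∂(M.sampleLaw μ n) = M.failProb μ n := by
  rw [integral_sub (integrable_const _) ((M.historyFun_good_eq μ _).integrable _)]
  simp [failProb]

lemma failProb_nonneg : 0 ≤ M.failProb μ n := by
  rw [← integral_one_sub_good]
  exact integral_nonneg fun D => sub_nonneg.2 (M.good_le_one μ _ D)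

/-- Union bound over the state-action pairs, with the Chernoff bound at `δ = 2 / 3`. -/
lemma failProb_le {L : ℝ} (hL : ∀ t s a, L ≤ n * M.stateActionOcc μ t s a) :
    M.failProb μ n ≤ H * (Fintype.card S * (Fintype.card A * Real.exp (-(2 / 9 * L)))) := by
  set B : Fin H → S → A → Set (Fin n → Traj S A H) := fun t s a =>
    {D | (count D t s a : ℝ) ≤ (1 - 2 / 3) * (n * M.stateActionOcc μ t s a)} with hBdef
  have hBm : ∀ t s a, MeasurableSet (B t s a) := fun t s a => measurableSet_count_le t s a _
  have hBP : ∀ t s a, (M.sampleLaw μ n).real (B t s a) ≤ Real.exp (-(2 / 9 * L)) := by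
    intro t s a
    refine (M.count_chernoff μ t s a (by norm_num)).trans (Real.exp_le_exp.2 ?_)
    linarith [hL t s a]
  have hi : ∀ t s a, Integrable ((B t s a).indicator fun _ => (1 : ℝ)) (M.sampleLaw μ n) :=
    fun t s a => (integrable_const _).indicator (hBm t s a)
  have hpt : ∀ D : Fin n → Traj S A H, 1 - M.good μ (Fin.last H) D ≤
      ∑ t, ∑ s, ∑ a, (B t s a).indicator (fun _ => (1 : ℝ)) D := by
    intro D
    have hnn : ∀ t s a, 0 ≤ (B t s a).indicator (fun _ => (1 : ℝ)) D := fun t s a =>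
      Set.indicator_nonneg (fun _ _ => zero_le_one) _
    by_cases hE : M.EnoughVisits μ (Fin.last H) D
    · have : M.good μ (Fin.last H) D = 1 := by simp [good, hE]
      rw [this, sub_self]
      exact Finset.sum_nonneg fun t _ => Finset.sum_nonneg fun s _ =>
        Finset.sum_nonneg fun a _ => hnn t s a
    · have : M.good μ (Fin.last H) D = 0 := by simp [good, hE]
      rw [this, sub_zero]
      simp only [EnoughVisits, not_forall, not_le] at hE
      obtain ⟨t, -, s, a, h⟩ := hE
      have hD : D ∈ B t s a := by
        change (count D t s a : ℝ) ≤ _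
        linarith
      calc (1 : ℝ) = (B t s a).indicator (fun _ => (1 : ℝ)) D := by simp [hD]
        _ ≤ ∑ a, (B t s a).indicator (fun _ => (1 : ℝ)) D :=
          Finset.single_le_sum (f := fun a => (B t s a).indicator (fun _ => (1 : ℝ)) D)
            (fun a _ => hnn t s a) (Finset.mem_univ a)
        _ ≤ ∑ s, ∑ a, (B t s a).indicator (fun _ => (1 : ℝ)) D :=
          Finset.single_le_sum (f := fun s => ∑ a, (B t s a).indicator (fun _ => (1 : ℝ)) D)
            (fun s _ => Finset.sum_nonneg fun a _ => hnn t s a) (Finset.mem_univ s)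
        _ ≤ _ :=
          Finset.single_le_sum
            (f := fun t => ∑ s, ∑ a, (B t s a).indicator (fun _ => (1 : ℝ)) D)
            (fun t _ => Finset.sum_nonneg fun s _ => Finset.sum_nonneg fun a _ => hnn t s a)
            (Finset.mem_univ t)
  rw [← integral_one_sub_good]
  calc _ ≤ ∫ D, ∑ t, ∑ s, ∑ a, (B t s a).indicator (fun _ => (1 : ℝ)) D ∂(M.sampleLaw μ n) :=
        integral_mono ((integrable_const _).sub ((M.historyFun_good_eq μ _).integrable _))
          (integrable_finsetSum _ fun t _ => integrable_finsetSum _ fun s _ =>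
            integrable_finsetSum _ fun a _ => hi t s a) hpt
    _ = ∑ t, ∑ s, ∑ a, (M.sampleLaw μ n).real (B t s a) := by
        rw [integral_finsetSum _ fun t _ => integrable_finsetSum _ fun s _ =>
            integrable_finsetSum _ fun a _ => hi t s a]
        refine Finset.sum_congr rfl fun t _ => ?_
        rw [integral_finsetSum _ fun s _ => integrable_finsetSum _ fun a _ => hi t s a]
        refine Finset.sum_congr rfl fun s _ => ?_
        rw [integral_finsetSum _ fun a _ => hi t s a]
        refine Finset.sum_congr rfl fun a _ => ?_
        rw [integral_indicator_const _ (hBm t s a), smul_eq_mul, mul_one]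
    _ ≤ ∑ _t : Fin H, ∑ _s : S, ∑ _a : A, Real.exp (-(2 / 9 * L)) :=
        Finset.sum_le_sum fun t _ => Finset.sum_le_sum fun s _ => Finset.sum_le_sum fun a _ =>
          hBP t s a
    _ = _ := by simp

/-! ### First and second moments of the estimated occupancies -/

variable {M μ}

lemma historyFun_sum_occHat (k : Fin (H + 1)) (φ : S → ℝ) :
    HistoryFun Eq (fun D : Fin n → Traj S A H => M.good μ k D * ∑ s, occHat π D k s * φ s) :=
  (M.historyFun_good_eq μ k).mul (HistoryFun.sum fun s _ =>
    (historyFun_occHat_eq π k s).mul (HistoryFun.const _))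

lemma abs_le_sum_abs (φ : S → ℝ) (s : S) : |φ s| ≤ ∑ s, |φ s| :=
  Finset.single_le_sum (f := fun s => |φ s|) (fun _ _ => abs_nonneg _) (Finset.mem_univ s)

/-- On the event of sufficient visits, the inverse count is at most three times the inverse of its
expected value. -/
lemma integral_occHat_sq_div_count_le {t : Fin H} {s : S} {a : A}
    (hd : 0 < M.stateActionOcc μ t s a) (hn : 0 < n) :
    ∫ D, M.good μ t.succ D * occHat π D t.castSucc s ^ 2 * (count D t s a : ℝ)⁻¹
        ∂(M.sampleLaw μ n) ≤
      3 / (n * M.stateActionOcc μ t s a) *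
        ∫ D, (M.good μ t.castSucc D * occHat π D t.castSucc s) ^ 2 ∂(M.sampleLaw μ n) := by
  rw [← integral_const_mul]
  refine integral_mono ((((M.historyFun_good μ t).mul (historyFun_occHat π t s).sq).mul
      (historyFun_inv_count t s a)).toEq.integrable _)
    (((HistoryFun.const _).mul ((M.historyFun_good_eq μ _).mul
      (historyFun_occHat_eq π _ s)).sq).integrable _) fun D => ?_
  have hnd : 0 < (n : ℝ) * M.stateActionOcc μ t s a := mul_pos (Nat.cast_pos.2 hn) hd
  by_cases hg : M.good μ t.succ D = 0
  · simp only [hg, zero_mul]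
    positivity
  · have h1 := M.le_count_of_good μ hg s a
    have h2 : (count D t s a : ℝ)⁻¹ ≤ 3 / (n * M.stateActionOcc μ t s a) := by
      rw [inv_le_comm₀ (by linarith) (by positivity), inv_div]
      linarith
    have h3 := M.good_anti μ (Fin.castSucc_le_succ t) D
    simp only [mul_pow, good_sq]
    rw [mul_comm]
    gcongr
    exact mul_nonneg (M.good_nonneg μ _ D) (sq_nonneg _)

/-- The constant `12 τ_a τ_s / n` is a fixed point of the induction in `integral_sq_sum_occHat_le`:
when `4 τ_a ≤ n d^μ(s)`, one step reproduces `3 τ_a τ_s (1 + 12 / 4) = 12 τ_a τ_s`. -/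
lemma second_moment_coeff_le {N p m d e τa τs : ℝ} (hN : 0 < N) (he : 0 < e) (hm : 0 < m)
    (hp : 0 ≤ p) (hd : 0 ≤ d) (hτs : 0 ≤ τs) (h1 : p ≤ τa * m) (h2 : d ≤ τs * e)
    (h3 : 4 * τa ≤ N * e) :
    p ^ 2 * (3 / (N * (e * m)) * (d ^ 2 + 12 * τa * τs / N * d)) ≤
      12 * τa * τs / N * (d * p) := by
  have hx : p / m ≤ τa := by rwa [div_le_iff₀ hm]
  have hx0 : 0 ≤ p / m := by positivity
  have hy : d / e ≤ τs := by rwa [div_le_iff₀ he]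
  have hz : τa / (N * e) ≤ 1 / 4 := by
    rw [div_le_div_iff₀ (by positivity) (by norm_num)]
    linarith
  have e1 : p ^ 2 * (3 / (N * (e * m)) * (d ^ 2 + 12 * τa * τs / N * d)) =
      p * d / N * (3 * (p / m) * (d / e + 12 * τs * (τa / (N * e)))) := by
    field_simp
  have e2 : 12 * τa * τs / N * (d * p) = p * d / N * (3 * τa * (τs + 12 * τs * (1 / 4))) := by
    field_simp
    ring
  rw [e1, e2]
  have hτa : 0 ≤ τa := hx0.trans hx
  gcongr

section Moments

variable {τa τs : ℝ}
  (hμ : ∀ (t : Fin H) s a, 0 < μ.prob t s a) (hs : ∀ (t : Fin H) s, 0 < M.stateOcc μ t.castSucc s)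
  (hn : 0 < n)
  (hτa : ∀ t s a, π.prob t s a ≤ τa * μ.prob t s a)
  (hτs : ∀ (t : Fin H) s, M.stateOcc π t.castSucc s ≤ τs * M.stateOcc μ t.castSucc s)
  (hτa1 : 1 ≤ τa) (hτs1 : 1 ≤ τs) (h4 : ∀ (t : Fin H) s, 4 * τa ≤ n * M.stateOcc μ t.castSucc s)

include hμ hs hn hτa hτs hτa1 hτs1 h4

/-- The second moment of the estimated occupancies on the event of sufficient visits. The excess
over the squared mean is carried through the induction as a multiple of the mean of `φ ^ 2`,
which is what the law of total variance preserves. -/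
theorem integral_sq_sum_occHat_le (k : Fin (H + 1)) (φ : S → ℝ) :
    ∫ D, (M.good μ k D * ∑ s, occHat π D k s * φ s) ^ 2 ∂(M.sampleLaw μ n) ≤
      (∑ s, M.stateOcc π k s * φ s) ^ 2 +
        12 * τa * τs / n * ∑ s, M.stateOcc π k s * φ s ^ 2 := by
  have hn' : (0 : ℝ) < n := Nat.cast_pos.2 hn
  have hκ : 0 ≤ 12 * τa * τs / n := by positivity
  induction k using Fin.induction generalizing φ with
  | zero =>
    have hX : HistoryFun Eq (fun ω : Traj S A H => φ (ω.state 0)) :=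
      HistoryFun.of_finite (Traj.measurable_state 0) (by rintro x y rfl; rfl) φ
    have h := integral_sample_mean_sub_sq (M.law μ) hX hn 0
    simp only [sub_zero] at h
    simp only [good_zero, one_mul, sum_occHat_zero]
    rw [h, variance_eq_sub (hX.memLp _)]
    have e1 : ∫ ω, ((fun ω : Traj S A H => φ (ω.state 0)) ^ 2) ω ∂(M.law μ) =
        ∑ s, M.init s * φ s ^ 2 := integral_state_zero M μ fun s => φ s ^ 2
    rw [e1, integral_state_zero M μ φ]
    simp only [stateOcc_zero]
    have h2 : 0 ≤ ∑ s, M.init s * φ s ^ 2 :=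
      Finset.sum_nonneg fun s _ => mul_nonneg (M.init_nonneg s) (sq_nonneg _)
    refine add_le_add le_rfl ?_
    rw [div_mul_eq_mul_div]
    gcongr
    have h1 : 1 * 1 ≤ τa * τs := mul_le_mul hτa1 hτs1 zero_le_one (by linarith)
    nlinarith [sq_nonneg (∑ s, M.init s * φ s)]
  | succ t ih =>
    have hd : ∀ s a, 0 < M.stateActionOcc μ t s a := fun s a => by
      rw [stateActionOcc_eq]; exact mul_pos (hs t s) (hμ t s a)
    set Y : S → ℝ → ℝ := fun s' _ => φ s' with hYdef
    have hY : ∀ s, Measurable (Y s) := fun _ => measurable_const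
    have hB : ∀ s r, |Y s r| ≤ ∑ s, |φ s| := fun s _ => abs_le_sum_abs φ s
    set T : S → ℝ := fun s => ∑ a, π.prob t s a * M.stepMean t Y s a with hT
    have h1 := integral_sq_good_mul_step π hY hB hd hn (HistoryFun.const (r := SameData t) 0)
    simp only [zero_add] at h1
    simp only [sum_occHat_succ]
    rw [h1]
    have h2 : ∫ D, (M.good μ t.succ D * ∑ s, occHat π D t.castSucc s * T s) ^ 2
        ∂(M.sampleLaw μ n) ≤ (∑ s, M.stateOcc π t.castSucc s * T s) ^ 2 +
          12 * τa * τs / n * ∑ s, M.stateOcc π t.castSucc s * T s ^ 2 := by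
      refine le_trans (integral_mono ?_ ?_ fun D => ?_) (ih T)
      · exact (((M.historyFun_good_eq μ _).mul (HistoryFun.sum fun s _ =>
          (historyFun_occHat_eq π _ s).mul (HistoryFun.const _))).sq).integrable _
      · exact (historyFun_sum_occHat π _ T).sq.integrable _
      · simp only [mul_pow, good_sq]
        exact mul_le_mul_of_nonneg_right (M.good_anti μ (Fin.castSucc_le_succ t) D) (sq_nonneg _)
    have h3 : ∀ s a, π.prob t s a ^ 2 * M.stepVariance t Y s a *
        ∫ D, M.good μ t.succ D * occHat π D t.castSucc s ^ 2 * (count D t s a : ℝ)⁻¹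
          ∂(M.sampleLaw μ n) ≤
        12 * τa * τs / n * (M.stateOcc π t.castSucc s * (π.prob t s a * M.stepVariance t Y s a)) := by
      intro s a
      have h5 := integral_occHat_sq_div_count_le π (hd s a) hn
      have h6 := ih (Pi.single s 1)
      simp only [Pi.single_apply, mul_ite, mul_one, mul_zero, Finset.sum_ite_eq', Finset.mem_univ,
        if_true, ite_pow, one_pow, ne_eq, OfNat.ofNat_ne_zero, not_false_eq_true, zero_pow] at h6
      have h7 := second_moment_coeff_le hn' (hs t s) (hμ t s a) (π.prob_nonneg t s a)
        (M.stateOcc_nonneg π t.castSucc s) (by linarith) (hτa t s a) (hτs t s) (h4 t s)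
      rw [← stateActionOcc_eq] at h7
      have hv := M.stepVariance_nonneg t Y s a
      have h8 : 0 ≤ 3 / (n * M.stateActionOcc μ t s a) := by
        have := hd s a
        positivity
      calc _ ≤ π.prob t s a ^ 2 * M.stepVariance t Y s a * (3 / (n * M.stateActionOcc μ t s a) *
            (M.stateOcc π t.castSucc s ^ 2 + 12 * τa * τs / n * M.stateOcc π t.castSucc s)) :=
            mul_le_mul_of_nonneg_left (h5.trans (mul_le_mul_of_nonneg_left h6 h8)) (by positivity)
        _ = M.stepVariance t Y s a * (π.prob t s a ^ 2 * (3 / (n * M.stateActionOcc μ t s a) *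
            (M.stateOcc π t.castSucc s ^ 2 + 12 * τa * τs / n * M.stateOcc π t.castSucc s))) := by
            ring
        _ ≤ M.stepVariance t Y s a * _ := mul_le_mul_of_nonneg_left h7 hv
        _ = _ := by ring
    have h9 : ∀ s, T s ^ 2 + ∑ a, π.prob t s a * M.stepVariance t Y s a ≤
        ∑ a, π.prob t s a * M.stepMean t (fun s' _ => φ s' ^ 2) s a := by
      intro s
      have hj := sq_sum_mul_le (x := fun a => M.stepMean t Y s a) (π.prob_nonneg t s)
        (π.sum_prob t s)
      have : ∀ a, π.prob t s a * M.stepMean t (fun s' _ => φ s' ^ 2) s a =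
          π.prob t s a * M.stepMean t Y s a ^ 2 + π.prob t s a * M.stepVariance t Y s a := by
        intro a
        rw [M.stepVariance_eq t hY hB]
        ring
      simp only [this, Finset.sum_add_distrib]
      exact add_le_add hj le_rfl
    rw [sum_stateOcc_succ, sum_stateOcc_succ]
    calc _ ≤ ((∑ s, M.stateOcc π t.castSucc s * T s) ^ 2 +
          12 * τa * τs / n * ∑ s, M.stateOcc π t.castSucc s * T s ^ 2) +
          ∑ s, ∑ a, 12 * τa * τs / n *
            (M.stateOcc π t.castSucc s * (π.prob t s a * M.stepVariance t Y s a)) :=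
          add_le_add h2 (Finset.sum_le_sum fun s _ => Finset.sum_le_sum fun a _ => h3 s a)
      _ = (∑ s, M.stateOcc π t.castSucc s * T s) ^ 2 + 12 * τa * τs / n *
          ∑ s, M.stateOcc π t.castSucc s *
            (T s ^ 2 + ∑ a, π.prob t s a * M.stepVariance t Y s a) := by
          simp only [← Finset.mul_sum, mul_add, Finset.sum_add_distrib]
          ring
      _ ≤ _ := by
          refine add_le_add le_rfl (mul_le_mul_of_nonneg_left ?_ hκ)
          exact Finset.sum_le_sum fun s _ =>
            mul_le_mul_of_nonneg_left (h9 s) (M.stateOcc_nonneg π _ s)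

lemma integral_sq_occHat_le (k : Fin (H + 1)) (s : S) :
    ∫ D, (M.good μ k D * occHat π D k s) ^ 2 ∂(M.sampleLaw μ n) ≤
      M.stateOcc π k s ^ 2 + 12 * τa * τs / n * M.stateOcc π k s := by
  have h6 := integral_sq_sum_occHat_le π hμ hs hn hτa hτs hτa1 hτs1 h4 k (Pi.single s 1)
  simpa [Pi.single_apply] using h6

end Moments

/-- Truncation to the event of sufficient visits biases the estimated occupancies by no more than
its failure probability at every step. -/
theorem le_integral_sum_occHat (hd : ∀ t s a, 0 < M.stateActionOcc μ t s a) (hn : 0 < n)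
    (k : Fin (H + 1)) {φ : S → ℝ} (hφ : ∀ s, φ s ∈ Set.Icc 0 1) :
    ∑ s, M.stateOcc π k s * φ s - k * M.failProb μ n ≤
      ∫ D, M.good μ k D * ∑ s, occHat π D k s * φ s ∂(M.sampleLaw μ n) := by
  induction k using Fin.induction generalizing φ with
  | zero =>
    have hX : HistoryFun Eq (fun ω : Traj S A H => φ (ω.state 0)) :=
      HistoryFun.of_finite (Traj.measurable_state 0) (by rintro x y rfl; rfl) φ
    simp only [good_zero, one_mul, sum_occHat_zero]
    rw [integral_sample_mean (M.law μ) hX hn, integral_state_zero M μ φ]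
    simp [stateOcc_zero]
  | succ t ih =>
    set Y : S → ℝ → ℝ := fun s' _ => φ s' with hYdef
    have hY : ∀ s, Measurable (Y s) := fun _ => measurable_const
    have hB : ∀ s r, |Y s r| ≤ ∑ s, |φ s| := fun s _ => abs_le_sum_abs φ s
    set T : S → ℝ := fun s => ∑ a, π.prob t s a * M.stepMean t Y s a with hT
    have hTm : ∀ s, T s ∈ Set.Icc 0 1 := by
      intro s
      have hm := fun a => M.stepMean_mem_Icc t hY (fun s' _ => hφ s') s a
      refine ⟨Finset.sum_nonneg fun a _ => mul_nonneg (π.prob_nonneg t s a) (hm a).1, ?_⟩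
      calc _ ≤ ∑ a, π.prob t s a :=
            Finset.sum_le_sum fun a _ => mul_le_of_le_one_right (π.prob_nonneg t s a) (hm a).2
        _ = 1 := π.sum_prob t s
    have h1 := integral_good_mul_step π hY hB (hd t) hn
    simp only [sum_occHat_succ]
    rw [h1, sum_stateOcc_succ]
    have h2 := ih hTm
    have i1 := (historyFun_sum_occHat (n := n) (M := M) (μ := μ) π t.castSucc T).integrable
      (M.sampleLaw μ n)
    have i2 : HistoryFun Eq (fun D : Fin n → Traj S A H =>
        M.good μ t.succ D * ∑ s, occHat π D t.castSucc s * T s) :=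
      (M.historyFun_good_eq μ _).mul (HistoryFun.sum fun s _ =>
          (historyFun_occHat_eq π _ s).mul (HistoryFun.const _))
    have i3 : Integrable (fun D : Fin n → Traj S A H => 1 - M.good μ (Fin.last H) D)
        (M.sampleLaw μ n) :=
      (integrable_const _).sub ((M.historyFun_good_eq μ _).integrable _)
    have h3 : ∫ D, M.good μ t.castSucc D * ∑ s, occHat π D t.castSucc s * T s ∂(M.sampleLaw μ n) -
        M.failProb μ n ≤
        ∫ D, M.good μ t.succ D * ∑ s, occHat π D t.castSucc s * T s ∂(M.sampleLaw μ n) := by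
      rw [← integral_one_sub_good, ← integral_sub i1 i3]
      refine integral_mono (i1.sub i3) (i2.integrable _) fun D => ?_
      have hX := sum_occHat_mul_mem_Icc π D t.castSucc hTm zero_le_one
      have g1 := M.good_anti μ (Fin.castSucc_le_succ t) D
      have g2 := M.good_anti μ (Fin.le_last t.succ) D
      have g3 := M.good_le_one μ t.castSucc D
      nlinarith [hX.1, hX.2]
    have e : ((t.succ : Fin (H + 1)) : ℝ) = ((t.castSucc : Fin (H + 1)) : ℝ) + 1 := by simp
    rw [e, add_mul, one_mul]
    change ∑ s, M.stateOcc π t.castSucc s * T s - _ ≤ _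
    linarith

end TabularMDP

/-! ### The error of the estimator -/

namespace TMIS

variable {S A : Type*} [Fintype S] [Fintype A] [DecidableEq S] [DecidableEq A] {H n : ℕ}

/-- The part of the estimator that stems from the steps before time `k`, for rewards truncated to
`[0, R]`. -/
noncomputable def partialReturn (π : Policy S A H) (R : ℝ) (k : Fin (H + 1))
    (D : Fin n → Traj S A H) : ℝ :=
  ∑ t : Fin H with t.castSucc < k, ∑ s, occHat π D t.castSucc s *
    ∑ a, π.prob t s a * avg D t (fun _ r => clip R r) s a

variable (π : Policy S A H)

lemma partialReturn_zero (R : ℝ) (D : Fin n → Traj S A H) : partialReturn π R 0 D = 0 := by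
  simp [partialReturn]

lemma partialReturn_succ (R : ℝ) (t : Fin H) (D : Fin n → Traj S A H) :
    partialReturn π R t.succ D = partialReturn π R t.castSucc D +
      ∑ s, occHat π D t.castSucc s *
        ∑ a, π.prob t s a * avg D t (fun _ r => clip R r) s a := by
  have h : (Finset.univ.filter fun j : Fin H => j.castSucc < t.succ) =
      insert t (Finset.univ.filter fun j : Fin H => j.castSucc < t.castSucc) := by
    ext j
    simp only [Finset.mem_filter, Finset.mem_univ, true_and, Finset.mem_insert,
      Fin.castSucc_lt_castSucc_iff, Fin.castSucc_lt_succ_iff]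
    exact le_iff_eq_or_lt
  rw [partialReturn, h, Finset.sum_insert (by simp), add_comm]
  rfl

lemma partialReturn_mem_Icc {R : ℝ} (hR : 0 ≤ R) (k : Fin (H + 1)) (D : Fin n → Traj S A H) :
    partialReturn π R k D ∈ Set.Icc 0 (H * R) := by
  have h : ∀ t : Fin H, ∑ s, occHat π D t.castSucc s *
      ∑ a, π.prob t s a * avg D t (fun _ r => clip R r) s a ∈ Set.Icc 0 R := by
    intro t
    refine sum_occHat_mul_mem_Icc π D _ (fun s => ?_) hR
    have hm := fun a => avg_mem_Icc D t (fun _ r => clip_mem_Icc hR r) hR s a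
    refine ⟨Finset.sum_nonneg fun a _ => mul_nonneg ((π.prob_mem t s).1 a) (hm a).1, ?_⟩
    calc _ ≤ ∑ a, π.prob t s a * R :=
          Finset.sum_le_sum fun a _ => mul_le_mul_of_nonneg_left (hm a).2 ((π.prob_mem t s).1 a)
      _ = R := by rw [← Finset.sum_mul, (π.prob_mem t s).2, one_mul]
  refine ⟨Finset.sum_nonneg fun t _ => (h t).1, ?_⟩
  calc _ ≤ ∑ t : Fin H with t.castSucc < k, R := Finset.sum_le_sum fun t _ => (h t).2
    _ ≤ ∑ _t : Fin H, R :=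
        Finset.sum_le_sum_of_subset_of_nonneg (Finset.filter_subset _ _) fun _ _ _ => hR
    _ = H * R := by simp

lemma partialReturn_last {R : ℝ} {D : Fin n → Traj S A H}
    (hD : ∀ i t, (D i).rew t ∈ Set.Icc 0 R) :
    partialReturn π R (Fin.last H) D = estimator π D := by
  unfold partialReturn estimator
  simp only [Fin.castSucc_lt_last, Finset.filter_true]
  refine Finset.sum_congr rfl fun t _ => Finset.sum_congr rfl fun s _ => ?_
  congr 1
  refine Finset.sum_congr rfl fun a _ => ?_
  simp only [avg, rewHat, clip_of_mem (hD _ t)]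
  ring

end TMIS

namespace TabularMDP

open TMIS

variable {S A : Type*} [Fintype S] [Fintype A] [DecidableEq S] [DecidableEq A]
  [MeasurableSpace S] [MeasurableSpace A] [MeasurableSingletonClass S]
  [MeasurableSingletonClass A] {H n : ℕ} (M : TabularMDP S A H) (π μ : Policy S A H)

lemma SameData.mono {t j : Fin H} (hj : j ≤ t) {D D' : Fin n → Traj S A H}
    (h : SameData t D D') : SameData j D D' := fun i =>
  ⟨⟨fun l hl => (h i).1.1 l (hl.trans (Fin.castSucc_le_castSucc_iff.2 hj)),
    fun l hl => (h i).1.2 l (hl.trans_le (Fin.castSucc_le_castSucc_iff.2 hj))⟩,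
    (h.state_action hj i).2⟩

lemma historyFun_partialReturn {R : ℝ} (hR : 0 ≤ R) (t : Fin H) :
    HistoryFun (SameData t)
      (fun D : Fin n → Traj S A H => partialReturn π R t.castSucc D) := by
  refine HistoryFun.sum fun j hj => HistoryFun.sum fun s _ => ?_
  have hjt : j < t := by simpa using hj
  have hmono : ∀ D D' : Fin n → Traj S A H, SameData t D D' → SameData j D D' :=
    fun D D' h => h.mono hjt.le
  refine ((historyFun_occHat π j s).mono hmono).mul (HistoryFun.sum fun a _ =>
    (HistoryFun.const _).mul ?_)
  have hc : ∀ i : Fin n, HistoryFun (SameData t)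
      (fun D : Fin n → Traj S A H => clip R ((D i).rew j)) := fun i => by
    have h := historyFun_apply (r := Eq) (j := i) (HistoryFun.clip_rew (S := S) (A := A) hR j)
      (by rintro x y rfl; rfl)
    refine ⟨h.meas, h.bdd, fun D D' hD => ?_⟩
    rw [((hD i).1.2 j (Fin.castSucc_lt_castSucc_iff.2 hjt)).2]
  have hv : ∀ i : Fin n, HistoryFun (SameData t) (fun D : Fin n → Traj S A H =>
      if (D i).state j.castSucc = s ∧ (D i).action j = a then (1 : ℝ) else 0) := fun i =>
    (historyFun_stateAction_apply j i fun x y => if x = s ∧ y = a then (1 : ℝ) else 0).mono hmono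
  have h := (HistoryFun.sum (s := Finset.univ) fun i _ => (hv i).mul (hc i)).mul
    ((historyFun_inv_count j s a).mono hmono)
  simpa only [avg, Finset.sum_filter, div_eq_mul_inv, ite_mul, one_mul, zero_mul] using h

/-- The error of the estimator when the estimated occupancy at time `k` is completed by the true
values of the states. At `k = 0` it is the error of a sample mean, at the last time that of the
estimator. -/
noncomputable def estError (R : ℝ) (k : Fin (H + 1)) (D : Fin n → Traj S A H) : ℝ :=
  partialReturn π R k D + ∑ s, occHat π D k s * M.bellmanValue π R k s -
    ∑ s, M.init s * M.bellmanValue π R 0 s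

lemma estError_succ (R : ℝ) (t : Fin H) (D : Fin n → Traj S A H) :
    M.estError π R t.succ D =
      (partialReturn π R t.castSucc D - ∑ s, M.init s * M.bellmanValue π R 0 s) +
        ∑ s, occHat π D t.castSucc s * ∑ a, π.prob t s a * avg D t (M.target π R t) s a := by
  have h : ∀ s a, avg D t (M.target π R t) s a =
      avg D t (fun s' _ => M.bellmanValue π R t.succ s') s a +
        avg D t (fun _ r => clip R r) s a := fun s a => avg_add D t _ _ s a
  simp only [h, mul_add, Finset.sum_add_distrib]
  rw [estError, partialReturn_succ, sum_occHat_succ]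
  ring

lemma estError_castSucc (R : ℝ) (t : Fin H) (D : Fin n → Traj S A H) :
    M.estError π R t.castSucc D =
      (partialReturn π R t.castSucc D - ∑ s, M.init s * M.bellmanValue π R 0 s) +
        ∑ s, occHat π D t.castSucc s *
          ∑ a, π.prob t s a * M.stepMean t (M.target π R t) s a := by
  simp only [← bellmanValue_castSucc]
  rw [estError]
  ring

lemma sum_init_mul_bellmanValue_mem {R : ℝ} (hR : 0 ≤ R) :
    ∑ s, M.init s * M.bellmanValue π R 0 s ∈ Set.Icc 0 (H * R) := by
  refine ⟨Finset.sum_nonneg fun s _ =>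
    mul_nonneg (M.init_nonneg s) (M.bellmanValue_mem_Icc π hR 0 s).1, ?_⟩
  calc _ ≤ ∑ s, M.init s * (H * R) := Finset.sum_le_sum fun s _ =>
        mul_le_mul_of_nonneg_left (M.bellmanValue_mem_Icc π hR 0 s).2 (M.init_nonneg s)
    _ = H * R := by rw [← Finset.sum_mul, sum_init, one_mul]

lemma sq_estError_le {R : ℝ} (hR : 0 ≤ R) (k : Fin (H + 1)) (D : Fin n → Traj S A H) :
    M.estError π R k D ^ 2 ≤ (2 * (H * R)) ^ 2 := by
  have h1 := partialReturn_mem_Icc π hR k D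
  have h2 := sum_occHat_mul_mem_Icc π D k (M.bellmanValue_mem_Icc π hR k) (by positivity)
  have h3 := M.sum_init_mul_bellmanValue_mem π hR
  rw [sq_le_sq, abs_of_nonneg (a := 2 * (H * R)) (by positivity), abs_le, estError]
  constructor <;> linarith [h1.1, h1.2, h2.1, h2.2, h3.1, h3.2]

lemma sq_estError_last_le {R : ℝ} (hR : 0 ≤ R) (D : Fin n → Traj S A H) :
    M.estError π R (Fin.last H) D ^ 2 ≤ (H * R) ^ 2 := by
  have h1 := partialReturn_mem_Icc π hR (Fin.last H) D
  have h3 := M.sum_init_mul_bellmanValue_mem π hR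
  rw [sq_le_sq, abs_of_nonneg (a := H * R) (by positivity), abs_le, estError]
  simp only [bellmanValue_last, mul_zero, Finset.sum_const_zero, add_zero]
  constructor <;> linarith [h1.1, h1.2, h3.1, h3.2]

lemma historyFun_estError {R : ℝ} (hR : 0 ≤ R) (k : Fin (H + 1)) :
    HistoryFun Eq (fun D : Fin n → Traj S A H => M.estError π R k D) := by
  refine HistoryFun.sub (HistoryFun.add ?_ (HistoryFun.sum fun s _ =>
    (historyFun_occHat_eq π k s).mul (HistoryFun.const _))) (HistoryFun.const _)
  refine HistoryFun.sum fun j _ => HistoryFun.sum fun s _ =>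
    (historyFun_occHat_eq π _ s).mul (HistoryFun.sum fun a _ => (HistoryFun.const _).mul ?_)
  have hv : ∀ i : Fin n, HistoryFun Eq (fun D : Fin n → Traj S A H =>
      if (D i).state j.castSucc = s ∧ (D i).action j = a then (1 : ℝ) else 0) := fun i =>
    (historyFun_stateAction_apply j i fun x y => if x = s ∧ y = a then (1 : ℝ) else 0).toEq
  have hc : ∀ i : Fin n, HistoryFun Eq
      (fun D : Fin n → Traj S A H => clip R ((D i).rew j)) := fun i =>
    historyFun_apply (HistoryFun.clip_rew (S := S) (A := A) hR j) (by rintro x y rfl; rfl)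
  have h := (HistoryFun.sum (s := Finset.univ) fun i _ => (hv i).mul (hc i)).mul
    (historyFun_inv_count j s a).toEq
  simpa only [avg, Finset.sum_filter, div_eq_mul_inv, ite_mul, one_mul, zero_mul] using h

/-- The second moment of the estimated occupancy relative to the number of visits, which weighs
the conditional variance at `(t, s, a)` in the error of the estimator. -/
noncomputable def visitMoment (n : ℕ) (t : Fin H) (s : S) (a : A) : ℝ :=
  ∫ D, M.good μ t.succ D * occHat π D t.castSucc s ^ 2 * (count D t s a : ℝ)⁻¹
    ∂(M.sampleLaw μ n)

/-- The contribution of step `t` to the mean square error. -/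
noncomputable def stepContribution (R : ℝ) (n : ℕ) (t : Fin H) : ℝ :=
  ∑ s, ∑ a, π.prob t s a ^ 2 * M.stepVariance t (M.target π R t) s a * M.visitMoment π μ n t s a

variable {M μ}

lemma integral_sq_estError_succ (hd : ∀ t s a, 0 < M.stateActionOcc μ t s a) (hn : 0 < n)
    {R : ℝ} (hR : 0 ≤ R) (t : Fin H) :
    ∫ D, (M.good μ t.succ D * M.estError π R t.succ D) ^ 2 ∂(M.sampleLaw μ n) =
      ∫ D, (M.good μ t.succ D * M.estError π R t.castSucc D) ^ 2 ∂(M.sampleLaw μ n) +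
        M.stepContribution π μ R n t := by
  simp only [estError_succ, estError_castSucc]
  exact integral_sq_good_mul_step π (M.measurable_target π R t) (M.abs_target_le π hR t) (hd t) hn
    ((historyFun_partialReturn π hR t).sub (HistoryFun.const _))

lemma integral_sq_estError_zero (hn : 0 < n) (R : ℝ) :
    ∫ D, (M.good μ 0 D * M.estError π R 0 D) ^ 2 ∂(M.sampleLaw μ n) =
      Var[fun ω => M.bellmanValue π R 0 (ω.state 0); M.law μ] / n := by
  have hX : HistoryFun Eq (fun ω : Traj S A H => M.bellmanValue π R 0 (ω.state 0)) :=
    HistoryFun.of_finite (Traj.measurable_state 0) (by rintro x y rfl; rfl) _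
  have h := integral_sample_mean_sub_sq (M.law μ) hX hn (∑ s, M.init s * M.bellmanValue π R 0 s)
  rw [integral_state_zero M μ (M.bellmanValue π R 0), sub_self] at h
  simp only [good_zero, one_mul, estError, partialReturn_zero, zero_add, sum_occHat_zero]
  rw [h]
  ring

lemma historyFun_good_mul_estError {R : ℝ} (hR : 0 ≤ R) (k l : Fin (H + 1)) :
    HistoryFun Eq (fun D : Fin n → Traj S A H => (M.good μ k D * M.estError π R l D) ^ 2) :=
  ((M.historyFun_good_eq μ k).mul (M.historyFun_estError π hR l)).sq

lemma integral_sq_estError_last_le (hd : ∀ t s a, 0 < M.stateActionOcc μ t s a) (hn : 0 < n)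
    {R : ℝ} (hR : 0 ≤ R) :
    ∫ D, (M.good μ (Fin.last H) D * M.estError π R (Fin.last H) D) ^ 2 ∂(M.sampleLaw μ n) ≤
      Var[fun ω => M.bellmanValue π R 0 (ω.state 0); M.law μ] / n +
        ∑ t, M.stepContribution π μ R n t := by
  set f : Fin (H + 1) → ℝ := fun k =>
    ∫ D, (M.good μ k D * M.estError π R k D) ^ 2 ∂(M.sampleLaw μ n) with hf
  have h : ∀ t : Fin H, f t.succ - f t.castSucc ≤ M.stepContribution π μ R n t := by
    intro t
    simp only [hf]
    rw [integral_sq_estError_succ π hd hn hR t]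
    have : ∫ D, (M.good μ t.succ D * M.estError π R t.castSucc D) ^ 2 ∂(M.sampleLaw μ n) ≤
        ∫ D, (M.good μ t.castSucc D * M.estError π R t.castSucc D) ^ 2 ∂(M.sampleLaw μ n) := by
      refine integral_mono ((historyFun_good_mul_estError π hR _ _).integrable _)
        ((historyFun_good_mul_estError π hR _ _).integrable _) fun D => ?_
      simp only [mul_pow, good_sq]
      exact mul_le_mul_of_nonneg_right (M.good_anti μ (Fin.castSucc_le_succ t) D) (sq_nonneg _)
    linarith
  have h2 := fin_sum_sub f
  have h3 := Finset.sum_le_sum fun t (_ : t ∈ Finset.univ) => h t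
  have h4 : f 0 = _ := integral_sq_estError_zero π hn R
  change f (Fin.last H) ≤ _
  linarith

lemma le_integral_sq_estError_last (hd : ∀ t s a, 0 < M.stateActionOcc μ t s a) (hn : 0 < n)
    {R : ℝ} (hR : 0 ≤ R) :
    Var[fun ω => M.bellmanValue π R 0 (ω.state 0); M.law μ] / n +
        ∑ t, M.stepContribution π μ R n t - H * ((2 * (H * R)) ^ 2 * M.failProb μ n) ≤
      ∫ D, (M.good μ (Fin.last H) D * M.estError π R (Fin.last H) D) ^ 2 ∂(M.sampleLaw μ n) := by
  set f : Fin (H + 1) → ℝ := fun k =>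
    ∫ D, (M.good μ k D * M.estError π R k D) ^ 2 ∂(M.sampleLaw μ n) with hf
  have h : ∀ t : Fin H, M.stepContribution π μ R n t - (2 * (H * R)) ^ 2 * M.failProb μ n ≤
      f t.succ - f t.castSucc := by
    intro t
    simp only [hf]
    rw [integral_sq_estError_succ π hd hn hR t]
    have i1 := (historyFun_good_mul_estError (n := n) (M := M) (μ := μ) π hR t.castSucc
      t.castSucc).integrable (M.sampleLaw μ n)
    have i2 := (historyFun_good_mul_estError (n := n) (M := M) (μ := μ) π hR t.succ
      t.castSucc).integrable (M.sampleLaw μ n)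
    have i3 : Integrable (fun D : Fin n → Traj S A H => (2 * (H * R)) ^ 2 *
        (1 - M.good μ (Fin.last H) D)) (M.sampleLaw μ n) :=
      ((integrable_const _).sub ((M.historyFun_good_eq μ _).integrable _)).const_mul _
    have : ∫ D, (M.good μ t.castSucc D * M.estError π R t.castSucc D) ^ 2 ∂(M.sampleLaw μ n) -
        (2 * (H * R)) ^ 2 * M.failProb μ n ≤
        ∫ D, (M.good μ t.succ D * M.estError π R t.castSucc D) ^ 2 ∂(M.sampleLaw μ n) := by
      rw [← integral_one_sub_good, ← integral_const_mul, ← integral_sub i1 i3]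
      refine integral_mono (i1.sub i3) i2 fun D => ?_
      simp only [mul_pow, good_sq]
      have hX := M.sq_estError_le π hR t.castSucc D
      have g1 := M.good_anti μ (Fin.castSucc_le_succ t) D
      have g2 := M.good_anti μ (Fin.le_last t.succ) D
      have g3 := M.good_le_one μ t.castSucc D
      have g4 : (M.good μ t.castSucc D - M.good μ t.succ D) * M.estError π R t.castSucc D ^ 2 ≤
          (1 - M.good μ (Fin.last H) D) * (2 * (H * R)) ^ 2 :=
        mul_le_mul (by linarith) hX (sq_nonneg _) (by linarith)
      rw [mul_pow] at g4
      linarith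
    linarith
  have h2 := fin_sum_sub f
  have h3 := Finset.sum_le_sum fun t (_ : t ∈ Finset.univ) => h t
  have h4 : f 0 = _ := integral_sq_estError_zero π hn R
  rw [Finset.sum_sub_distrib] at h3
  simp only [Finset.sum_const, Finset.card_univ, Fintype.card_fin, nsmul_eq_mul] at h3
  change _ ≤ f (Fin.last H)
  linarith

/-! ### Bounds on the visit moments -/

/-- Splitting on whether the count falls below `1 - δ` times its mean gives the sharp leading
constant. -/
lemma visitMoment_le {t : Fin H} {s : S} {a : A} (hd : 0 < M.stateActionOcc μ t s a) (hn : 0 < n)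
    {δ : ℝ} (hδ0 : 0 ≤ δ) (hδ : δ ≤ 1 / 2) :
    M.visitMoment π μ n t s a ≤
      (1 + 2 * δ) / (n * M.stateActionOcc μ t s a) *
        ∫ D, (M.good μ t.castSucc D * occHat π D t.castSucc s) ^ 2 ∂(M.sampleLaw μ n) +
      3 / (n * M.stateActionOcc μ t s a) *
        Real.exp (-(δ ^ 2 / 2 * (n * M.stateActionOcc μ t s a))) := by
  set x := (n : ℝ) * M.stateActionOcc μ t s a with hx
  have hx0 : 0 < x := mul_pos (Nat.cast_pos.2 hn) hd
  set B : Set (Fin n → Traj S A H) := {D | (count D t s a : ℝ) ≤ (1 - δ) * x} with hB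
  have hBm : MeasurableSet B := measurableSet_count_le t s a _
  have hBP : (M.sampleLaw μ n).real B ≤ Real.exp (-(δ ^ 2 / 2 * x)) :=
    M.count_chernoff μ t s a hδ0
  have i1 : Integrable (fun D : Fin n → Traj S A H => (1 + 2 * δ) / x *
      (M.good μ t.castSucc D * occHat π D t.castSucc s) ^ 2) (M.sampleLaw μ n) :=
    ((HistoryFun.const _).mul ((M.historyFun_good_eq μ _).mul
      (historyFun_occHat_eq π _ s)).sq).integrable _
  have i2 : Integrable (fun D : Fin n → Traj S A H => 3 / x * B.indicator (fun _ => (1 : ℝ)) D)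
      (M.sampleLaw μ n) := ((integrable_const _).indicator hBm).const_mul _
  have h1 : M.visitMoment π μ n t s a ≤ ∫ D, ((1 + 2 * δ) / x *
      (M.good μ t.castSucc D * occHat π D t.castSucc s) ^ 2 +
      3 / x * B.indicator (fun _ => (1 : ℝ)) D) ∂(M.sampleLaw μ n) := by
    refine integral_mono ((((M.historyFun_good μ t).mul (historyFun_occHat π t s).sq).mul
      (historyFun_inv_count t s a)).toEq.integrable _) (i1.add i2) fun D => ?_
    have hind : 0 ≤ B.indicator (fun _ => (1 : ℝ)) D :=
      Set.indicator_nonneg (fun _ _ => zero_le_one) _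
    by_cases hg : M.good μ t.succ D = 0
    · simp only [hg, zero_mul]
      positivity
    have hcount := M.le_count_of_good μ hg s a
    rw [← hx] at hcount
    have hg1 : M.good μ t.succ D = 1 := (M.good_eq_zero_or_one μ _ D).resolve_left hg
    have hg2 : M.good μ t.castSucc D = 1 := le_antisymm (M.good_le_one μ _ D)
      (hg1 ▸ M.good_anti μ (Fin.castSucc_le_succ t) D)
    simp only [hg1, hg2, one_mul]
    have ho := occHat_nonneg π D t.castSucc s
    by_cases hDB : D ∈ B
    · have h2 : (count D t s a : ℝ)⁻¹ ≤ 3 / x := by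
        rw [inv_le_comm₀ (by linarith) (by positivity), inv_div]
        linarith
      have h3 : occHat π D t.castSucc s ^ 2 ≤ 1 := pow_le_one₀ ho (occHat_le_one π D _ s)
      rw [Set.indicator_of_mem hDB]
      have h4 : occHat π D t.castSucc s ^ 2 * (count D t s a : ℝ)⁻¹ ≤ 1 * (3 / x) :=
        mul_le_mul h3 h2 (by positivity) zero_le_one
      have h5 : 0 ≤ (1 + 2 * δ) / x * occHat π D t.castSucc s ^ 2 := by positivity
      linarith
    · have hlt : (1 - δ) * x < (count D t s a : ℝ) := not_le.1 hDB
      have h2 : (count D t s a : ℝ)⁻¹ ≤ (1 + 2 * δ) / x := by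
        rw [inv_le_comm₀ (by linarith) (by positivity), inv_div, div_le_iff₀ (by positivity)]
        nlinarith [mul_nonneg hδ0 (by linarith : 0 ≤ 1 - 2 * δ)]
      have h4 : occHat π D t.castSucc s ^ 2 * (count D t s a : ℝ)⁻¹ ≤
          occHat π D t.castSucc s ^ 2 * ((1 + 2 * δ) / x) :=
        mul_le_mul_of_nonneg_left h2 (sq_nonneg _)
      have h5 : 0 ≤ 3 / x * B.indicator (fun _ => (1 : ℝ)) D := by positivity
      linarith
  refine h1.trans ?_
  rw [integral_add i1 i2, integral_const_mul, integral_const_mul,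
    integral_indicator_const _ hBm, smul_eq_mul, mul_one]
  gcongr

/-- The bound `x ^ 2 / y ≥ 2 * l * x - l ^ 2 * y` with `l` the ratio of the limits of `x` and `y`
replaces a law of large numbers. -/
lemma le_visitMoment {t : Fin H} {s : S} {a : A} (hd : ∀ t s a, 0 < M.stateActionOcc μ t s a)
    (hn : 0 < n) :
    M.stateOcc π t.castSucc s ^ 2 / M.stateActionOcc μ t s a -
        2 * (M.stateOcc π t.castSucc s / M.stateActionOcc μ t s a) * (H * M.failProb μ n) ≤
      n * M.visitMoment π μ n t s a := by
  set d := M.stateActionOcc μ t s a with hdd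
  set e := M.stateOcc π t.castSucc s with he
  set l := e / d with hl
  have hd0 : 0 < d := hd t s a
  have hn' : (0 : ℝ) < n := Nat.cast_pos.2 hn
  have hl0 : 0 ≤ l := div_nonneg (M.stateOcc_nonneg π _ s) hd0.le
  have hq := M.failProb_nonneg μ (n := n)
  have i1 : Integrable (fun D : Fin n → Traj S A H =>
      2 * l * (M.good μ t.succ D * occHat π D t.castSucc s)) (M.sampleLaw μ n) :=
    ((HistoryFun.const _).mul ((M.historyFun_good_eq μ _).mul
      (historyFun_occHat_eq π _ s))).integrable _
  have i2 : Integrable (fun D : Fin n → Traj S A H => l ^ 2 / n * (count D t s a : ℝ))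
      (M.sampleLaw μ n) := ((HistoryFun.const _).mul (historyFun_count t s a).toEq).integrable _
  have h1 : ∫ D, (2 * l * (M.good μ t.succ D * occHat π D t.castSucc s) -
      l ^ 2 / n * (count D t s a : ℝ)) ∂(M.sampleLaw μ n) ≤ n * M.visitMoment π μ n t s a := by
    rw [visitMoment, ← integral_const_mul]
    refine integral_mono (i1.sub i2) ((((M.historyFun_good μ t).mul
      (historyFun_occHat π t s).sq).mul (historyFun_inv_count t s a)).toEq.integrable _
        |>.const_mul _) fun D => ?_
    by_cases hg : M.good μ t.succ D = 0
    · simp only [hg, zero_mul, mul_zero, zero_sub]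
      have : 0 ≤ l ^ 2 / n * (count D t s a : ℝ) := by positivity
      linarith
    have hg1 : M.good μ t.succ D = 1 := (M.good_eq_zero_or_one μ _ D).resolve_left hg
    have hc : (0 : ℝ) < count D t s a :=
      Nat.cast_pos.2 (Nat.pos_of_ne_zero (count_ne_zero_of_good hd0 hn hg))
    simp only [hg1, one_mul]
    set x := occHat π D t.castSucc s
    set c := (count D t s a : ℝ)
    have h0 : 0 ≤ n / c * (x - l * c / n) ^ 2 := by positivity
    have e1 : n / c * (x - l * c / n) ^ 2 = n * (x ^ 2 * c⁻¹) - (2 * l * x - l ^ 2 / n * c) := by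
      field_simp
      ring
    linarith
  refine le_trans ?_ h1
  rw [integral_sub i1 i2, integral_const_mul, integral_const_mul, integral_count, ← hdd]
  have h2 := le_integral_sum_occHat π hd hn t.castSucc (φ := Pi.single s 1) (fun x => by
    by_cases h : x = s
    · subst h; simp
    · simp [h])
  simp only [Pi.single_apply, mul_ite, mul_one, mul_zero, Finset.sum_ite_eq', Finset.mem_univ,
    if_true] at h2
  have i3 : Integrable (fun D : Fin n → Traj S A H => M.good μ t.castSucc D *
      occHat π D t.castSucc s) (M.sampleLaw μ n) :=
    ((M.historyFun_good_eq μ _).mul (historyFun_occHat_eq π _ s)).integrable _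
  have i4 : Integrable (fun D : Fin n → Traj S A H => M.good μ t.succ D *
      occHat π D t.castSucc s) (M.sampleLaw μ n) :=
    ((M.historyFun_good_eq μ _).mul (historyFun_occHat_eq π _ s)).integrable _
  have i5 : Integrable (fun D : Fin n → Traj S A H => 1 - M.good μ (Fin.last H) D)
      (M.sampleLaw μ n) :=
    (integrable_const _).sub ((M.historyFun_good_eq μ _).integrable _)
  have h3 : ∫ D, M.good μ t.castSucc D * occHat π D t.castSucc s ∂(M.sampleLaw μ n) -
      M.failProb μ n ≤
      ∫ D, M.good μ t.succ D * occHat π D t.castSucc s ∂(M.sampleLaw μ n) := by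
    rw [← integral_one_sub_good, ← integral_sub i3 i5]
    refine integral_mono (i3.sub i5) i4 fun D => ?_
    have g1 := M.good_anti μ (Fin.castSucc_le_succ t) D
    have g2 := M.good_anti μ (Fin.le_last t.succ) D
    have g3 := M.good_le_one μ t.castSucc D
    nlinarith [occHat_nonneg π D t.castSucc s, occHat_le_one π D t.castSucc s]
  have hH : ((t.castSucc : Fin (H + 1)) : ℝ) + 1 ≤ H := by
    have := t.isLt
    rw [Fin.val_castSucc]
    exact_mod_cast this
  have h4 : e - H * M.failProb μ n ≤
      ∫ D, M.good μ t.succ D * occHat π D t.castSucc s ∂(M.sampleLaw μ n) := by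
    have := mul_le_mul_of_nonneg_right hH hq
    rw [add_mul, one_mul] at this
    linarith
  have h5 := mul_le_mul_of_nonneg_left h4 (mul_nonneg zero_le_two hl0)
  have e2 : e ^ 2 / d = 2 * l * e - l ^ 2 * d := by
    rw [hl]; field_simp; ring
  have e3 : l ^ 2 / n * (n * d) = l ^ 2 * d := by field_simp
  rw [e3, e2]
  linarith

end TabularMDP

/-! ### Bounds on the mean square error -/

namespace TabularMDP

open TMIS

variable {S A : Type*} [Fintype S] [Fintype A] [DecidableEq S] [DecidableEq A]
  [MeasurableSpace S] [MeasurableSpace A] [MeasurableSingletonClass S]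
  [MeasurableSingletonClass A] {H n : ℕ} {M : TabularMDP S A H} (π : Policy S A H)
  {μ : Policy S A H}

/-- Truncating the rewards changes the estimator on a null set only, so its mean square error is the
second moment of the last of the completed errors. -/
lemma mse_eq {R : ℝ} (hR : 0 ≤ R) (hM : M.RewardsIn R) (n : ℕ) :
    mse M π μ n = ∫ D, M.estError π R (Fin.last H) D ^ 2 ∂(M.sampleLaw μ n) := by
  have hae : ∀ᵐ D ∂(M.sampleLaw μ n), ∀ i t, (D i).rew t ∈ Set.Icc 0 R :=
    ae_all_iff.2 fun i => (measurePreserving_eval (fun _ : Fin n => M.law μ) i).quasiMeasurePreserving.ae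
      (M.ae_rew_mem μ hM)
  refine integral_congr_ae ?_
  filter_upwards [hae] with D hD
  rw [estError, partialReturn_last π hD, M.value_eq π hM hR]
  simp [bellmanValue_last]

lemma mse_le_good_add {R : ℝ} (hR : 0 ≤ R) (hM : M.RewardsIn R) (n : ℕ) :
    mse M π μ n ≤
      ∫ D, (M.good μ (Fin.last H) D * M.estError π R (Fin.last H) D) ^ 2 ∂(M.sampleLaw μ n) +
        (H * R) ^ 2 * M.failProb μ n := by
  have i1 := (historyFun_good_mul_estError (n := n) (M := M) (μ := μ) π hR (Fin.last H)
    (Fin.last H)).integrable (M.sampleLaw μ n)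
  have i3 : Integrable (fun D : Fin n → Traj S A H => (H * R) ^ 2 *
      (1 - M.good μ (Fin.last H) D)) (M.sampleLaw μ n) :=
    ((integrable_const _).sub ((M.historyFun_good_eq μ _).integrable _)).const_mul _
  rw [mse_eq π hR hM, ← integral_one_sub_good, ← integral_const_mul, ← integral_add i1 i3]
  refine integral_mono ((M.historyFun_estError π hR _).sq.integrable _) (i1.add i3) fun D => ?_
  simp only [mul_pow, good_sq]
  have h1 := M.sq_estError_last_le π hR D
  have h2 := M.good_le_one μ (Fin.last H) D
  have h3 := mul_le_mul_of_nonneg_left h1 (sub_nonneg.2 h2)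
  rw [mul_pow] at h3
  linarith

lemma good_le_mse {R : ℝ} (hR : 0 ≤ R) (hM : M.RewardsIn R) (n : ℕ) :
    ∫ D, (M.good μ (Fin.last H) D * M.estError π R (Fin.last H) D) ^ 2 ∂(M.sampleLaw μ n) ≤
      mse M π μ n := by
  rw [mse_eq π hR hM]
  refine integral_mono ((historyFun_good_mul_estError π hR _ _).integrable _)
    ((M.historyFun_estError π hR _).sq.integrable _) fun D => ?_
  simp only [mul_pow, good_sq]
  exact mul_le_of_le_one_left (sq_nonneg _) (M.good_le_one μ _ D)

/-- The arithmetic of one term `(s, a)` of the error at one step, where `d`, `e`, `p`, `m` stand for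
`d^π(s)`, `d^μ(s)`, `π(a|s)`, `μ(a|s)` and `v ≤ V` for the conditional variance: the leading term
separates from a remainder that is summable against `d p` and `p`. -/
lemma contribution_le {N p m d e dm τa τs v V δ I J E : ℝ} (hN : 0 < N) (he : 0 < e) (hm : 0 < m)
    (hp : 0 ≤ p) (hd : 0 ≤ d) (hτa : 0 ≤ τa) (hτs : 0 ≤ τs) (hdm : 0 < dm) (hdme : dm ≤ e)
    (h1 : p ≤ τa * m) (hv : 0 ≤ v) (hV : v ≤ V) (hδ0 : 0 ≤ δ) (hδ : δ ≤ 1 / 2)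
    (hI : I ≤ (1 + 2 * δ) / (N * (e * m)) * J + 3 / (N * (e * m)) * E)
    (hJ : J ≤ d ^ 2 + 12 * τa * τs / N * d) (hE : E ≤ 1 / N ^ 2) :
    p ^ 2 * v * I ≤ (1 + 2 * δ) / N * (d ^ 2 / e * (p ^ 2 / m) * v) +
      (24 * τa ^ 2 * τs * V / (N ^ 2 * dm) * (d * p) + 3 * τa * V / (N ^ 3 * dm) * p) := by
  have hx : p / m ≤ τa := by rwa [div_le_iff₀ hm]
  have hx0 : 0 ≤ p / m := by positivity
  have hy : 1 / e ≤ 1 / dm := one_div_le_one_div_of_le hdm hdme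
  have hI2 : I ≤ (1 + 2 * δ) / (N * (e * m)) * (d ^ 2 + 12 * τa * τs / N * d) +
      3 / (N * (e * m)) * (1 / N ^ 2) := by
    refine hI.trans ?_
    gcongr
  have h2 : p ^ 2 * v * I ≤ p ^ 2 * v * ((1 + 2 * δ) / (N * (e * m)) *
      (d ^ 2 + 12 * τa * τs / N * d) + 3 / (N * (e * m)) * (1 / N ^ 2)) := by gcongr
  refine h2.trans ?_
  have e1 : p ^ 2 * v * ((1 + 2 * δ) / (N * (e * m)) *
      (d ^ 2 + 12 * τa * τs / N * d) + 3 / (N * (e * m)) * (1 / N ^ 2)) =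
      (1 + 2 * δ) / N * (d ^ 2 / e * (p ^ 2 / m) * v) +
      ((1 + 2 * δ) * (p / m) * (1 / e) * v * (12 * τa * τs * d * p / N ^ 2) +
        3 * (p / m) * (1 / e) * v * (p / N ^ 3)) := by
    field_simp
    ring
  have e2 : 24 * τa ^ 2 * τs * V / (N ^ 2 * dm) * (d * p) + 3 * τa * V / (N ^ 3 * dm) * p =
      2 * τa * (1 / dm) * V * (12 * τa * τs * d * p / N ^ 2) +
        3 * τa * (1 / dm) * V * (p / N ^ 3) := by
    field_simp
    ring
  rw [e1, e2]
  have h3 : 1 + 2 * δ ≤ 2 := by linarith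
  gcongr

section Upper

variable {τa τs : ℝ}
  (hμ : ∀ (t : Fin H) s a, 0 < μ.prob t s a) (hs : ∀ (t : Fin H) s, 0 < M.stateOcc μ t.castSucc s)
  (hn : 0 < n)
  (hτa : ∀ t s a, π.prob t s a ≤ τa * μ.prob t s a)
  (hτs : ∀ (t : Fin H) s, M.stateOcc π t.castSucc s ≤ τs * M.stateOcc μ t.castSucc s)
  (hτa1 : 1 ≤ τa) (hτs1 : 1 ≤ τs) (h4 : ∀ (t : Fin H) s, 4 * τa ≤ n * M.stateOcc μ t.castSucc s)
  {R : ℝ} (hR : 0 ≤ R) (hM : M.RewardsIn R)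
  {dm : ℝ} (hdm : 0 < dm) (hdm1 : dm ≤ 1) (hdms : ∀ (t : Fin H) s, dm ≤ M.stateOcc μ t.castSucc s)
  (hSn : (Fintype.card S : ℝ) ≤ n) {δ : ℝ} (hδ0 : 0 ≤ δ) (hδ : δ ≤ 1 / 2)
  (hexp : ∀ t s a, Real.exp (-(δ ^ 2 / 2 * (n * M.stateActionOcc μ t s a))) ≤ 1 / (n : ℝ) ^ 2)
  (hq : M.failProb μ n ≤ H / (n : ℝ) ^ 2)

include hμ hs hn hτa hτs hτa1 hτs1 h4 hR hdm hdms hSn hδ0 hδ hexp in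
lemma stepContribution_le (t : Fin H) :
    M.stepContribution π μ R n t ≤ (1 + 2 * δ) / n * (∑ s, ∑ a,
        M.stateOcc π t.castSucc s ^ 2 / M.stateOcc μ t.castSucc s *
          (π.prob t s a ^ 2 / μ.prob t s a) * M.stepVariance t (M.target π R t) s a) +
      27 * (τa ^ 2 * τs * (H * R) ^ 2 / ((n : ℝ) ^ 2 * dm)) := by
  have hn' : (0 : ℝ) < n := Nat.cast_pos.2 hn
  have hd : ∀ s a, 0 < M.stateActionOcc μ t s a := fun s a => by
    rw [stateActionOcc_eq]; exact mul_pos (hs t s) (hμ t s a)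
  have h1 : ∀ s a, π.prob t s a ^ 2 * M.stepVariance t (M.target π R t) s a *
      M.visitMoment π μ n t s a ≤ (1 + 2 * δ) / n * (M.stateOcc π t.castSucc s ^ 2 /
        M.stateOcc μ t.castSucc s * (π.prob t s a ^ 2 / μ.prob t s a) *
          M.stepVariance t (M.target π R t) s a) +
      (24 * τa ^ 2 * τs * (H * R) ^ 2 / ((n : ℝ) ^ 2 * dm) *
          (M.stateOcc π t.castSucc s * π.prob t s a) +
        3 * τa * (H * R) ^ 2 / ((n : ℝ) ^ 3 * dm) * π.prob t s a) := by
    intro s a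
    have hI := visitMoment_le π (hd s a) hn hδ0 hδ
    rw [stateActionOcc_eq] at hI
    refine contribution_le hn' (hs t s) (hμ t s a) (π.prob_nonneg t s a)
      (M.stateOcc_nonneg π _ s) (by linarith) (by linarith) hdm (hdms t s) (hτa t s a)
      (M.stepVariance_nonneg t _ s a)
      (M.stepVariance_le t (M.measurable_target π R t) (M.target_mem π hR t) s a) hδ0 hδ hI
      (integral_sq_occHat_le π hμ hs hn hτa hτs hτa1 hτs1 h4 t.castSucc s) ?_
    rw [← stateActionOcc_eq]
    exact hexp t s a
  refine (Finset.sum_le_sum fun s _ => Finset.sum_le_sum fun a _ => h1 s a).trans ?_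
  simp only [Finset.sum_add_distrib, ← Finset.mul_sum, π.sum_prob, mul_one, M.sum_stateOcc]
  refine add_le_add le_rfl ?_
  simp only [Finset.sum_const, Finset.card_univ, nsmul_eq_mul]
  have h2 : 3 * τa * (H * R) ^ 2 / ((n : ℝ) ^ 3 * dm) * Fintype.card S ≤
      3 * (τa ^ 2 * τs * (H * R) ^ 2 / ((n : ℝ) ^ 2 * dm)) := by
    have h3 : τa ≤ τa ^ 2 * τs := by
      have : 1 * 1 ≤ τa * τs := mul_le_mul hτa1 hτs1 zero_le_one (by linarith)
      nlinarith
    calc 3 * τa * (H * R) ^ 2 / ((n : ℝ) ^ 3 * dm) * Fintype.card S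
        ≤ 3 * τa * (H * R) ^ 2 / ((n : ℝ) ^ 3 * dm) * n := by gcongr
      _ = 3 * (τa * (H * R) ^ 2 / ((n : ℝ) ^ 2 * dm)) := by field_simp
      _ ≤ _ := by gcongr
  have h5 : 24 * τa ^ 2 * τs * (H * R) ^ 2 / ((n : ℝ) ^ 2 * dm) =
      24 * (τa ^ 2 * τs * (H * R) ^ 2 / ((n : ℝ) ^ 2 * dm)) := by ring
  rw [h5]
  linarith

include hμ hs hn hτa hτs hτa1 hτs1 h4 hR hM hdm hdm1 hdms hSn hδ0 hδ hexp hq in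
/-- Of the factor `28`, the excess second moment of the estimated occupancies and the deviations of
the counts account for `27`, the event of insufficient visits for `1`. -/
theorem mse_le : mse M π μ n ≤ 1 / (n : ℝ) * M.leadingVar π μ * (1 + 2 * δ) +
    28 * (τa ^ 2 * τs * (H : ℝ) ^ 3 * R ^ 2 / ((n : ℝ) ^ 2 * dm)) := by
  have hn' : (0 : ℝ) < n := Nat.cast_pos.2 hn
  have hd : ∀ t s a, 0 < M.stateActionOcc μ t s a := fun t s a => by
    rw [stateActionOcc_eq]; exact mul_pos (hs t s) (hμ t s a)
  have h1 := mse_le_good_add (μ := μ) π hR hM n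
  have h2 := integral_sq_estError_last_le π hd hn hR
  have h3 := Finset.sum_le_sum fun t (_ : t ∈ (Finset.univ : Finset (Fin H))) =>
    stepContribution_le π hμ hs hn hτa hτs hτa1 hτs1 h4 hR hdm hdms hSn hδ0 hδ hexp t
  rw [Finset.sum_add_distrib, ← Finset.mul_sum] at h3
  simp only [Finset.sum_const, Finset.card_univ, Fintype.card_fin, nsmul_eq_mul] at h3
  have h4 : (H * R) ^ 2 * M.failProb μ n ≤
      τa ^ 2 * τs * (H : ℝ) ^ 3 * R ^ 2 / ((n : ℝ) ^ 2 * dm) := by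
    have h5 : 1 ≤ τa ^ 2 * τs := by
      have : 1 * 1 ≤ τa ^ 2 * τs :=
        mul_le_mul (one_le_pow₀ hτa1) hτs1 zero_le_one (by positivity)
      linarith
    calc (H * R) ^ 2 * M.failProb μ n ≤ (H * R) ^ 2 * (H / (n : ℝ) ^ 2) := by gcongr
      _ = 1 * ((H : ℝ) ^ 3 * R ^ 2) / ((n : ℝ) ^ 2 * 1) := by ring
      _ ≤ (τa ^ 2 * τs) * ((H : ℝ) ^ 3 * R ^ 2) / ((n : ℝ) ^ 2 * dm) := by gcongr
      _ = _ := by ring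
  have h6 : (H : ℝ) * (27 * (τa ^ 2 * τs * (H * R) ^ 2 / ((n : ℝ) ^ 2 * dm))) =
      27 * (τa ^ 2 * τs * (H : ℝ) ^ 3 * R ^ 2 / ((n : ℝ) ^ 2 * dm)) := by ring
  rw [h6] at h3
  set X := Var[fun ω => M.bellmanValue π R 0 (ω.state 0); M.law μ] with hX
  have hX0 : 0 ≤ X := variance_nonneg _ _
  have h7 : X / n ≤ (1 + 2 * δ) / n * X := by
    rw [div_mul_eq_mul_div]
    gcongr
    nlinarith
  rw [M.leadingVar_eq π hM hR μ hs hμ, ← hX]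
  have h8 : ∀ Z : ℝ, 1 / (n : ℝ) * (X + Z) * (1 + 2 * δ) =
      (1 + 2 * δ) / n * X + (1 + 2 * δ) / n * Z := fun Z => by ring
  rw [h8]
  linarith

end Upper

/-- Lower bound for the mean square error: up to a multiple of the failure probability it is at
least the leading term. -/
theorem le_mse (hμ : ∀ (t : Fin H) s a, 0 < μ.prob t s a)
    (hs : ∀ (t : Fin H) s, 0 < M.stateOcc μ t.castSucc s) {R : ℝ} (hR : 0 ≤ R)
    (hM : M.RewardsIn R) : ∃ K₁ K₂ : ℝ, 0 ≤ K₁ ∧ 0 ≤ K₂ ∧ ∀ n : ℕ, 0 < n →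
      M.leadingVar π μ - (K₁ + n * K₂) * M.failProb μ n ≤ n * mse M π μ n := by
  have hd : ∀ t s a, 0 < M.stateActionOcc μ t s a := fun t s a => by
    rw [stateActionOcc_eq]; exact mul_pos (hs t s) (hμ t s a)
  have hv : ∀ t s a, 0 ≤ π.prob t s a ^ 2 * M.stepVariance t (M.target π R t) s a :=
    fun t s a => mul_nonneg (sq_nonneg _) (M.stepVariance_nonneg t _ s a)
  refine ⟨∑ t, ∑ s, ∑ a, π.prob t s a ^ 2 * M.stepVariance t (M.target π R t) s a *
    (2 * (M.stateOcc π t.castSucc s / M.stateActionOcc μ t s a) * H), H * (2 * (H * R)) ^ 2,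
    ?_, by positivity, fun n hn => ?_⟩
  · refine Finset.sum_nonneg fun t _ => Finset.sum_nonneg fun s _ => Finset.sum_nonneg fun a _ =>
      mul_nonneg (hv t s a) ?_
    have h1 := M.stateOcc_nonneg π t.castSucc s
    have h2 := hd t s a
    positivity
  have hn' : (0 : ℝ) < n := Nat.cast_pos.2 hn
  have h1 := (le_integral_sq_estError_last π hd hn hR).trans (good_le_mse (μ := μ) π hR hM n)
  have h2 := mul_le_mul_of_nonneg_left h1 hn'.le
  have h3 : ∀ t, ∑ s, ∑ a, (M.stateOcc π t.castSucc s ^ 2 / M.stateOcc μ t.castSucc s *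
          (π.prob t s a ^ 2 / μ.prob t s a) * M.stepVariance t (M.target π R t) s a -
      π.prob t s a ^ 2 * M.stepVariance t (M.target π R t) s a *
        (2 * (M.stateOcc π t.castSucc s / M.stateActionOcc μ t s a) * H) * M.failProb μ n) ≤
      n * M.stepContribution π μ R n t := by
    intro t
    rw [stepContribution, Finset.mul_sum]
    refine Finset.sum_le_sum fun s _ => ?_
    rw [Finset.mul_sum]
    refine Finset.sum_le_sum fun a _ => ?_
    have h5 := mul_le_mul_of_nonneg_left (le_visitMoment π (t := t) (s := s) (a := a) hd hn)
      (hv t s a)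
    refine le_trans (le_of_eq ?_) (h5.trans (le_of_eq (by ring)))
    have h6 := (hs t s).ne'
    have h7 := (hμ t s a).ne'
    rw [stateActionOcc_eq]
    field_simp
  have h4 := Finset.sum_le_sum fun t (_ : t ∈ (Finset.univ : Finset (Fin H))) => h3 t
  simp only [Finset.sum_sub_distrib, ← Finset.sum_mul, ← Finset.mul_sum] at h4
  rw [M.leadingVar_eq π hM hR μ hs hμ]
  have h5 : (n : ℝ) * (Var[fun ω => M.bellmanValue π R 0 (ω.state 0); M.law μ] / n +
      ∑ t, M.stepContribution π μ R n t - H * ((2 * (H * R)) ^ 2 * M.failProb μ n)) =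
      Var[fun ω => M.bellmanValue π R 0 (ω.state 0); M.law μ] +
      n * ∑ t, M.stepContribution π μ R n t - n * (H * (2 * (H * R)) ^ 2) * M.failProb μ n := by
    field_simp
  rw [h5] at h2
  linarith

/-! ### The regime of large samples -/

lemma minStateActionOcc_le (t : Fin H) (s : S) (a : A) :
    M.minStateActionOcc μ ≤ M.stateActionOcc μ t s a :=
  ciInf_le (Set.finite_range _).bddBelow (⟨t, s, a⟩ : Fin H × S × A)

lemma minStateOcc_le (t : Fin H) (s : S) : M.minStateOcc μ ≤ M.stateOcc μ t.castSucc s :=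
  ciInf_le (Set.finite_range _).bddBelow (⟨t, s⟩ : Fin H × S)

lemma minMaxOcc_le (t : Fin H) (s : S) : M.minMaxOcc π μ ≤
    max (M.stateOcc π t.castSucc s) (M.stateOcc μ t.castSucc s) :=
  ciInf_le (Set.finite_range _).bddBelow (⟨t, s⟩ : Fin H × S)

lemma minStateActionOcc_pos (hμ : ∀ (t : Fin H) (s : S) a, 0 < μ.prob t s a)
    (hs : ∀ (t : Fin H) s, 0 < M.stateOcc μ t.castSucc s) (t : Fin H) (s : S) (a : A) :
    0 < M.minStateActionOcc μ := by
  have : Nonempty (Fin H × S × A) := ⟨(t, s, a)⟩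
  obtain ⟨x, hx⟩ := exists_eq_ciInf_of_finite
    (f := fun x : Fin H × S × A => M.stateActionOcc μ x.1 x.2.1 x.2.2)
  rw [minStateActionOcc, ← hx, stateActionOcc_eq]
  exact mul_pos (hs _ _) (hμ _ _ _)

lemma minStateOcc_pos (hs : ∀ (t : Fin H) s, 0 < M.stateOcc μ t.castSucc s) (t : Fin H) (s : S) :
    0 < M.minStateOcc μ := by
  have : Nonempty (Fin H × S) := ⟨(t, s)⟩
  obtain ⟨x, hx⟩ := exists_eq_ciInf_of_finite
    (f := fun x : Fin H × S => M.stateOcc μ x.1.castSucc x.2)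
  rw [minStateOcc, ← hx]
  exact hs _ _

lemma le_stateWeight_mul (hs : ∀ (t : Fin H) s, 0 < M.stateOcc μ t.castSucc s) (t : Fin H) (s : S) :
    M.stateOcc π t.castSucc s ≤ M.stateWeight π μ * M.stateOcc μ t.castSucc s := by
  rw [← div_le_iff₀ (hs t s)]
  exact le_ciSup (f := fun x : Fin H × S => M.stateOcc π x.1.castSucc x.2 /
    M.stateOcc μ x.1.castSucc x.2) (Set.finite_range _).bddAbove (⟨t, s⟩ : Fin H × S)

lemma le_actionWeight_mul (hμ : ∀ (t : Fin H) (s : S) a, 0 < μ.prob t s a) (t : Fin H) (s : S)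
    (a : A) : π.prob t s a ≤ actionWeight π μ * μ.prob t s a := by
  rw [← div_le_iff₀ (hμ t s a)]
  exact le_ciSup (f := fun x : Fin H × S × A => π.prob x.1 x.2.1 x.2.2 / μ.prob x.1 x.2.1 x.2.2)
    (Set.finite_range _).bddAbove (⟨t, s, a⟩ : Fin H × S × A)

lemma one_le_actionWeight (hμ : ∀ (t : Fin H) (s : S) a, 0 < μ.prob t s a) (t : Fin H) (s : S) :
    1 ≤ actionWeight π μ := by
  have h := Finset.sum_le_sum fun a (_ : a ∈ Finset.univ) => le_actionWeight_mul π hμ t s a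
  rwa [← Finset.mul_sum, π.sum_prob, μ.sum_prob, mul_one] at h

lemma one_le_stateWeight (hs : ∀ (t : Fin H) s, 0 < M.stateOcc μ t.castSucc s) (t : Fin H) :
    1 ≤ M.stateWeight π μ := by
  have h := Finset.sum_le_sum fun s (_ : s ∈ Finset.univ) => le_stateWeight_mul π hs t s
  rwa [← Finset.mul_sum, M.sum_stateOcc, M.sum_stateOcc, mul_one] at h

lemma nonempty_state (M : TabularMDP S A H) : Nonempty S := by
  by_contra h
  have := M.sum_init
  rw [not_nonempty_iff] at h
  simp at this

lemma _root_.Policy.nonempty_action (π : Policy S A H) (t : Fin H) (s : S) : Nonempty A := by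
  by_contra h
  have := π.sum_prob t s
  rw [not_nonempty_iff] at h
  simp at this

/-- What the lower bound on the number of episodes provides. With
`δ = √(4 log n / (n min d^μ(s, a)))`, half of the square root in the error bound, the counts fall
below `1 - δ` times their means with probability at most `n⁻²`. -/
lemma large_sample (hμ : ∀ (t : Fin H) (s : S) a, 0 < μ.prob t s a)
    (hs : ∀ (t : Fin H) s, 0 < M.stateOcc μ t.castSucc s) (hH : 1 ≤ H)
    (hcond : max (16 * Real.log n / M.minStateActionOcc μ)
      (4 * H * actionWeight π μ * M.stateWeight π μ / M.minMaxOcc π μ) < (n : ℝ)) :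
    0 < n ∧ (∀ (t : Fin H) s, 4 * actionWeight π μ ≤ n * M.stateOcc μ t.castSucc s) ∧
      (Fintype.card S : ℝ) ≤ n ∧ M.failProb μ n ≤ H / (n : ℝ) ^ 2 ∧
      Real.sqrt (16 * Real.log n / (n * M.minStateActionOcc μ)) / 2 ≤ 1 / 2 ∧
      ∀ t s a, Real.exp (-((Real.sqrt (16 * Real.log n / (n * M.minStateActionOcc μ)) / 2) ^ 2 / 2 *
        (n * M.stateActionOcc μ t s a))) ≤ 1 / (n : ℝ) ^ 2 := by
  have t₀ : Fin H := ⟨0, hH⟩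
  obtain ⟨s₀⟩ := M.nonempty_state
  obtain ⟨a₀⟩ := μ.nonempty_action t₀ s₀
  have : Nonempty (Fin H × S) := ⟨(t₀, s₀)⟩
  set d := M.minStateActionOcc μ with hd
  set τa := actionWeight π μ
  set τs := M.stateWeight π μ
  have hτa1 : 1 ≤ τa := one_le_actionWeight π hμ t₀ s₀
  have hτs1 : 1 ≤ τs := one_le_stateWeight π hs t₀
  have hH' : (1 : ℝ) ≤ H := by exact_mod_cast hH
  have hd0 : 0 < d := minStateActionOcc_pos hμ hs t₀ s₀ a₀
  have hm0 : 0 < M.minMaxOcc π μ := by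
    obtain ⟨x, hx⟩ := exists_eq_ciInf_of_finite
      (f := fun x : Fin H × S => max (M.stateOcc π x.1.castSucc x.2) (M.stateOcc μ x.1.castSucc x.2))
    rw [minMaxOcc, ← hx]
    exact lt_max_of_lt_right (hs _ _)
  obtain ⟨hc1, hc2⟩ := max_lt_iff.1 hcond
  rw [div_lt_iff₀ hd0] at hc1
  rw [div_lt_iff₀ hm0] at hc2
  have hn' : (0 : ℝ) < n := by
    by_contra h
    have h1 : (n : ℝ) * M.minMaxOcc π μ ≤ 0 := mul_nonpos_of_nonpos_of_nonneg (not_lt.1 h) hm0.le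
    have h2 : 0 < 4 * H * τa * τs := by positivity
    linarith
  have hn : 0 < n := Nat.cast_pos.1 hn'
  have h4 : ∀ (t : Fin H) s, 4 * τa ≤ n * M.stateOcc μ t.castSucc s := by
    intro t s
    have h1 : M.minMaxOcc π μ ≤ τs * M.stateOcc μ t.castSucc s :=
      (minMaxOcc_le π t s).trans (max_le (le_stateWeight_mul π hs t s)
        (le_mul_of_one_le_left (hs t s).le hτs1))
    have h2 : (4 * τa) * τs ≤ (n * M.stateOcc μ t.castSucc s) * τs :=
      calc (4 * τa) * τs ≤ H * ((4 * τa) * τs) := le_mul_of_one_le_left (by positivity) hH'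
        _ = 4 * H * τa * τs := by ring
        _ ≤ n * M.minMaxOcc π μ := hc2.le
        _ ≤ n * (τs * M.stateOcc μ t.castSucc s) := by gcongr
        _ = _ := by ring
    exact le_of_mul_le_mul_right h2 (by linarith)
  have hn4 : (4 : ℝ) ≤ n := by
    have h1 := h4 t₀ s₀
    have h2 := mul_le_of_le_one_right hn'.le (M.stateOcc_le_one μ t₀.castSucc s₀)
    linarith
  have hlog : 1 / 16 ≤ Real.log n := by
    have h1 := Real.add_one_le_exp (1 : ℝ)
    have h2 : Real.exp 1 ≤ n := by linarith [Real.exp_one_lt_d9]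
    have h3 := (Real.le_log_iff_exp_le hn').2 h2
    linarith
  have hnd : 1 ≤ n * d := by linarith
  have hSA : (Fintype.card S : ℝ) * Fintype.card A ≤ n := by
    have h1 : ∑ s, ∑ a, M.stateActionOcc μ t₀ s a = 1 := by
      simp only [stateActionOcc_eq, ← Finset.mul_sum, μ.sum_prob, mul_one, M.sum_stateOcc]
    have h2 : ∑ _s : S, ∑ _a : A, d ≤ 1 := by
      rw [← h1]
      exact Finset.sum_le_sum fun s _ => Finset.sum_le_sum fun a _ => minStateActionOcc_le t₀ s a
    simp only [Finset.sum_const, Finset.card_univ, nsmul_eq_mul] at h2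
    have h3 : (Fintype.card S : ℝ) * Fintype.card A * d ≤ n * d := by linarith
    exact le_of_mul_le_mul_right h3 hd0
  have hA1 : (1 : ℝ) ≤ Fintype.card A := by
    exact_mod_cast Fintype.card_pos_iff.2 ⟨a₀⟩
  have hexpn : ∀ c k : ℝ, k ≤ c → Real.exp (-(c * Real.log n)) ≤ (n : ℝ) ^ (-k) := by
    intro c k hk
    rw [Real.rpow_def_of_pos hn']
    refine Real.exp_le_exp.2 ?_
    nlinarith
  have hδsq : (Real.sqrt (16 * Real.log n / (n * d)) / 2) ^ 2 = 4 * Real.log n / (n * d) := by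
    rw [div_pow, Real.sq_sqrt (by positivity)]
    ring
  refine ⟨hn, h4, ?_, ?_, ?_, fun t s a => ?_⟩
  · refine le_trans ?_ hSA
    exact le_mul_of_one_le_right (Nat.cast_nonneg _) hA1
  · have h1 := M.failProb_le μ (n := n) (L := 16 * Real.log n) fun t s a => hc1.le.trans
      (mul_le_mul_of_nonneg_left (minStateActionOcc_le t s a) hn'.le)
    -- Since `2 / 9 * 16 ≥ 3`, each pair fails with probability at most `n⁻³`, and there are at most
    -- `n` pairs at each step.
    have h2 : Real.exp (-(2 / 9 * (16 * Real.log n))) ≤ 1 / (n : ℝ) ^ 3 := by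
      have h3 := hexpn (32 / 9) 3 (by norm_num)
      rw [Real.rpow_neg hn'.le] at h3
      rw [one_div]
      refine le_trans (le_of_eq ?_) (h3.trans (le_of_eq ?_))
      · congr 1; ring
      · norm_cast
    calc M.failProb μ n ≤ _ := h1
      _ = H * (Fintype.card S * Fintype.card A) * Real.exp (-(2 / 9 * (16 * Real.log n))) := by ring
      _ ≤ H * n * (1 / (n : ℝ) ^ 3) := by gcongr
      _ = H / (n : ℝ) ^ 2 := by field_simp
  · have : Real.sqrt (16 * Real.log n / (n * d)) ≤ 1 := by
      rw [Real.sqrt_le_left zero_le_one, one_pow, div_le_one (by positivity)]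
      exact hc1.le
    linarith
  · rw [hδsq]
    have h1 : 2 * Real.log n ≤ 4 * Real.log n / (n * d) / 2 * (n * M.stateActionOcc μ t s a) := by
      have h2 : d ≤ M.stateActionOcc μ t s a := minStateActionOcc_le t s a
      calc 2 * Real.log n = 4 * Real.log n / (n * d) / 2 * (n * d) := by field_simp; ring
        _ ≤ _ := by gcongr
    refine (Real.exp_le_exp.2 (neg_le_neg h1)).trans ?_
    have h3 := hexpn 2 2 le_rfl
    rw [Real.rpow_neg hn'.le] at h3
    rw [one_div]
    exact h3.trans (le_of_eq (by norm_cast))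

end TabularMDP

/-! ### The error bound and its limit -/

lemma tendsto_log_div_mul_atTop (d : ℝ) :
    Tendsto (fun n : ℕ => 16 * Real.log n / (n * d)) atTop (𝓝 0) := by
  have h : Tendsto (fun n : ℕ => Real.log n / (n : ℝ)) atTop (𝓝 0) :=
    Real.isLittleO_log_id_atTop.tendsto_div_nhds_zero.comp tendsto_natCast_atTop_atTop
  simpa [mul_div_mul_comm, mul_comm] using h.mul_const (16 / d)

theorem theorem1 :
    ∃ C : ℝ, 0 < C ∧
      ∀ (S A : Type*) [Fintype S] [Fintype A] [DecidableEq S] [DecidableEq A]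
        [MeasurableSpace S] [MeasurableSingletonClass S]
        [MeasurableSpace A] [MeasurableSingletonClass A]
        (H : ℕ) (_hH : 1 ≤ H) (M : TabularMDP S A H) (π μ : Policy S A H) (Rmax : ℝ)
        -- bounded rewards
        (_hR : ∀ t s a s', 0 < M.trans t s a s' →
          ∀ᵐ r ∂(M.reward t s a s'), 0 ≤ r ∧ r ≤ Rmax)
        -- sufficient exploration
        (_hs : ∀ (t : Fin H) (s : S), 0 < M.stateOcc μ t.castSucc s)
        -- finite action weights, and a finite threshold on the number of episodes
        (_ha : ∀ (t : Fin H) (s : S) (a : A), 0 < μ.prob t s a),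
        (∀ n : ℕ,
          max (16 * Real.log n / M.minStateActionOcc μ)
              (4 * H * actionWeight π μ * M.stateWeight π μ / M.minMaxOcc π μ) < (n : ℝ) →
          TMIS.mse M π μ n ≤
            1 / (n : ℝ) * M.leadingVar π μ *
                (1 + Real.sqrt (16 * Real.log n / (n * M.minStateActionOcc μ))) +
              C * (actionWeight π μ ^ 2 * M.stateWeight π μ * (H : ℝ) ^ 3 * Rmax ^ 2 /
                ((n : ℝ) ^ 2 * M.minStateOcc μ))) ∧
        Tendsto (fun n : ℕ => (n : ℝ) * TMIS.mse M π μ n) atTop (𝓝 (M.leadingVar π μ)) := by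
  refine ⟨28, by norm_num, ?_⟩
  intro S A _ _ _ _ _ _ _ _ H hH M π μ R hM hs hμ
  have t₀ : Fin H := ⟨0, hH⟩
  obtain ⟨s₀⟩ := M.nonempty_state
  obtain ⟨a₀⟩ := μ.nonempty_action t₀ s₀
  have hR : 0 ≤ R := M.rewardBound_nonneg hM t₀ a₀
  set d := M.minStateActionOcc μ with hd
  have hd0 : 0 < d := TabularMDP.minStateActionOcc_pos hμ hs t₀ s₀ a₀
  have hupper : ∀ n : ℕ, max (16 * Real.log n / d)
      (4 * H * actionWeight π μ * M.stateWeight π μ / M.minMaxOcc π μ) < (n : ℝ) →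
      TMIS.mse M π μ n ≤ 1 / (n : ℝ) * M.leadingVar π μ *
          (1 + Real.sqrt (16 * Real.log n / (n * d))) +
        28 * (actionWeight π μ ^ 2 * M.stateWeight π μ * (H : ℝ) ^ 3 * R ^ 2 /
          ((n : ℝ) ^ 2 * M.minStateOcc μ)) := by
    intro n hcond
    obtain ⟨hn, h4, hSn, hq, hδ, hexp⟩ := TabularMDP.large_sample π hμ hs hH hcond
    have h := TabularMDP.mse_le π hμ hs hn (TabularMDP.le_actionWeight_mul π hμ)
      (TabularMDP.le_stateWeight_mul π hs) (TabularMDP.one_le_actionWeight π hμ t₀ s₀)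
      (TabularMDP.one_le_stateWeight π hs t₀) h4 hR hM (TabularMDP.minStateOcc_pos hs t₀ s₀)
      ((TabularMDP.minStateOcc_le t₀ s₀).trans (M.stateOcc_le_one μ _ _))
      TabularMDP.minStateOcc_le hSn (by positivity) hδ hexp hq
    rwa [mul_div_cancel₀ _ (two_ne_zero' ℝ)] at h
  refine ⟨hupper, ?_⟩
  have hlog := tendsto_log_div_mul_atTop d
  have hcond : ∀ᶠ n : ℕ in atTop, max (16 * Real.log n / d)
      (4 * H * actionWeight π μ * M.stateWeight π μ / M.minMaxOcc π μ) < (n : ℝ) := by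
    filter_upwards [hlog.eventually (gt_mem_nhds zero_lt_one), eventually_gt_atTop 0,
      tendsto_natCast_atTop_atTop.eventually_gt_atTop
        (4 * H * actionWeight π μ * M.stateWeight π μ / M.minMaxOcc π μ)] with n h1 h2 h3
    have hn : (0 : ℝ) < n := Nat.cast_pos.2 h2
    refine max_lt ?_ h3
    rw [div_lt_one (by positivity)] at h1
    rwa [div_lt_iff₀ hd0]
  obtain ⟨K₁, K₂, hK₁, hK₂, hlower⟩ := TabularMDP.le_mse π hμ hs hR hM
  have hinv : Tendsto (fun n : ℕ => (n : ℝ)⁻¹) atTop (𝓝 0) := tendsto_inv_atTop_nhds_zero_nat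
  have hlow : Tendsto (fun n : ℕ => M.leadingVar π μ -
      (K₁ * H * (n : ℝ)⁻¹ * (n : ℝ)⁻¹ + K₂ * H * (n : ℝ)⁻¹)) atTop (𝓝 (M.leadingVar π μ)) := by
    simpa using tendsto_const_nhds.sub
      ((((hinv.const_mul (K₁ * H)).mul hinv)).add (hinv.const_mul (K₂ * H)))
  have hupp : Tendsto (fun n : ℕ => M.leadingVar π μ *
      (1 + Real.sqrt (16 * Real.log n / (n * d))) +
        28 * (actionWeight π μ ^ 2 * M.stateWeight π μ * (H : ℝ) ^ 3 * R ^ 2 / M.minStateOcc μ) *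
          (n : ℝ)⁻¹) atTop (𝓝 (M.leadingVar π μ)) := by
    simpa using ((hlog.sqrt.const_add 1).const_mul (M.leadingVar π μ)).add
      (hinv.const_mul (28 * (actionWeight π μ ^ 2 * M.stateWeight π μ * (H : ℝ) ^ 3 * R ^ 2 /
        M.minStateOcc μ)))
  refine tendsto_of_tendsto_of_tendsto_of_le_of_le' hlow hupp ?_ ?_
  · filter_upwards [hcond] with n hc
    obtain ⟨hn, -, -, hq, -⟩ := TabularMDP.large_sample π hμ hs hH hc
    have hn' : (0 : ℝ) < n := Nat.cast_pos.2 hn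
    have h1 := mul_le_mul_of_nonneg_left hq (by positivity : 0 ≤ K₁ + n * K₂)
    have h2 : (K₁ + n * K₂) * (H / (n : ℝ) ^ 2) =
        K₁ * H * (n : ℝ)⁻¹ * (n : ℝ)⁻¹ + K₂ * H * (n : ℝ)⁻¹ := by
      field_simp
    linarith [hlower n hn]
  · filter_upwards [hcond] with n hc
    obtain ⟨hn, -⟩ := TabularMDP.large_sample π hμ hs hH hc
    have hn' : (0 : ℝ) < n := Nat.cast_pos.2 hn
    have hm := TabularMDP.minStateOcc_pos hs t₀ s₀
    refine (mul_le_mul_of_nonneg_left (hupper n hc) hn'.le).trans (le_of_eq ?_)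
    field_simp
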